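/- **Theorem.** Let $\Sigma=\{0,1\}^k$ and $\mathcal R=\{0,1\}^r$, with $\oplus$ the bitwise exclusive or, and let $c\ge 0$, $d\ge 2$. A simple tabulation hash function on $\Sigma^m$ is $y\mapsto T_1[y_1]\oplus\cdots\oplus T_m[y_m]$, with independent, fully random tables $T_j$. For $x\in\Sigma^c$ the derived key $\tilde h(x)=\tilde x\in\Sigma^{c+d}$ of simple tornado tabulation with $d$ derived characters is given by $\tilde x_i=x_i$ for $i\le c$ and $\tilde x_{c+i}=\tilde h_i(\tilde x_1\cdots\tilde x_{c+i-1})$ for $1\le i\le d$, and the hash value is $h(x)=\widehat h(\tilde x)\in\mathcal R$, where $\tilde h_i:\Sigma^{c+i-1}\to\Sigma$ $(1\le i\le d)$ and $\widehat h:\Sigma^{c+d}\to\mathcal R$ are independent random simple tabulation hash functions. A set $Y$ of keys is linearly independent if for every nonempty $Z\subseteq Y$ there is a position in which some character occurs an odd number of times among the keys of $Z$. Let $A\subseteq\Sigma^c$ be a set of $n\ge 1$ keys and let $s:\Sigma^c\times\mathcal R\to\{0,1\}$ be a selector function under which all keys of $A$ have the same selection probability and the other keys are never selected: for some $p$, $\Pr_{v\sim\mathcal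 U(\mathcal R)}[s(x,v)=1]$ is $p$ for $x\in A$ and $0$ for $x\notin A$. Let $X=\{x\in\Sigma^c : s(x,h(x))=1\}$ be the set of selected keys, $\mu=\sum_{x\in\Sigma^c}\Pr_{v\sim\mathcal U(\mathcal R)}[s(x,v)=1]$ $(=np)$, and $f=\mu/|\Sigma|$. If $\mu\le|\Sigma|/2$, then $$\Pr\bigl[\tilde h(X)\text{ is not linearly independent}\bigr]\;\le\;\frac{3^c|\Sigma|}{n}\cdot 3\mu^3\Bigl(\frac{3}{|\Sigma|}\Bigr)^{d+1}+f^{|\Sigma|/2}.$$ The same bound holds for tornado tabulation with a twisted last character, in which (for $c\ge1$) $x_c$ is first replaced by $x_c\oplus h_0(x_1\cdots x_{c-1})$, with a further independent random simple tabulation hash function $h_0:\Sigma^{c-1}\to\Sigma$. -/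

import Mathlib

/-- Bit strings of length `k`; the pointwise addition is the exclusive or.
The alphabet is `BitString k`, the set of hash values is `BitString r`. -/
abbrev BitString (k : ℕ) : Type := Fin k → ZMod 2

namespace Tornado

/-- Keys of `m` characters from the alphabet `BitString k`. -/
abbrev Key (k m : ℕ) : Type := Fin m → BitString k

/-- The `m` lookup tables (one for each position) of a simple tabulation hash function
on keys of `m` characters, with values in `BitString l`. -/
abbrev Tables (k l m : ℕ) : Type := Fin m → BitString k → BitString l

/-- Simple tabulation hashing: the exclusive or of the `m` table lookups. -/
def simpleTab {k l m : ℕ} (T : Tables k l m) (x : Key k m) : BitString l :=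
  ∑ j, T j (x j)

/-- The tables of the simple tabulation functions that compute the `d` derived characters;
the derived character with (zero-based) index `i` is computed from a key of `c + i` characters. -/
abbrev DerivedTables (k c d : ℕ) : Type :=
  (i : Fin d) → Tables k k (c + (i : ℕ))

/-- The derived key of simple tornado tabulation: the `c` characters of `x` are kept, then
`d` characters are appended one after the other, each of them being the value of its own simple
tabulation function at the key built so far. -/
def derivedKey {k c : ℕ} : (d : ℕ) → DerivedTables k c d → Key k c → Key k (c + d)
  | 0, _, x => x
  | d + 1, T, x =>
      let y : Key k (c + d) := derivedKey d (fun i => T i.castSucc) x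
      Fin.snoc (α := fun _ => BitString k) y (simpleTab (T (Fin.last d)) y)

/-- The twist of (non-simple) tornado tabulation: the last character `x_c` is replaced by
`x_c ⊕ h₀(x_1 ⋯ x_{c-1})`, with `h₀` a simple tabulation function; the other characters are
kept. -/
def twist {k c : ℕ} (T₀ : Tables k k (c - 1)) (x : Key k c) : Key k c :=
  fun i =>
    if (i : ℕ) + 1 = c then
      x i + simpleTab T₀ (fun j => x ⟨(j : ℕ), lt_of_lt_of_le j.isLt (Nat.sub_le c 1)⟩)
    else x i

/-- A set `Y` of keys is linearly independent if for every nonempty subset `Z` there is a character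
that occurs an odd number of times in some position across the keys of `Z`. -/
def LinIndep {k m : ℕ} (Y : Set (Key k m)) : Prop :=
  ∀ Z : Finset (Key k m), Z.Nonempty → (Z : Set (Key k m)) ⊆ Y →
    ∃ (i : Fin m) (a : BitString k), Odd (Z.filter (fun y => y i = a)).card

/-- The probability of the event `E` for a uniformly random element of the finite type `Ω`. -/
noncomputable def uniformProb {Ω : Type} (E : Ω → Prop) : ℝ :=
  (Nat.card {ω : Ω // E ω} : ℝ) / (Nat.card Ω : ℝ)

/-- The set of selected keys of the selector function `f` under the hash function `h`. -/
def selected {k r c : ℕ} (f : Key k c → BitString r → Bool) (h : Key k c → BitString r) :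
    Set (Key k c) :=
  {x | f x (h x) = true}

/-- The probability `p_x` that the key `x` is selected when its hash value is uniform. -/
noncomputable def selProb {k r c : ℕ} (f : Key k c → BitString r → Bool) (x : Key k c) : ℝ :=
  uniformProb (fun v : BitString r => f x v = true)

/-- The expected number `μ = ∑ x, p_x` of selected keys. -/
noncomputable def expectedSize {k r c : ℕ} (f : Key k c → BitString r → Bool) : ℝ :=
  ∑ x, selProb f x

/-- The probability, over fully random and independent tables, that the derived keys of the keys
selected by `f` are not linearly independent, for simple tornado tabulation hashing
`h = simpleTab That ∘ derivedKey d T` with `d` derived characters. -/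
noncomputable def simpleFailProb {k r c : ℕ} (d : ℕ) (f : Key k c → BitString r → Bool) : ℝ :=
  uniformProb (fun ω : DerivedTables k c d × Tables k r (c + d) =>
    ¬ LinIndep (derivedKey d ω.1 '' selected f (fun x => simpleTab ω.2 (derivedKey d ω.1 x))))

/-- The same probability for tornado tabulation hashing with the last original character
twisted, `h = simpleTab That ∘ derivedKey d T ∘ twist T₀`. -/
noncomputable def twistedFailProb {k r c : ℕ} (d : ℕ) (f : Key k c → BitString r → Bool) : ℝ :=
  uniformProb (fun ω : Tables k k (c - 1) × DerivedTables k c d × Tables k r (c + d) =>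
    ¬ LinIndep ((fun x => derivedKey d ω.2.1 (twist ω.1 x)) ''
      selected f (fun x => simpleTab ω.2.2 (derivedKey d ω.2.1 (twist ω.1 x)))))

/-- The bound `(3^c |Σ| / n) · 3 μ³ (3 / |Σ|)^(d+1) + (μ / |Σ|)^(|Σ| / 2)`, with `σ = |Σ|`. -/
noncomputable def failBound (σ n μ : ℝ) (c d : ℕ) : ℝ :=
  (3 ^ c * σ / n) * (3 * μ ^ 3 * (3 / σ) ^ (d + 1)) + (μ / σ) ^ (σ / 2)

end Tornado

/-! Write s = 2^k, n = |A|, μ = np and φ = μ/s ≤ 1/2. If the derived keys of the selected set X are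
dependent, then X contains a circuit Z: a minimal nonempty set among whose derived keys every
position character occurs an even number of times. Random tables take independent uniform values at
linearly independent vectors over 𝔽₂ (`avg_evalTab`). Hence each independent equation between
derived characters costs a factor 1/s (`avg_matched_le`), and each key of an independent set is
selected with an independent probability p (`avg_selected_le`).

The last two derived characters are constant on the pairs of two fixed-point-free involutions σ, τ
of Z. The circuit is explored along the alternating paths of σ and τ, one σ-edge at a time, until
the σ-edges become dependent as vectors of keys without these two characters, or until 2L keys are
reached (`exists_obstruction`). On 2t explored keys there are t σ-edges and t-1 τ-edges. By
minimality of Z the τ-edges are independent one level up, and so are the fully derived keys of every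
proper subset of Z.

If 2L keys are reached, there are 2L-1 equations and 2L selections against about n^(2L) choices,
which leaves s φ^(2L) up to a moderate factor; for suitable L this is below φ^(s/2). If a dependency
appears at 2t keys, there are 2t-2 equations and 2t-1 selections, and moreover some zero set exists
among keys with only d-2 derived characters. The expected number of such configurations has order
3^c (3/s)^(d-2) n^(2t-2), so the contribution is p φ^(2t-2) 3^c (3/s)^(d-2) times a weight. As φ² ≤
1/4, these add up to at most 81 p φ² 3^c (3/s)^(d-2), the first term of the bound.

Zero sets are counted level by level. Four original keys from A sum to zero in at most 3^c n² ways: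
three pairings for each position, combined by Cauchy–Schwarz and tensorisation (`quadBound_keyVec`).
Any further keys are chosen freely. A circuit of 2w keys with one more derived character requires
w-1 independent equations along one of (2w-1)!! perfect matchings (`avg_circ_ext_le`); for w = 2
this is the factor 3/s. A zero set that is no circuit contains a circuit of at most half its size
(`exists_circ_half`), which closes the recursion (`circAvg_le`). There remains a numerical choice of
L and of weights for the circuits (`exists_goodWeights`). The twist is a permutation of the keys for
fixed tables and is absorbed into the selector. -/

namespace Tornado

/-! ### Indicators and averages -/

/-- The real-valued indicator of a proposition. -/
noncomputable def ind (P : Prop) : ℝ := by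
  classical exact if P then 1 else 0

theorem ind_true {P : Prop} (h : P) : ind P = 1 := by simp [ind, h]

theorem ind_false {P : Prop} (h : ¬ P) : ind P = 0 := by simp [ind, h]

theorem ind_nonneg (P : Prop) : 0 ≤ ind P := by
  unfold ind; split_ifs <;> norm_num

theorem ind_le_one (P : Prop) : ind P ≤ 1 := by
  unfold ind; split_ifs <;> norm_num

theorem ind_mono {P Q : Prop} (h : P → Q) : ind P ≤ ind Q := by
  by_cases hP : P
  · rw [ind_true hP, ind_true (h hP)]
  · rw [ind_false hP]; exact ind_nonneg Q

theorem ind_and (P Q : Prop) : ind (P ∧ Q) = ind P * ind Q := by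
  by_cases hP : P <;> by_cases hQ : Q <;> simp [ind, hP, hQ]

theorem ind_or_le (P Q : Prop) : ind (P ∨ Q) ≤ ind P + ind Q := by
  by_cases hP : P <;> by_cases hQ : Q <;> simp [ind, hP, hQ]

theorem ind_congr {P Q : Prop} (h : P ↔ Q) : ind P = ind Q := by
  rw [propext h]

theorem ind_exists_le {α : Type*} (s : Finset α) (P : α → Prop) :
    ind (∃ a ∈ s, P a) ≤ ∑ a ∈ s, ind (P a) := by
  by_cases h : ∃ a ∈ s, P a
  · obtain ⟨a, ha, hPa⟩ := h
    refine (ind_le_one _).trans ?_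
    rw [← ind_true hPa]
    exact Finset.single_le_sum (f := fun a => ind (P a)) (fun _ _ => ind_nonneg _) ha
  · rw [ind_false h]
    exact Finset.sum_nonneg fun _ _ => ind_nonneg _

theorem sum_ind_eq_card {α : Type*} (s : Finset α) (P : α → Prop) [DecidablePred P] :
    ∑ a ∈ s, ind (P a) = ((s.filter P).card : ℝ) := by
  rw [Finset.card_filter, Nat.cast_sum]
  refine Finset.sum_congr rfl fun a _ => ?_
  by_cases h : P a <;> simp [ind, h]

/-- The average of a real function on a finite type. -/
noncomputable def avg {Ω : Type*} [Fintype Ω] (F : Ω → ℝ) : ℝ :=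
  (∑ ω, F ω) / Fintype.card Ω

section avg

variable {Ω Ω' : Type*} [Fintype Ω] [Fintype Ω']

theorem avg_mono {F G : Ω → ℝ} (h : ∀ ω, F ω ≤ G ω) : avg F ≤ avg G := by
  unfold avg
  gcongr with ω
  exact h ω

theorem avg_const [Nonempty Ω] (a : ℝ) : avg (fun _ : Ω => a) = a := by
  unfold avg
  simp

theorem avg_le_of_le [Nonempty Ω] {F : Ω → ℝ} {a : ℝ} (h : ∀ ω, F ω ≤ a) : avg F ≤ a :=
  (avg_mono h).trans_eq (avg_const a)

theorem avg_sum {α : Type*} (s : Finset α) (F : α → Ω → ℝ) :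
    avg (fun ω => ∑ a ∈ s, F a ω) = ∑ a ∈ s, avg (F a) := by
  unfold avg
  rw [Finset.sum_comm, Finset.sum_div]

theorem avg_add (F G : Ω → ℝ) : avg (fun ω => F ω + G ω) = avg F + avg G := by
  unfold avg
  rw [Finset.sum_add_distrib, add_div]

theorem avg_mul_left (a : ℝ) (F : Ω → ℝ) : avg (fun ω => a * F ω) = a * avg F := by
  unfold avg
  rw [← Finset.mul_sum, mul_div_assoc]

theorem avg_mul_right (a : ℝ) (F : Ω → ℝ) : avg (fun ω => F ω * a) = avg F * a := by
  simp_rw [mul_comm _ a, avg_mul_left]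

theorem avg_equiv (e : Ω ≃ Ω') (F : Ω' → ℝ) : avg (fun ω => F (e ω)) = avg F := by
  unfold avg
  rw [Equiv.sum_comp e F, Fintype.card_congr e]

theorem avg_prod (F : Ω × Ω' → ℝ) : avg F = avg fun ω => avg fun ω' => F (ω, ω') := by
  unfold avg
  rw [Fintype.sum_prod_type, Fintype.card_prod, ← Finset.sum_div, div_div]
  push_cast
  rw [mul_comm]

theorem avg_prod_swap (F : Ω × Ω' → ℝ) : avg F = avg fun ω' => avg fun ω => F (ω, ω') := by
  rw [← avg_equiv (Equiv.prodComm Ω' Ω) F, avg_prod]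
  rfl

theorem uniformProb_eq_avg {Ω : Type} [Fintype Ω] (E : Ω → Prop) :
    uniformProb E = avg fun ω => ind (E ω) := by
  classical
  unfold uniformProb avg
  rw [sum_ind_eq_card, Nat.card_eq_fintype_card, Nat.card_eq_fintype_card, Fintype.card_subtype]

/-- Averages are preserved by surjective homomorphisms of finite groups. -/
theorem avg_comp_surjective {G H : Type*} [AddGroup G] [AddGroup H] [Fintype G] [Fintype H]
    (φ : G →+ H) (hφ : Function.Surjective φ) (F : H → ℝ) :
    avg (fun g => F (φ g)) = avg F := by
  classical
  have hfib : ∀ h : H, (Finset.univ.filter fun g => φ g = h).card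
      = (Finset.univ.filter fun g => φ g = 0).card := fun h =>
    AddMonoidHom.card_fiber_eq_of_mem_range φ (hφ h) (hφ 0)
  set N := (Finset.univ.filter fun g => φ g = 0).card with hN
  have hcard : Fintype.card G = Fintype.card H * N := by
    rw [← Finset.card_univ, Finset.card_eq_sum_card_fiberwise (f := φ) (t := Finset.univ)
      (fun _ _ => Finset.mem_coe.2 (Finset.mem_univ _))]
    simp [hfib]
  have hsum : ∑ g, F (φ g) = (∑ h, F h) * N := by
    rw [← Finset.sum_fiberwise (s := Finset.univ) (g := φ) (f := fun g => F (φ g)),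
      Finset.sum_mul]
    refine Finset.sum_congr rfl fun h _ => ?_
    rw [Finset.sum_congr rfl (g := fun _ => F h)
      (fun g hg => by rw [(Finset.mem_filter.1 hg).2]), Finset.sum_const, hfib, nsmul_eq_mul,
      mul_comm]
  have hN0 : (N : ℝ) ≠ 0 := by
    have : 0 < N := Finset.card_pos.2 ⟨0, by simp⟩
    positivity
  unfold avg
  rw [hsum, hcard]
  push_cast
  exact mul_div_mul_right _ _ hN0

/-- Independent coordinates: the average of a product is the product of the averages. -/
theorem avg_pi_prod {ι β : Type*} [Fintype ι] [DecidableEq ι] [Fintype β] (F : ι → β → ℝ) :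
    avg (fun b : ι → β => ∏ i, F i (b i)) = ∏ i, avg (F i) := by
  unfold avg
  rw [Finset.prod_div_distrib, Finset.prod_univ_sum, Fintype.card_fun]
  simp

end avg

/-! ### Keys as vectors over 𝔽₂ and tables as linear maps -/

/-- Vectors over `𝔽₂` indexed by position characters. -/
abbrev GenKey (k m : ℕ) : Type := Fin m × BitString k → ZMod 2

/-- The indicator vector of the position characters of a key. -/
def keyVec {k m : ℕ} (y : Key k m) : GenKey k m := fun q => if y q.1 = q.2 then 1 else 0

theorem keyVec_injective {k m : ℕ} : Function.Injective (keyVec : Key k m → GenKey k m) := by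
  intro x y h
  funext j
  have := congrFun h (j, y j)
  simp only [keyVec, if_true] at this
  by_contra hne
  simp [hne] at this

/-- The linear extension of a simple tabulation function to generalized keys. -/
def evalTab {k l m : ℕ} (T : Tables k l m) : GenKey k m →ₗ[ZMod 2] BitString l :=
  Fintype.linearCombination (ZMod 2) fun q : Fin m × BitString k => T q.1 q.2

theorem evalTab_apply {k l m : ℕ} (T : Tables k l m) (g : GenKey k m) :
    evalTab T g = ∑ q : Fin m × BitString k, g q • T q.1 q.2 := rfl

theorem evalTab_keyVec {k l m : ℕ} (T : Tables k l m) (y : Key k m) :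
    evalTab T (keyVec y) = simpleTab T y := by
  rw [evalTab_apply, Fintype.sum_prod_type]
  simp [keyVec, simpleTab]

theorem exists_evalTab_eq {k l m : ℕ} (L : GenKey k m →ₗ[ZMod 2] BitString l) :
    ∃ T : Tables k l m, evalTab T = L := by
  classical
  refine ⟨fun j a => L (Pi.single (j, a) 1), LinearMap.ext fun g => ?_⟩
  rw [evalTab_apply, LinearMap.pi_apply_eq_sum_univ L g]
  refine Finset.sum_congr rfl fun q _ => ?_
  congr 2
  funext q'
  simp [Pi.single_apply, eq_comm]

/-- Prescribed values on an independent family extend linearly from its span to all generalized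
keys, and every linear map is given by tables. -/
theorem exists_evalTab_of_linearIndependent {k l m : ℕ} {ι : Type*} {v : ι → GenKey k m}
    (hv : LinearIndependent (ZMod 2) v) (b : ι → BitString l) :
    ∃ T : Tables k l m, ∀ i, evalTab T (v i) = b i := by
  obtain ⟨L, hL⟩ := LinearMap.exists_extend ((Module.Basis.span hv).constr (ZMod 2) b)
  obtain ⟨T, rfl⟩ := exists_evalTab_eq L
  refine ⟨T, fun i => ?_⟩
  have h1 := LinearMap.congr_fun hL (Module.Basis.span hv i)
  rw [Module.Basis.constr_basis] at h1
  rw [← h1, LinearMap.comp_apply, Submodule.subtype_apply, Module.Basis.span_apply]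

/-- Fully random tables take uniform and independent values at linearly independent vectors. -/
theorem avg_evalTab {k l m : ℕ} {ι : Type*} [Fintype ι] [DecidableEq ι] {v : ι → GenKey k m}
    (hv : LinearIndependent (ZMod 2) v) (F : (ι → BitString l) → ℝ) :
    avg (fun T : Tables k l m => F fun i => evalTab T (v i)) = avg F := by
  let φ : Tables k l m →+ (ι → BitString l) :=
    { toFun := fun T i => evalTab T (v i)
      map_zero' := by funext i; simp [evalTab_apply]
      map_add' := fun S T => by
        funext i; simp [evalTab_apply, smul_add, Finset.sum_add_distrib] }
  refine avg_comp_surjective φ (fun b => ?_) F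
  obtain ⟨T, hT⟩ := exists_evalTab_of_linearIndependent hv b
  exact ⟨T, funext hT⟩

/-- A family over `𝔽₂` without vanishing nonempty subsums is linearly independent. -/
theorem linearIndependent_of_sum_ne_zero {ι E : Type*} [AddCommGroup E]
    [Module (ZMod 2) E] (s : Finset ι) (v : ι → E)
    (h : ∀ S ⊆ s, S.Nonempty → ∑ i ∈ S, v i ≠ 0) :
    LinearIndependent (ZMod 2) (fun i : s => v i) := by
  classical
  rw [Fintype.linearIndependent_iff]
  intro g hg
  by_contra! hne
  obtain ⟨i₀, hi₀⟩ := hne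
  let S : Finset ι := (Finset.univ.filter fun i : s => g i ≠ 0).map ⟨Subtype.val,
    Subtype.val_injective⟩
  refine h S ?_ ⟨i₀, ?_⟩ ?_
  · intro x hx
    simp only [S, Finset.mem_map, Function.Embedding.coeFn_mk] at hx
    obtain ⟨a, -, rfl⟩ := hx
    exact a.2
  · simp only [S, Finset.mem_map, Function.Embedding.coeFn_mk]
    exact ⟨i₀, by simp [hi₀], rfl⟩
  · rw [Finset.sum_map, Finset.sum_filter]
    refine Eq.trans ?_ hg
    refine Finset.sum_congr rfl fun i _ => ?_
    by_cases hi : g i = 0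
    · simp [hi]
    · have : g i = 1 := by
        generalize g i = a at hi
        revert hi a; decide
      simp [this]

theorem card_bitString (k : ℕ) : Fintype.card (BitString k) = 2 ^ k := by
  simp [BitString]

theorem add_self_bits {ι : Type*} (g : ι → ZMod 2) : g + g = 0 :=
  funext fun _ => CharTwo.add_self_eq_zero _

theorem eq_of_add_bits_eq_zero {ι : Type*} {g g' : ι → ZMod 2} (h : g + g' = 0) : g = g' :=
  funext fun i => CharTwo.add_eq_zero.1 (congrFun h i)

/-! ### Zero sets, circuits and the cost of independent events -/

section keys

variable {K : Type*} {k l m : ℕ}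

/-- The keys `y x`, `x ∈ Z`, form a zero set: every position character occurs an even number of
times. -/
def Zero (y : K → Key k m) (Z : Finset K) : Prop := ∑ x ∈ Z, keyVec (y x) = 0

/-- A minimal nonempty zero set. -/
def Circ (y : K → Key k m) (Z : Finset K) : Prop :=
  Z.Nonempty ∧ Zero y Z ∧ ∀ Z' ⊂ Z, Z'.Nonempty → ¬ Zero y Z'

/-- No nonempty subset is a zero set. -/
def IndepKeys (y : K → Key k m) (V : Finset K) : Prop :=
  ∀ S ⊆ V, S.Nonempty → ¬ Zero y S

/-- The sums of the two end points of the edges are linearly independent. -/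
def IndepEdges (y : K → Key k m) (E : Finset (K × K)) : Prop :=
  ∀ S ⊆ E, S.Nonempty → ∑ e ∈ S, (keyVec (y e.1) + keyVec (y e.2)) ≠ 0

/-- The end points of each edge have the same hash value. -/
def Matched (T : Tables k l m) (y : K → Key k m) (E : Finset (K × K)) : Prop :=
  ∀ e ∈ E, simpleTab T (y e.1) = simpleTab T (y e.2)

/-- Append to each key its hash value under a simple tabulation function. -/
def ext (T : Tables k k m) (y : K → Key k m) : K → Key k (m + 1) := fun x =>
  Fin.snoc (α := fun _ => BitString k) (y x) (simpleTab T (y x))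

theorem ext_castSucc (T : Tables k k m) (y : K → Key k m) (x : K) (j : Fin m) :
    ext T y x j.castSucc = y x j := by simp [ext]

theorem ext_last (T : Tables k k m) (y : K → Key k m) (x : K) :
    ext T y x (Fin.last m) = simpleTab T (y x) := by simp [ext]

theorem ext_injective (T : Tables k k m) {y : K → Key k m} (hy : Function.Injective y) :
    Function.Injective (ext T y) := by
  intro x x' h
  refine hy (funext fun j => ?_)
  rw [← ext_castSucc T y x, ← ext_castSucc T y x', h]

theorem zero_iff [DecidableEq K] (y : K → Key k m) (Z : Finset K) :
    Zero y Z ↔ ∀ j a, Even (Z.filter fun x => y x j = a).card := by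
  unfold Zero
  constructor
  · intro h j a
    have := congrFun h (j, a)
    simp only [Finset.sum_apply, keyVec, Finset.sum_boole, Pi.zero_apply] at this
    exact ZMod.natCast_eq_zero_iff_even.1 this
  · intro h
    funext ⟨j, a⟩
    simp only [Finset.sum_apply, keyVec, Finset.sum_boole, Pi.zero_apply]
    exact ZMod.natCast_eq_zero_iff_even.2 (h j a)

theorem zero_of_zero_ext [DecidableEq K] {T : Tables k k m} {y : K → Key k m} {Z : Finset K}
    (h : Zero (ext T y) Z) : Zero y Z := by
  rw [zero_iff] at h ⊢
  intro j a
  simpa [ext_castSucc] using h j.castSucc a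

theorem even_of_zero_ext [DecidableEq K] {T : Tables k k m} {y : K → Key k m} {Z : Finset K}
    (h : Zero (ext T y) Z) (a : BitString k) :
    Even (Z.filter fun x => simpleTab T (y x) = a).card := by
  rw [zero_iff] at h
  simpa [ext_last] using h (Fin.last m) a

/-- At the new position the two end points of a matched edge cancel, so a dependency among matched
edges survives the extension. Contrapositively, minimality of a circuit of extended keys makes its
edges independent before the extension. -/
theorem sum_edges_ext {T : Tables k k m} {y : K → Key k m} {S : Finset (K × K)}
    (hT : Matched T y S) (h : ∑ e ∈ S, (keyVec (y e.1) + keyVec (y e.2)) = 0) :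
    ∑ e ∈ S, (keyVec (ext T y e.1) + keyVec (ext T y e.2)) = 0 := by
  funext ⟨j, a⟩
  simp only [Finset.sum_apply, Pi.add_apply, Pi.zero_apply]
  induction j using Fin.lastCases with
  | last =>
    refine Finset.sum_eq_zero fun e he => ?_
    simp only [keyVec, ext_last, hT e he]
    exact CharTwo.add_self_eq_zero _
  | cast j =>
    have := congrFun h (j, a)
    simpa [keyVec, ext_castSucc, Finset.sum_apply] using this

theorem zero_sdiff [DecidableEq K] {y : K → Key k m} {Z Z' : Finset K} (h : Zero y Z)
    (h' : Zero y Z') (hs : Z' ⊆ Z) : Zero y (Z \ Z') := by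
  unfold Zero at *
  rw [← Finset.sum_sdiff hs, h', add_zero] at h
  exact h

theorem exists_circ_subset [DecidableEq K] {y : K → Key k m} (Z : Finset K) (hn : Z.Nonempty)
    (hz : Zero y Z) : ∃ Y ⊆ Z, Circ y Y := by
  induction Z using Finset.strongInduction with
  | H Z ih =>
    by_cases h : Circ y Z
    · exact ⟨Z, subset_rfl, h⟩
    · simp only [Circ, hn, hz, true_and, not_forall, not_not] at h
      obtain ⟨Z', hss, hn', hz'⟩ := h
      obtain ⟨Y, hY, hc⟩ := ih Z' hss hn' hz'
      exact ⟨Y, hY.trans hss.1, hc⟩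

/-- A zero set that is not minimal splits into a smaller zero set and its complement, again a zero
set; the smaller half contains the circuit. -/
theorem exists_circ_half [DecidableEq K] {y : K → Key k m} {Z : Finset K} (hn : Z.Nonempty)
    (hz : Zero y Z) (hc : ¬ Circ y Z) : ∃ Y ⊆ Z, Circ y Y ∧ 2 * Y.card ≤ Z.card := by
  simp only [Circ, hn, hz, true_and, not_forall, not_not] at hc
  obtain ⟨Z', hss, hn', hz'⟩ := hc
  have hadd := Finset.card_sdiff_add_card_eq_card hss.1
  rcases le_total (2 * Z'.card) Z.card with h | h
  · obtain ⟨Y, hY, hc⟩ := exists_circ_subset Z' hn' hz'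
    exact ⟨Y, hY.trans hss.1, hc, by have := Finset.card_le_card hY; omega⟩
  · have hn2 : (Z \ Z').Nonempty := Finset.sdiff_nonempty.2 hss.2
    obtain ⟨Y, hY, hc⟩ := exists_circ_subset (Z \ Z') hn2 (zero_sdiff hz hz' hss.1)
    exact ⟨Y, hY.trans Finset.sdiff_subset, hc, by have := Finset.card_le_card hY; omega⟩

theorem even_card_of_zero [DecidableEq K] {y : K → Key k m} (hm : 0 < m) {Z : Finset K}
    (h : Zero y Z) : Even Z.card := by
  rw [zero_iff] at h
  rw [Finset.card_eq_sum_card_fiberwise (f := fun x => y x ⟨0, hm⟩) (t := Finset.univ)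
    (fun _ _ => Finset.mem_coe.2 (Finset.mem_univ _))]
  exact Finset.even_sum _ fun a _ => h _ a

theorem card_ne_two_of_zero [DecidableEq K] {y : K → Key k m} (hy : Function.Injective y)
    {Z : Finset K} (h : Zero y Z) : Z.card ≠ 2 := by
  intro h2
  obtain ⟨a, b, hab, rfl⟩ := Finset.card_eq_two.1 h2
  unfold Zero at h
  rw [Finset.sum_pair hab] at h
  exact hab (hy (keyVec_injective (eq_of_add_bits_eq_zero h)))

/-- Nonempty zero sets have at least four keys. -/
theorem exists_card_of_zero [DecidableEq K] {y : K → Key k m} (hy : Function.Injective y)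
    (hm : 0 < m) {Z : Finset K} (hn : Z.Nonempty) (h : Zero y Z) :
    ∃ w, 2 ≤ w ∧ Z.card = 2 * w := by
  obtain ⟨w, hw⟩ := even_card_of_zero hm h
  have h0 := hn.card_pos
  have h2 := card_ne_two_of_zero hy h
  exact ⟨w, by omega, by omega⟩

/-- An edge is matched when the linear extension of the hash function vanishes at the sum of its end
points. At independent edges these values are independent and uniform. Independence does not depend
on `T`; without it the event is empty. -/
theorem avg_matched_le (y : K → Key k m) (E : Finset (K × K)) :
    avg (fun T : Tables k l m => ind (IndepEdges y E ∧ Matched T y E))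
      ≤ (1 / 2 ^ l : ℝ) ^ E.card := by
  classical
  by_cases hE : IndepEdges y E
  · have hv := linearIndependent_of_sum_ne_zero E
      (fun e => keyVec (y e.1) + keyVec (y e.2)) hE
    have := avg_evalTab (l := l) hv fun b => ∏ i, ind (b i = 0)
    rw [avg_pi_prod (fun _ b => ind (b = 0))] at this
    have h1 : avg (fun b : BitString l => ind (b = 0)) = 1 / 2 ^ l := by
      unfold avg
      rw [sum_ind_eq_card, card_bitString]
      simp [Finset.filter_eq']
    simp only [h1, Finset.prod_const, Finset.card_univ, Fintype.card_coe] at this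
    rw [← this]
    refine avg_mono fun T => ?_
    by_cases hT : Matched T y E
    · refine (ind_le_one _).trans (le_of_eq ?_)
      symm
      refine Finset.prod_eq_one fun e _ => ind_true ?_
      rw [map_add, evalTab_keyVec, evalTab_keyVec, hT e e.2]
      exact add_self_bits _
    · rw [ind_false (fun h => hT h.2)]
      exact Finset.prod_nonneg fun _ _ => ind_nonneg _
  · refine avg_le_of_le fun T => ?_
    rw [ind_false (fun h => hE h.1)]
    positivity

theorem avg_selected_le {c r : ℕ} (f : Key k c → BitString r → Bool) (y : Key k c → Key k m)
    (V : Finset (Key k c)) :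
    avg (fun T : Tables k r m =>
        ind (IndepKeys y V ∧ ∀ x ∈ V, f x (simpleTab T (y x)) = true))
      ≤ ∏ x ∈ V, selProb f x := by
  classical
  have hnn : ∀ x, 0 ≤ selProb f x := fun x => by unfold selProb uniformProb; positivity
  by_cases hV : IndepKeys y V
  · have hv := linearIndependent_of_sum_ne_zero V (fun x => keyVec (y x)) hV
    have := avg_evalTab (l := r) hv fun b => ∏ i : V, ind (f i (b i) = true)
    rw [avg_pi_prod (fun (i : V) b => ind (f i b = true))] at this
    have h1 : ∏ x ∈ V, selProb f x = ∏ i : V, avg fun b => ind (f i b = true) := by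
      rw [← Finset.prod_coe_sort]
      exact Finset.prod_congr rfl fun x _ => uniformProb_eq_avg _
    rw [h1, ← this]
    refine avg_mono fun T => ?_
    by_cases hT : ∀ x ∈ V, f x (simpleTab T (y x)) = true
    · refine (ind_le_one _).trans (le_of_eq ?_)
      symm
      refine Finset.prod_eq_one fun e _ => ind_true ?_
      have h2 := hT e e.2
      rw [← evalTab_keyVec] at h2
      exact h2
    · rw [ind_false (fun h => hT h.2)]
      exact Finset.prod_nonneg fun _ _ => ind_nonneg _
  · refine avg_le_of_le fun T => ?_
    rw [ind_false (fun h => hV h.1)]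
    exact Finset.prod_nonneg fun _ _ => hnn _

end keys

/-! ### Perfect matchings -/

/-- The number `(2 w - 1)!!` of perfect matchings of a set of `2 w` points. -/
def oddFact (w : ℕ) : ℕ := ∏ i ∈ Finset.range w, (2 * i + 1)

theorem oddFact_zero : oddFact 0 = 1 := rfl

theorem oddFact_succ (w : ℕ) : oddFact (w + 1) = (2 * w + 1) * oddFact w := by
  rw [oddFact, Finset.prod_range_succ, mul_comm]
  rfl

section matchings

variable {K : Type*} [DecidableEq K]

/-- The end points of the edges. -/
def supp (E : Finset (K × K)) : Finset K := E.biUnion fun e => {e.1, e.2}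

theorem mem_supp {E : Finset (K × K)} {x : K} : x ∈ supp E ↔ ∃ e ∈ E, x = e.1 ∨ x = e.2 := by
  simp [supp]

theorem supp_mono {E E' : Finset (K × K)} (h : E ⊆ E') : supp E ⊆ supp E' :=
  Finset.biUnion_subset_biUnion_of_subset_left _ h

theorem supp_insert (e : K × K) (E : Finset (K × K)) :
    supp (insert e E) = {e.1, e.2} ∪ supp E := Finset.biUnion_insert

theorem supp_nonempty {E : Finset (K × K)} (h : E.Nonempty) : (supp E).Nonempty := by
  obtain ⟨e, he⟩ := h
  exact ⟨e.1, mem_supp.2 ⟨e, he, Or.inl rfl⟩⟩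

/-- Pairwise disjoint edges. -/
def IsMatching (E : Finset (K × K)) : Prop :=
  (∀ e ∈ E, e.1 ≠ e.2) ∧
    ∀ e ∈ E, ∀ e' ∈ E, e ≠ e' → Disjoint ({e.1, e.2} : Finset K) {e'.1, e'.2}

theorem IsMatching.mono {E E' : Finset (K × K)} (h : IsMatching E') (hs : E ⊆ E') :
    IsMatching E :=
  ⟨fun e he => h.1 e (hs he), fun e he e' he' => h.2 e (hs he) e' (hs he')⟩

theorem IsMatching.sum_supp {M : Type*} [AddCommMonoid M] {E : Finset (K × K)}
    (h : IsMatching E) (F : K → M) : ∑ x ∈ supp E, F x = ∑ e ∈ E, (F e.1 + F e.2) := by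
  rw [supp, Finset.sum_biUnion (fun e he e' he' hne => h.2 e he e' he' hne)]
  exact Finset.sum_congr rfl fun e he => Finset.sum_pair (h.1 e he)

theorem IsMatching.card_supp {E : Finset (K × K)} (h : IsMatching E) :
    (supp E).card = 2 * E.card := by
  rw [Finset.card_eq_sum_ones, h.sum_supp, Finset.sum_const, smul_eq_mul, mul_comm]

/-- The perfect matchings of a set of `2 w` points; each edge is stored with one orientation. -/
noncomputable def perfectMatchings : ℕ → Finset K → Finset (Finset (K × K))
  | 0, _ => {∅}
  | w + 1, V =>
    if h : V.Nonempty then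
      (V.erase h.choose).biUnion fun x =>
        (perfectMatchings w ((V.erase h.choose).erase x)).image (insert (h.choose, x))
    else ∅

theorem perfectMatchings_zero (V : Finset K) : perfectMatchings 0 V = {∅} := rfl

theorem exists_perfectMatchings_succ (w : ℕ) {V : Finset K} (h : V.Nonempty) :
    ∃ x₀ ∈ V, perfectMatchings (w + 1) V = (V.erase x₀).biUnion fun x =>
      (perfectMatchings w ((V.erase x₀).erase x)).image (insert (x₀, x)) :=
  ⟨h.choose, h.choose_spec, by rw [perfectMatchings, dif_pos h]⟩

theorem card_perfectMatchings_le (w : ℕ) (V : Finset K) (hV : V.card = 2 * w) :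
    (perfectMatchings w V).card ≤ oddFact w := by
  induction w generalizing V with
  | zero => simp [perfectMatchings_zero, oddFact_zero]
  | succ w ih =>
    obtain ⟨x₀, hx₀, h⟩ := exists_perfectMatchings_succ w (V := V) (by
      rw [← Finset.card_pos]; omega)
    have hc : (V.erase x₀).card = 2 * w + 1 := by rw [Finset.card_erase_of_mem hx₀]; omega
    rw [h, oddFact_succ, ← hc]
    refine Finset.card_biUnion_le_card_mul _ _ _ fun x hx => Finset.card_image_le.trans (ih _ ?_)
    rw [Finset.card_erase_of_mem hx]; omega

theorem perfectMatchings_spec (w : ℕ) (V : Finset K) (hV : V.card = 2 * w)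
    {E : Finset (K × K)} (hE : E ∈ perfectMatchings w V) :
    IsMatching E ∧ supp E = V := by
  induction w generalizing V E with
  | zero =>
    rw [perfectMatchings_zero, Finset.mem_singleton] at hE
    subst hE
    have : V = ∅ := Finset.card_eq_zero.1 hV
    subst this
    simp [IsMatching, supp]
  | succ w ih =>
    obtain ⟨x₀, hx₀, h⟩ := exists_perfectMatchings_succ w (V := V) (by
      rw [← Finset.card_pos]; omega)
    rw [h] at hE
    simp only [Finset.mem_biUnion, Finset.mem_image] at hE
    obtain ⟨x, hx, E', hE', rfl⟩ := hE
    obtain ⟨hM, hs⟩ := ih ((V.erase x₀).erase x)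
      (by rw [Finset.card_erase_of_mem hx, Finset.card_erase_of_mem hx₀]; omega) hE'
    have hdis : ∀ e ∈ E', Disjoint ({x₀, x} : Finset K) {e.1, e.2} := by
      intro e he
      have h1 : e.1 ∈ supp E' := mem_supp.2 ⟨e, he, Or.inl rfl⟩
      have h2 : e.2 ∈ supp E' := mem_supp.2 ⟨e, he, Or.inr rfl⟩
      rw [hs] at h1 h2
      simp only [Finset.mem_erase] at h1 h2
      simp only [Finset.disjoint_insert_left, Finset.disjoint_singleton_left,
        Finset.mem_insert, Finset.mem_singleton, not_or]
      exact ⟨⟨Ne.symm h1.2.1, Ne.symm h2.2.1⟩, Ne.symm h1.1, Ne.symm h2.1⟩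
    refine ⟨⟨?_, ?_⟩, ?_⟩
    · intro e he
      rcases Finset.mem_insert.1 he with rfl | he
      · exact (Finset.ne_of_mem_erase hx).symm
      · exact hM.1 e he
    · intro e he e' he' hne
      rcases Finset.mem_insert.1 he with rfl | he <;> rcases Finset.mem_insert.1 he' with rfl | he'
      · exact absurd rfl hne
      · exact hdis e' he'
      · exact (hdis e he).symm
      · exact hM.2 e he e' he' hne
    · rw [supp_insert, hs]
      ext z
      simp only [Finset.mem_erase] at hx
      simp only [Finset.mem_union, Finset.mem_insert, Finset.mem_singleton, Finset.mem_erase]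
      constructor
      · rintro ((rfl | rfl) | h)
        · exact hx₀
        · exact hx.2
        · exact h.2.2
      · intro hz
        by_cases h1 : z = x₀ <;> by_cases h2 : z = x <;> simp [*]

/-- The recursion that defines `perfectMatchings` offers every partner for its chosen point, in
particular the one given by `f`; the orientation of the edges then agrees with `f`. -/
theorem exists_perfectMatching_of_involution (w : ℕ) (V : Finset K) (hV : V.card = 2 * w)
    (f : K → K) (hf : ∀ x ∈ V, f x ∈ V ∧ f (f x) = x ∧ f x ≠ x) :
    ∃ E ∈ perfectMatchings w V, ∀ e ∈ E, f e.1 = e.2 := by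
  induction w generalizing V with
  | zero => exact ⟨∅, by simp [perfectMatchings_zero], by simp⟩
  | succ w ih =>
    obtain ⟨x₀, hx₀, h⟩ := exists_perfectMatchings_succ w (V := V) (by
      rw [← Finset.card_pos]; omega)
    have hx : f x₀ ∈ V.erase x₀ := Finset.mem_erase.2 ⟨(hf x₀ hx₀).2.2, (hf x₀ hx₀).1⟩
    obtain ⟨E, hE, hEf⟩ := ih ((V.erase x₀).erase (f x₀))
      (by rw [Finset.card_erase_of_mem hx, Finset.card_erase_of_mem hx₀]; omega) (by
        intro x hx
        simp only [Finset.mem_erase] at hx ⊢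
        obtain ⟨h1, h2, h3⟩ := hx
        obtain ⟨h4, h5, h6⟩ := hf x h3
        refine ⟨⟨?_, ?_, h4⟩, h5, h6⟩
        · intro he
          apply h2
          rw [← h5, he, (hf x₀ hx₀).2.1]
        · intro he
          apply h1
          rw [← h5, he])
    refine ⟨insert (x₀, f x₀) E, ?_, ?_⟩
    · rw [h]
      exact Finset.mem_biUnion.2 ⟨f x₀, hx, Finset.mem_image_of_mem _ hE⟩
    · intro e he
      rcases Finset.mem_insert.1 he with rfl | he
      · rfl
      · exact hEf e he

/-- The number of perfect matchings that restrict to a matching of a given subset. -/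
theorem card_perfectMatchings_filter_le (t w : ℕ) (V Z : Finset K)
    (hV : V.card = 2 * t) (hZ : Z.card = 2 * w) (hZV : Z ⊆ V) :
    ((perfectMatchings t V).filter fun E => ∃ S ⊆ E, supp S = Z).card
      ≤ oddFact w * oddFact (t - w) := by
  induction t generalizing V Z w with
  | zero =>
    refine (Finset.card_filter_le _ _).trans ?_
    have : w = 0 := by have := Finset.card_le_card hZV; omega
    subst this
    simp [perfectMatchings_zero, oddFact_zero]
  | succ t ih =>
    obtain ⟨x₀, hx₀, h⟩ := exists_perfectMatchings_succ t (V := V) (by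
      rw [← Finset.card_pos]; omega)
    have hcard : ∀ x ∈ V.erase x₀, ((V.erase x₀).erase x).card = 2 * t := fun x hx => by
      rw [Finset.card_erase_of_mem hx, Finset.card_erase_of_mem hx₀]; omega
    -- The first edge lies inside `Z` or outside it, so `x` is on the same side as `x₀`. This leaves
    -- 2w - 1 partners, respectively 2(t - w) - 1, the leading factors of the two double factorials.
    have key : ∀ x ∈ V.erase x₀, ∀ E' ∈ perfectMatchings t ((V.erase x₀).erase x),
        (∃ S ⊆ insert (x₀, x) E', supp S = Z) →
        (x₀ ∈ Z ↔ x ∈ Z) ∧ ∃ S ⊆ E', supp S = (Z.erase x₀).erase x := by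
      rintro x hx E' hE' ⟨S, hS, rfl⟩
      obtain ⟨-, hs⟩ := perfectMatchings_spec t _ (hcard x hx) hE'
      have hS' : S.erase (x₀, x) ⊆ E' := by
        rw [← Finset.subset_insert_iff]; exact hS
      have hsub := supp_mono hS'
      rw [hs] at hsub
      have hx0' : x₀ ∉ supp (S.erase (x₀, x)) := fun h => by simpa using hsub h
      have hx' : x ∉ supp (S.erase (x₀, x)) := fun h => by simpa using hsub h
      by_cases hmem : (x₀, x) ∈ S
      · have hSe : supp S = {x₀, x} ∪ supp (S.erase (x₀, x)) := by
          conv_lhs => rw [← Finset.insert_erase hmem]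
          exact supp_insert _ _
        refine ⟨by simp [hSe], S.erase (x₀, x), hS', ?_⟩
        rw [hSe]
        ext z
        simp only [Finset.mem_erase, Finset.mem_union, Finset.mem_insert, Finset.mem_singleton]
        constructor
        · intro hz
          exact ⟨fun h => hx' (h ▸ hz), fun h => hx0' (h ▸ hz), Or.inr hz⟩
        · rintro ⟨h1, h2, (h3 | h3) | h3⟩
          · exact absurd h3 h2
          · exact absurd h3 h1
          · exact h3
      · rw [Finset.erase_eq_of_notMem hmem] at hS' hsub hx0' hx'
        refine ⟨by simp [hx0', hx'], S, hS', ?_⟩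
        rw [Finset.erase_eq_of_notMem hx0', Finset.erase_eq_of_notMem hx']
    rw [h, Finset.filter_biUnion]
    by_cases hx₀Z : x₀ ∈ Z
    · have hw : ∃ w', w = w' + 1 := ⟨w - 1, by
        have := Finset.card_pos.2 ⟨x₀, hx₀Z⟩; omega⟩
      obtain ⟨w, rfl⟩ := hw
      have hc : (Z.erase x₀).card = 2 * w + 1 := by
        rw [Finset.card_erase_of_mem hx₀Z]; omega
      calc _ ≤ ∑ x ∈ V.erase x₀, if x ∈ Z then oddFact w * oddFact (t - w) else 0 := by
            refine Finset.card_biUnion_le.trans (Finset.sum_le_sum fun x hx => ?_)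
            rw [Finset.filter_image]
            refine Finset.card_image_le.trans ?_
            split_ifs with hxZ
            · refine le_trans (Finset.card_le_card ?_) (ih w _ ((Z.erase x₀).erase x)
                (hcard x hx) ?_ ?_)
              · intro E' hE'
                simp only [Finset.mem_filter] at hE' ⊢
                exact ⟨hE'.1, (key x hx E' hE'.1 hE'.2).2⟩
              · rw [Finset.card_erase_of_mem (Finset.mem_erase.2
                  ⟨(Finset.mem_erase.1 hx).1, hxZ⟩), hc]; omega
              · exact Finset.erase_subset_erase _ (Finset.erase_subset_erase _ hZV)
            · rw [Nat.le_zero, Finset.card_eq_zero, Finset.filter_eq_empty_iff]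
              intro E' hE' hS
              exact hxZ ((key x hx E' hE' hS).1.1 hx₀Z)
        _ = (2 * w + 1) * (oddFact w * oddFact (t - w)) := by
            rw [← Finset.sum_filter, Finset.sum_const, smul_eq_mul, ← hc]
            congr 2
            ext z
            simp only [Finset.mem_filter, Finset.mem_erase]
            exact ⟨fun h => ⟨h.1.1, h.2⟩, fun h => ⟨⟨h.1, hZV h.2⟩, h.2⟩⟩
        _ = _ := by rw [oddFact_succ, Nat.add_sub_add_right]; ring
    · have hwt : w ≤ t := by
        have := Finset.card_le_card (Finset.subset_erase.2 ⟨hZV, hx₀Z⟩)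
        rw [Finset.card_erase_of_mem hx₀] at this
        omega
      calc _ ≤ ∑ x ∈ V.erase x₀, if x ∈ Z then 0 else oddFact w * oddFact (t - w) := by
            refine Finset.card_biUnion_le.trans (Finset.sum_le_sum fun x hx => ?_)
            rw [Finset.filter_image]
            refine Finset.card_image_le.trans ?_
            split_ifs with hxZ
            · rw [Nat.le_zero, Finset.card_eq_zero, Finset.filter_eq_empty_iff]
              intro E' hE' hS
              exact hx₀Z ((key x hx E' hE' hS).1.2 hxZ)
            · have hZe : (Z.erase x₀).erase x = Z := by
                rw [Finset.erase_eq_of_notMem hx₀Z, Finset.erase_eq_of_notMem hxZ]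
              refine le_trans (Finset.card_le_card ?_) (ih w _ Z (hcard x hx) hZ ?_)
              · intro E' hE'
                simp only [Finset.mem_filter] at hE' ⊢
                have := (key x hx E' hE'.1 hE'.2).2
                rw [hZe] at this
                exact ⟨hE'.1, this⟩
              · exact Finset.subset_erase.2 ⟨Finset.subset_erase.2 ⟨hZV, hx₀Z⟩, hxZ⟩
        _ = (2 * (t - w) + 1) * (oddFact w * oddFact (t - w)) := by
            simp_rw [← ite_not (_ ∈ Z) (oddFact w * oddFact (t - w)) 0]
            rw [← Finset.sum_filter, Finset.sum_const, smul_eq_mul]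
            congr 1
            rw [Finset.filter_notMem_eq_sdiff, Finset.card_sdiff_of_subset
              (Finset.subset_erase.2 ⟨hZV, hx₀Z⟩), Finset.card_erase_of_mem hx₀]
            omega
        _ = _ := by rw [Nat.succ_sub hwt, oddFact_succ]; ring

/-- A colouring with classes of even size admits a fixed-point-free involution that preserves
colours. -/
theorem exists_involution_of_even {C : Type*} [DecidableEq C] (Z : Finset K) (χ : K → C)
    (h : ∀ a, Even (Z.filter fun x => χ x = a).card) :
    ∃ f : K → K, ∀ x ∈ Z, f x ∈ Z ∧ f (f x) = x ∧ f x ≠ x ∧ χ (f x) = χ x := by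
  induction Z using Finset.strongInduction with
  | H Z ih =>
    rcases Z.eq_empty_or_nonempty with rfl | ⟨x₀, hx₀⟩
    · exact ⟨id, by simp⟩
    · have hmem : x₀ ∈ Z.filter fun x => χ x = χ x₀ := by simp [hx₀]
      have h1 : 1 < (Z.filter fun x => χ x = χ x₀).card := by
        have := Finset.card_pos.2 ⟨x₀, hmem⟩
        obtain ⟨q, hq⟩ := h (χ x₀)
        omega
      obtain ⟨x₁, hx₁, hne⟩ := Finset.exists_mem_ne h1 x₀
      rw [Finset.mem_filter] at hx₁
      obtain ⟨f, hf⟩ := ih ((Z.erase x₀).erase x₁) ((Finset.erase_subset _ _).trans_ssubset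
        (Finset.erase_ssubset hx₀)) (by
          intro a
          rw [Finset.filter_erase, Finset.filter_erase]
          by_cases ha : χ x₀ = a
          · subst ha
            rw [Finset.card_erase_of_mem (Finset.mem_erase.2 ⟨hne, Finset.mem_filter.2 hx₁⟩),
              Finset.card_erase_of_mem hmem]
            obtain ⟨q, hq⟩ := h (χ x₀)
            exact ⟨q - 1, by omega⟩
          · rw [Finset.erase_eq_of_notMem (s := (Finset.filter _ Z).erase x₀),
              Finset.erase_eq_of_notMem]
            · exact h a
            · simp [ha]
            · simp [hx₁.2, ha])
      refine ⟨fun x => if x = x₀ then x₁ else if x = x₁ then x₀ else f x, fun x hx => ?_⟩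
      by_cases e0 : x = x₀
      · subst e0
        simp [hne, hx₁]
      · by_cases e1 : x = x₁
        · subst e1
          simp [hne, hx₀, hx₁.2, Ne.symm hne]
        · obtain ⟨g1, g2, g3, g4⟩ := hf x (by simp [e0, e1, hx])
          simp only [Finset.mem_erase] at g1
          simp [e0, e1, g1, g2, g3, g4]

end matchings

/-! ### The number of zero sets of a set of keys -/

section energy

/-- The Euclidean norm of a real function on a finite type. -/
noncomputable def l2 {α : Type*} [Fintype α] (F : α → ℝ) : ℝ := √(∑ a, F a ^ 2)

theorem l2_nonneg {α : Type*} [Fintype α] (F : α → ℝ) : 0 ≤ l2 F := Real.sqrt_nonneg _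

theorem l2_prod {α β : Type*} [Fintype α] [Fintype β] (F : α × β → ℝ) :
    l2 (fun a => l2 fun b => F (a, b)) = l2 F := by
  unfold l2
  congr 1
  rw [Fintype.sum_prod_type]
  exact Finset.sum_congr rfl fun a _ => Real.sq_sqrt (Finset.sum_nonneg fun _ _ => sq_nonneg _)

theorem l2_equiv {α β : Type*} [Fintype α] [Fintype β] (e : α ≃ β) (F : β → ℝ) :
    l2 (fun a => F (e a)) = l2 F := by
  unfold l2
  rw [Equiv.sum_comp e fun b => F b ^ 2]

theorem sum_mul_le_l2 {α : Type*} [Fintype α] (F G : α → ℝ) : ∑ a, F a * G a ≤ l2 F * l2 G :=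
  Real.sum_mul_le_sqrt_mul_sqrt _ _ _

/-- The quadrilinear form of the relation `R` is bounded by `C` times the product of the norms. -/
def QuadBound {α : Type*} [Fintype α] (R : (Fin 4 → α) → Prop) (C : ℝ) : Prop :=
  ∀ F : Fin 4 → α → ℝ, (∀ i a, 0 ≤ F i a) →
    ∑ x : Fin 4 → α, ind (R x) * ∏ i, F i (x i) ≤ C * ∏ i, l2 (F i)

/-- For a fixed first component the bound for `S` replaces each function by the norm of its slice.
The bound for `R` then applies to these norms, and norms of norms are norms on the product. This
step is the reason for working with arbitrary nonnegative functions instead of sets. -/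
theorem QuadBound.prod {α β : Type*} [Fintype α] [Fintype β] {R : (Fin 4 → α) → Prop}
    {S : (Fin 4 → β) → Prop} {C D : ℝ} (hR : QuadBound R C) (hS : QuadBound S D) (hD : 0 ≤ D) :
    QuadBound (fun x : Fin 4 → α × β => R (fun i => (x i).1) ∧ S (fun i => (x i).2))
      (C * D) := by
  intro F hF
  rw [← Equiv.sum_comp (Equiv.arrowProdEquivProdArrow (Fin 4) (fun _ => α) (fun _ => β)).symm,
    Fintype.sum_prod_type]
  calc _ = ∑ a : Fin 4 → α, ind (R a) *
        ∑ b : Fin 4 → β, ind (S b) * ∏ i, F i (a i, b i) := by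
        refine Finset.sum_congr rfl fun a _ => ?_
        rw [Finset.mul_sum]
        refine Finset.sum_congr rfl fun b _ => ?_
        rw [← mul_assoc, ← ind_and]
        rfl
    _ ≤ ∑ a : Fin 4 → α, ind (R a) * (D * ∏ i, l2 fun b => F i (a i, b)) := by
        refine Finset.sum_le_sum fun a _ => mul_le_mul_of_nonneg_left ?_ (ind_nonneg _)
        exact hS (fun i b => F i (a i, b)) fun i b => hF _ _
    _ = D * ∑ a : Fin 4 → α, ind (R a) * ∏ i, l2 fun b => F i (a i, b) := by
        rw [Finset.mul_sum]
        exact Finset.sum_congr rfl fun a _ => by ring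
    _ ≤ D * (C * ∏ i, l2 fun a => l2 fun b => F i (a, b)) :=
        mul_le_mul_of_nonneg_left (hR (fun i a => l2 fun b => F i (a, b))
          fun i a => l2_nonneg _) hD
    _ = _ := by simp_rw [l2_prod]; ring

theorem QuadBound.equiv {α β : Type*} [Fintype α] [Fintype β] {R : (Fin 4 → α) → Prop}
    {S : (Fin 4 → β) → Prop} {C : ℝ} (e : α ≃ β) (hR : QuadBound R C)
    (h : ∀ x : Fin 4 → α, S (fun i => e (x i)) → R x) : QuadBound S C := by
  intro F hF
  rw [← Equiv.sum_comp (Equiv.piCongrRight fun _ : Fin 4 => e)]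
  have := hR (fun i a => F i (e a)) fun i a => hF _ _
  simp_rw [l2_equiv] at this
  refine le_trans (Finset.sum_le_sum fun x _ => ?_) this
  exact mul_le_mul_of_nonneg_right (ind_mono (h x)) (Finset.prod_nonneg fun i _ => hF _ _)

/-- Four points that can be grouped into two pairs of equal points. -/
def Paired {α : Type*} (x : Fin 4 → α) : Prop :=
  (x 0 = x 1 ∧ x 2 = x 3) ∨ (x 0 = x 2 ∧ x 1 = x 3) ∨ (x 0 = x 3 ∧ x 1 = x 2)

/-- Each of the three pairings turns the sum into a product of two inner products, and
Cauchy–Schwarz applies to both. Degenerate quadruples are merely counted several times. -/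
theorem quadBound_paired (α : Type*) [Fintype α] : QuadBound (Paired (α := α)) 3 := by
  classical
  intro F hF
  -- The map `π` encodes a pairing: coordinate `i` carries the value of its pair `π i`.
  have key : ∀ π : Fin 4 → Fin 2, ∀ x : Fin 4 → α,
      ind (∃ a ∈ (Finset.univ : Finset (Fin 2 → α)), x = fun i => a (π i)) * ∏ i, F i (x i) ≤
      ∑ a : Fin 2 → α, ind (x = fun i => a (π i)) * ∏ i, F i (a (π i)) := by
    intro π x
    refine (mul_le_mul_of_nonneg_right (ind_exists_le _ _)
      (Finset.prod_nonneg fun i _ => hF _ _)).trans (le_of_eq ?_)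
    rw [Finset.sum_mul]
    refine Finset.sum_congr rfl fun a _ => ?_
    by_cases h : x = fun i => a (π i)
    · rw [h]
    · rw [ind_false h, zero_mul, zero_mul]
  have key2 : ∀ π : Fin 4 → Fin 2,
      ∑ x : Fin 4 → α, ind (∃ a ∈ (Finset.univ : Finset (Fin 2 → α)), x = fun i => a (π i)) * ∏ i, F i (x i) ≤
      ∑ a : Fin 2 → α, ∏ i, F i (a (π i)) := by
    intro π
    refine (Finset.sum_le_sum fun x _ => key π x).trans (le_of_eq ?_)
    rw [Finset.sum_comm]
    refine Finset.sum_congr rfl fun a _ => ?_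
    rw [← Finset.sum_mul, sum_ind_eq_card, Finset.filter_eq']
    simp
  have key3 : ∀ G H : α → ℝ, ∑ a : Fin 2 → α, G (a 0) * H (a 1) = (∑ a, G a) * ∑ a, H a := by
    intro G H
    have := Finset.prod_univ_sum (fun _ : Fin 2 => (Finset.univ : Finset α))
      (fun j a => (![G, H] : Fin 2 → α → ℝ) j a)
    simp [Fin.prod_univ_two] at this
    exact this.symm
  have split : ∀ x : Fin 4 → α, ind (Paired x) ≤
      ind (∃ a ∈ (Finset.univ : Finset (Fin 2 → α)), x = fun i => a (![0, 0, 1, 1] i)) +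
      (ind (∃ a ∈ (Finset.univ : Finset (Fin 2 → α)), x = fun i => a (![0, 1, 0, 1] i)) +
      ind (∃ a ∈ (Finset.univ : Finset (Fin 2 → α)), x = fun i => a (![0, 1, 1, 0] i))) := by
    intro x
    refine (ind_mono ?_).trans ((ind_or_le _ _).trans
      (add_le_add_right (ind_or_le _ _) _))
    rintro (⟨h1, h2⟩ | ⟨h1, h2⟩ | ⟨h1, h2⟩)
    · refine Or.inl ⟨![x 0, x 2], Finset.mem_univ _, funext fun i => ?_⟩
      fin_cases i <;> simp [h1, h2]
    · refine Or.inr (Or.inl ⟨![x 0, x 1], Finset.mem_univ _, funext fun i => ?_⟩)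
      fin_cases i <;> simp [h1, h2]
    · refine Or.inr (Or.inr ⟨![x 0, x 1], Finset.mem_univ _, funext fun i => ?_⟩)
      fin_cases i <;> simp [h1, h2]
  have hN : ∏ i, l2 (F i) = l2 (F 0) * l2 (F 1) * l2 (F 2) * l2 (F 3) := by
    simp [Fin.prod_univ_four]
  have cs : ∀ i j p q : Fin 4, (∑ a, F i a * F j a) * (∑ a, F p a * F q a) ≤
      (l2 (F i) * l2 (F j)) * (l2 (F p) * l2 (F q)) := fun i j p q =>
    mul_le_mul (sum_mul_le_l2 _ _) (sum_mul_le_l2 _ _)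
      (Finset.sum_nonneg fun a _ => mul_nonneg (hF _ _) (hF _ _))
      (mul_nonneg (l2_nonneg _) (l2_nonneg _))
  have b1 : ∑ a : Fin 2 → α, ∏ i, F i (a ((![0, 0, 1, 1] : Fin 4 → Fin 2) i)) ≤
      ∏ i, l2 (F i) := by
    rw [hN]
    refine le_trans (le_of_eq ?_) ((cs 0 1 2 3).trans (le_of_eq (by ring)))
    rw [← key3]
    exact Finset.sum_congr rfl fun a _ => by simp [Fin.prod_univ_four]; ring
  have b2 : ∑ a : Fin 2 → α, ∏ i, F i (a ((![0, 1, 0, 1] : Fin 4 → Fin 2) i)) ≤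
      ∏ i, l2 (F i) := by
    rw [hN]
    refine le_trans (le_of_eq ?_) ((cs 0 2 1 3).trans (le_of_eq (by ring)))
    rw [← key3]
    exact Finset.sum_congr rfl fun a _ => by simp [Fin.prod_univ_four]; ring
  have b3 : ∑ a : Fin 2 → α, ∏ i, F i (a ((![0, 1, 1, 0] : Fin 4 → Fin 2) i)) ≤
      ∏ i, l2 (F i) := by
    rw [hN]
    refine le_trans (le_of_eq ?_) ((cs 0 3 1 2).trans (le_of_eq (by ring)))
    rw [← key3]
    exact Finset.sum_congr rfl fun a _ => by simp [Fin.prod_univ_four]; ring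
  calc ∑ x : Fin 4 → α, ind (Paired x) * ∏ i, F i (x i)
      ≤ ∑ x : Fin 4 → α, _ * ∏ i, F i (x i) := Finset.sum_le_sum fun x _ =>
        mul_le_mul_of_nonneg_right (split x) (Finset.prod_nonneg fun i _ => hF _ _)
    _ ≤ 3 * ∏ i, l2 (F i) := by
        simp_rw [add_mul, Finset.sum_add_distrib]
        linarith [key2 ![0, 0, 1, 1], key2 ![0, 1, 0, 1], key2 ![0, 1, 1, 0]]

theorem paired_of_sum_eq_zero {α : Type*} [DecidableEq α] (x : Fin 4 → α)
    (h : ∀ a, ∑ i, (if x i = a then (1 : ZMod 2) else 0) = 0) : Paired x := by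
  have h0 := h (x 0)
  have h1 := h (x 1)
  have h2 := h (x 2)
  clear h
  simp only [Fin.sum_univ_four, if_true] at h0 h1 h2
  unfold Paired
  have two : (1 : ZMod 2) + 1 = 0 := rfl
  by_cases e1 : x 1 = x 0
  · rw [e1] at h2 ⊢
    by_cases e3 : x 3 = x 2
    · simp [e3]
    · by_cases e2 : x 0 = x 2 <;> simp_all
  · by_cases e2 : x 2 = x 0
    · by_cases e3 : x 3 = x 1
      · simp [e2, e3]
      · simp_all [Ne.symm e1]
    · by_cases e3 : x 3 = x 0
      · by_cases e4 : x 2 = x 1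
        · simp [e3, e4]
        · simp_all [Ne.symm e1]
      · simp_all

/-- Four characters at one position cancel only if they are paired, so each position contributes a
factor 3. -/
theorem quadBound_keyVec (k c : ℕ) :
    QuadBound (fun x : Fin 4 → Key k c => ∑ i, keyVec (x i) = 0) (3 ^ c) := by
  induction c with
  | zero =>
    intro F hF
    rw [Fintype.sum_unique]
    rw [pow_zero, one_mul]
    refine (mul_le_of_le_one_left (Finset.prod_nonneg fun i _ => hF _ _) (ind_le_one _)).trans
      (le_of_eq (Finset.prod_congr rfl fun i _ => ?_))
    rw [l2, Fintype.sum_unique, Real.sqrt_sq (hF _ _)]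
    congr
  | succ c ih =>
    rw [pow_succ']
    refine ((quadBound_paired (BitString k)).prod ih (by positivity)).equiv
      (Fin.consEquiv fun _ : Fin (c + 1) => BitString k) fun x hx => ⟨?_, ?_⟩
    · refine paired_of_sum_eq_zero _ fun a => ?_
      have := congrFun hx (0, a)
      simpa [keyVec, Finset.sum_apply, Fin.consEquiv] using this
    · funext ⟨j, a⟩
      have := congrFun hx (j.succ, a)
      simpa [keyVec, Finset.sum_apply, Fin.consEquiv] using this

theorem l2_ind_mem {α : Type*} [Fintype α] [DecidableEq α] (A : Finset α) :
    l2 (fun a => ind (a ∈ A)) = √A.card := by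
  unfold l2
  congr 1
  rw [Finset.sum_congr rfl (g := fun a => ind (a ∈ A)) fun a _ => by
    by_cases h : a ∈ A <;> simp [ind, h], sum_ind_eq_card]
  simp

/-- A shift does not increase the additive energy. -/
theorem sum_ind_add_eq_le {P G : Type*} [AddCommGroup G] [Fintype G]
    (s : Finset P) (φ : P → G) (g : G) :
    ∑ p ∈ s, ∑ q ∈ s, ind (φ p + φ q = g) ≤ ∑ p ∈ s, ∑ q ∈ s, ind (φ p = φ q) := by
  classical
  let r : G → ℝ := fun h => ∑ p ∈ s, ind (φ p = h)
  have h1 : ∑ p ∈ s, ∑ q ∈ s, ind (φ p + φ q = g) = ∑ h, r h * r (g - h) := by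
    simp only [r, Finset.sum_mul_sum]
    symm
    rw [Finset.sum_comm]
    refine Finset.sum_congr rfl fun p _ => ?_
    rw [Finset.sum_comm]
    refine Finset.sum_congr rfl fun q _ => ?_
    rw [Finset.sum_eq_single (φ p)]
    · rw [ind_true rfl, one_mul]
      symm
      exact ind_congr (by rw [eq_sub_iff_add_eq, add_comm])
    · intro h _ hne
      rw [ind_false (Ne.symm hne), zero_mul]
    · simp
  have h2 : ∑ p ∈ s, ∑ q ∈ s, ind (φ p = φ q) = ∑ h, r h * r h := by
    simp only [r, Finset.sum_mul_sum]
    symm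
    rw [Finset.sum_comm]
    refine Finset.sum_congr rfl fun p _ => ?_
    rw [Finset.sum_comm]
    refine Finset.sum_congr rfl fun q _ => ?_
    rw [Finset.sum_eq_single (φ p)]
    · rw [ind_true rfl, one_mul]
      exact ind_congr eq_comm
    · intro h _ hne
      rw [ind_false (Ne.symm hne), zero_mul]
    · simp
  have h3 : ∑ h, r (g - h) * r (g - h) = ∑ h, r h * r h :=
    Equiv.sum_comp (Equiv.subLeft g) fun h => r h * r h
  rw [h1, h2]
  have h4 : ∀ h ∈ Finset.univ, r h * r (g - h) ≤ (r h * r h + r (g - h) * r (g - h)) / 2 :=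
    fun h _ => by nlinarith [sq_nonneg (r h - r (g - h))]
  refine (Finset.sum_le_sum h4).trans (le_of_eq ?_)
  rw [← Finset.sum_div, Finset.sum_add_distrib, h3]
  ring

/-- The weighted number of tuples of keys from `A` with a given sum. -/
noncomputable def tupleSum {k c : ℕ} (A : Finset (Key k c)) (N : ℕ) (g : GenKey k c) : ℝ :=
  ∑ x : Fin N → Key k c, ind (∑ i, keyVec (x i) = g) * ∏ i, ind (x i ∈ A)

/-- Four-tuples as pairs of pairs. -/
def quadEquiv (α : Type*) : (α × α) × (α × α) ≃ (Fin 4 → α) where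
  toFun x := ![x.1.1, x.1.2, x.2.1, x.2.2]
  invFun x := ((x 0, x 1), (x 2, x 3))
  left_inv _ := rfl
  right_inv x := by funext i; fin_cases i <;> rfl

/-- For `g = 0` this is the quadrilinear bound for the indicator of `A`, of norm √|A|. Grouping four
keys into two pairs turns a general `g` into a shifted additive energy; over 𝔽₂ the unshifted energy
is the case `g = 0`. -/
theorem tupleSum_four_le {k c : ℕ} (A : Finset (Key k c)) (g : GenKey k c) :
    tupleSum A 4 g ≤ 3 ^ c * (A.card : ℝ) ^ 2 := by
  have hpair : ∀ h : GenKey k c, tupleSum A 4 h = ∑ p ∈ A ×ˢ A, ∑ q ∈ A ×ˢ A,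
      ind ((keyVec p.1 + keyVec p.2) + (keyVec q.1 + keyVec q.2) = h) := by
    intro h
    have hA : ∀ p : Key k c × Key k c, p ∈ A ×ˢ A ↔ p.1 ∈ A ∧ p.2 ∈ A :=
      fun p => Finset.mem_product
    have hext : ∀ F : Key k c × Key k c → ℝ,
        ∑ p ∈ A ×ˢ A, F p = ∑ p, (ind (p.1 ∈ A) * ind (p.2 ∈ A)) * F p := by
      intro F
      rw [← Finset.sum_subset (Finset.subset_univ (A ×ˢ A))]
      · refine Finset.sum_congr rfl fun p hp => ?_
        rw [← ind_and, ind_true ((hA p).1 hp), one_mul]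
      · intro p _ hp
        rw [← ind_and, ind_false (mt (hA p).2 hp), zero_mul]
    rw [tupleSum, ← Equiv.sum_comp (quadEquiv (Key k c)), Fintype.sum_prod_type, hext]
    refine Finset.sum_congr rfl fun p _ => ?_
    rw [hext, Finset.mul_sum]
    refine Finset.sum_congr rfl fun q _ => ?_
    rw [show quadEquiv (Key k c) (p, q) = ![p.1, p.2, q.1, q.2] from rfl]
    simp only [Fin.prod_univ_four, Fin.sum_univ_four, Matrix.cons_val]
    rw [add_assoc (keyVec p.1 + keyVec p.2)]
    ring
  have h0 : tupleSum A 4 0 ≤ 3 ^ c * (A.card : ℝ) ^ 2 := by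
    refine (quadBound_keyVec k c (fun _ a => ind (a ∈ A)) fun _ _ => ind_nonneg _).trans
      (le_of_eq ?_)
    simp only [l2_ind_mem, Finset.prod_const, Finset.card_univ, Fintype.card_fin]
    rw [show (4 : ℕ) = 2 * 2 from rfl, pow_mul, Real.sq_sqrt (Nat.cast_nonneg _)]
  refine le_trans ?_ h0
  rw [hpair, hpair]
  refine (sum_ind_add_eq_le (A ×ˢ A) (fun p => keyVec p.1 + keyVec p.2) g).trans
    (le_of_eq ?_)
  refine Finset.sum_congr rfl fun p _ => Finset.sum_congr rfl fun q _ => ind_congr ?_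
  exact ⟨fun h => by rw [h]; exact add_self_bits _, eq_of_add_bits_eq_zero⟩

/-- All keys but four are chosen freely and only shift the target, which is why arbitrary `g` are
needed. -/
theorem tupleSum_le {k c : ℕ} (A : Finset (Key k c)) (m : ℕ) (g : GenKey k c) :
    tupleSum A (4 + m) g ≤ 3 ^ c * (A.card : ℝ) ^ (m + 2) := by
  induction m generalizing g with
  | zero => simpa using tupleSum_four_le A g
  | succ m ih =>
    have h : tupleSum A (4 + (m + 1)) g
        = ∑ a : Key k c, ind (a ∈ A) * tupleSum A (4 + m) (g - keyVec a) := by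
      unfold tupleSum
      change ∑ x : Fin (4 + m + 1) → Key k c, ind (∑ i, keyVec (x i) = g) *
        ∏ i, ind (x i ∈ A) = _
      rw [← Equiv.sum_comp (Fin.consEquiv fun _ : Fin (4 + m + 1) => Key k c),
        Fintype.sum_prod_type]
      refine Finset.sum_congr rfl fun a _ => ?_
      rw [Finset.mul_sum]
      refine Finset.sum_congr rfl fun x _ => ?_
      rw [Fin.sum_univ_succ, Fin.prod_univ_succ]
      simp only [Fin.consEquiv, Equiv.coe_fn_mk, Fin.cons_zero, Fin.cons_succ]
      rw [ind_congr (eq_sub_iff_add_eq' (a := ∑ i, keyVec (x i)) (b := g) (c := keyVec a))]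
      ring
    rw [h]
    calc _ ≤ ∑ a : Key k c, ind (a ∈ A) * (3 ^ c * (A.card : ℝ) ^ (m + 2)) :=
          Finset.sum_le_sum fun a _ => mul_le_mul_of_nonneg_left (ih _) (ind_nonneg _)
      _ = _ := by
          rw [← Finset.sum_mul, sum_ind_eq_card]
          simp only [Finset.filter_univ_mem]
          ring

/-- The number of zero sets of `2 w` original keys from `A`. -/
theorem card_zero_powersetCard_le {k c : ℕ} (A : Finset (Key k c)) (w : ℕ) (hw : 2 ≤ w) :
    ∑ Z ∈ A.powersetCard (2 * w), ind (Zero (fun x => x) Z)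
      ≤ 3 ^ c * (A.card : ℝ) ^ (2 * w - 2) / (2 * w).factorial := by
  classical
  obtain ⟨m, hm⟩ : ∃ m, 2 * w = 4 + m := ⟨2 * w - 4, by omega⟩
  have hm2 : 2 * w - 2 = m + 2 := by omega
  rw [hm2, le_div_iff₀ (by positivity)]
  refine le_trans ?_ (tupleSum_le A m 0)
  rw [sum_ind_eq_card, hm]
  set s := Finset.univ.filter fun x : Fin (4 + m) → Key k c =>
    (∑ i, keyVec (x i) = 0 ∧ ∀ i, x i ∈ A) ∧ Function.Injective x with hs
  have h1 : (s.card : ℝ) ≤ tupleSum A (4 + m) 0 := by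
    rw [hs, ← sum_ind_eq_card, tupleSum]
    refine Finset.sum_le_sum fun x _ => ?_
    by_cases h : (∑ i, keyVec (x i) = 0 ∧ ∀ i, x i ∈ A) ∧ Function.Injective x
    · rw [ind_true h, ind_true h.1.1, one_mul, Finset.prod_eq_one fun i _ => ind_true (h.1.2 i)]
    · rw [ind_false h]
      exact mul_nonneg (ind_nonneg _) (Finset.prod_nonneg fun i _ => ind_nonneg _)
  refine le_trans ?_ h1
  rw [mul_comm]
  norm_cast
  -- Every zero set is the range of (2w)! injective tuples, one for each permutation of an
  -- enumeration.
  refine Finset.mul_card_image_le_card_of_maps_to (f := fun x => Finset.univ.image x) ?_ _ ?_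
  · rintro x hx
    simp only [hs, Finset.mem_filter, Finset.mem_univ, true_and] at hx
    obtain ⟨⟨h1, h2⟩, h3⟩ := hx
    simp only [Finset.mem_filter, Finset.mem_powersetCard]
    refine ⟨⟨?_, ?_⟩, ?_⟩
    · intro z hz
      obtain ⟨i, -, rfl⟩ := Finset.mem_image.1 hz
      exact h2 i
    · rw [Finset.card_image_of_injective _ h3]; simp
    · unfold Zero
      rw [Finset.sum_image fun i _ j _ h => h3 h]
      exact h1
  · intro Z hZ
    simp only [Finset.mem_filter, Finset.mem_powersetCard] at hZ
    obtain ⟨⟨hZA, hZc⟩, hZ0⟩ := hZ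
    let e : Fin (4 + m) ≃ Z := (Z.equivFinOfCardEq hZc).symm
    have hcard : (4 + m).factorial
        = (Finset.univ : Finset (Equiv.Perm (Fin (4 + m)))).card := by
      rw [Finset.card_univ, Fintype.card_perm, Fintype.card_fin]
    rw [hcard]
    refine Finset.card_le_card_of_injOn (fun σ i => (e (σ i) : Key k c)) ?_ ?_
    · intro σ _
      have hinj : Function.Injective fun i => (e (σ i) : Key k c) :=
        Subtype.val_injective.comp (e.injective.comp σ.injective)
      have himg : Finset.univ.image (fun i => (e (σ i) : Key k c)) = Z := by
        refine Finset.eq_of_subset_of_card_le ?_ ?_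
        · intro z hz
          obtain ⟨i, -, rfl⟩ := Finset.mem_image.1 hz
          exact (e (σ i)).2
        · rw [Finset.card_image_of_injective _ hinj, hZc]; simp
      simp only [Finset.coe_filter, hs, Finset.mem_filter, Finset.mem_univ, true_and,
        Set.mem_ofPred_eq]
      refine ⟨⟨⟨?_, fun i => hZA (e (σ i)).2⟩, hinj⟩, himg⟩
      unfold Zero at hZ0
      rw [← himg, Finset.sum_image fun i _ j _ h => hinj h] at hZ0
      exact hZ0
    · intro σ _ τ _ h
      ext i
      have := congrFun h i
      simp only [Subtype.val_inj, e.apply_eq_iff_eq] at this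
      rw [this]

end energy

/-! ### Zero sets of derived keys -/

section levels

variable {k c : ℕ}

theorem derivedKey_succ (i : ℕ) (T : DerivedTables k c (i + 1)) :
    derivedKey (i + 1) T = ext (T (Fin.last i)) (derivedKey i fun j => T j.castSucc) := rfl

theorem derivedKey_injective (i : ℕ) (T : DerivedTables k c i) :
    Function.Injective (derivedKey i T) := by
  induction i with
  | zero => exact fun _ _ h => h
  | succ i ih => exact ext_injective (T (Fin.last i)) (ih fun j => T j.castSucc)

theorem avg_derivedKey_succ (i : ℕ) (F : (Key k c → Key k (c + (i + 1))) → ℝ) :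
    avg (fun T : DerivedTables k c (i + 1) => F (derivedKey (i + 1) T)) =
      avg fun T : DerivedTables k c i => avg fun S : Tables k k (c + i) =>
        F (ext S (derivedKey i T)) := by
  rw [← avg_equiv (Fin.snocEquiv fun j : Fin (i + 1) => Tables k k (c + (j : ℕ))),
    avg_prod_swap]
  refine congrArg avg (funext fun T => congrArg avg (funext fun S => congrArg F ?_))
  rw [derivedKey_succ]
  congr 1
  · exact Fin.snoc_last (α := fun j : Fin (i + 1) => Tables k k (c + (j : ℕ))) S T
  · congr 1
    funext j
    exact Fin.snoc_castSucc (α := fun j : Fin (i + 1) => Tables k k (c + (j : ℕ))) S T j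

/-- The new character occurs an even number of times, so keys with equal new characters can be
paired. A dependency that misses an edge would give a zero set of extended keys on fewer keys,
against minimality. -/
theorem exists_matching_of_circ_ext {K : Type*} [DecidableEq K] {m w : ℕ} {T : Tables k k m}
    {y : K → Key k m} {Y : Finset K} (hY : Y.card = 2 * w) (h : Circ (ext T y) Y) :
    ∃ E ∈ perfectMatchings w Y, Matched T y E ∧ ∀ e ∈ E, IndepEdges y (E.erase e) := by
  obtain ⟨f, hf⟩ := exists_involution_of_even Y (fun x => simpleTab T (y x))
    (even_of_zero_ext h.2.1)
  obtain ⟨E, hE, hEf⟩ := exists_perfectMatching_of_involution w Y hY f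
    fun x hx => ⟨(hf x hx).1, (hf x hx).2.1, (hf x hx).2.2.1⟩
  obtain ⟨hM, hs⟩ := perfectMatchings_spec w Y hY hE
  have hmatch : Matched T y E := fun e he => by
    rw [← hEf e he]
    exact ((hf e.1 (hs ▸ mem_supp.2 ⟨e, he, Or.inl rfl⟩)).2.2.2).symm
  refine ⟨E, hE, hmatch, fun e he S hS hSn h0 => ?_⟩
  have hSE : S ⊆ E := hS.trans (Finset.erase_subset _ _)
  have h1 := sum_edges_ext (T := T) (fun e he => hmatch e (hSE he)) h0
  rw [← (hM.mono hSE).sum_supp (fun x => keyVec (ext T y x))] at h1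
  refine h.2.2 (supp S) (Finset.ssubset_iff_subset_ne.2 ⟨hs ▸ supp_mono hSE, fun heq => ?_⟩)
    (supp_nonempty hSn) h1
  have hc := (hM.mono hSE).card_supp
  rw [heq, ← hs, hM.card_supp] at hc
  have := Finset.card_le_card hS
  have := Finset.card_erase_lt_of_mem he
  omega

/-- Union bound over the perfect matchings. One edge is dropped from each of them, because all edges
together sum to zero on a zero set. -/
theorem avg_circ_ext_le {K : Type*} [DecidableEq K] {m w : ℕ} (y : K → Key k m) {Y : Finset K}
    (hY : Y.card = 2 * w) (hw : 1 ≤ w) :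
    avg (fun T : Tables k k m => ind (Circ (ext T y) Y))
      ≤ ind (Zero y Y) * (oddFact w * (1 / 2 ^ k : ℝ) ^ (w - 1)) := by
  by_cases hz : Zero y Y
  · rw [ind_true hz, one_mul]
    have hcard : ∀ E ∈ perfectMatchings w Y, ∃ e ∈ E, (E.erase e).card = w - 1 := by
      intro E hE
      obtain ⟨hM, hs⟩ := perfectMatchings_spec w Y hY hE
      have hc := hM.card_supp
      rw [hs, hY] at hc
      obtain ⟨e, he⟩ := Finset.card_pos.1 (show 0 < E.card by omega)
      exact ⟨e, he, by rw [Finset.card_erase_of_mem he]; omega⟩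
    calc _ ≤ avg (fun T : Tables k k m => ∑ E ∈ perfectMatchings w Y,
          ind (Matched T y E ∧ ∀ e ∈ E, IndepEdges y (E.erase e))) :=
          avg_mono fun T => (ind_mono (exists_matching_of_circ_ext hY)).trans (ind_exists_le _ _)
      _ = ∑ E ∈ perfectMatchings w Y, avg (fun T : Tables k k m =>
          ind (Matched T y E ∧ ∀ e ∈ E, IndepEdges y (E.erase e))) := avg_sum _ _
      _ ≤ ∑ E ∈ perfectMatchings w Y, (1 / 2 ^ k : ℝ) ^ (w - 1) := by
          refine Finset.sum_le_sum fun E hE => ?_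
          obtain ⟨e, he, hc⟩ := hcard E hE
          rw [← hc]
          refine (avg_mono fun T => ind_mono fun h => ?_).trans (avg_matched_le y (E.erase e))
          exact ⟨h.2 e he, fun e' he' => h.1 e' (Finset.mem_of_mem_erase he')⟩
      _ ≤ _ := by
          rw [Finset.sum_const, nsmul_eq_mul]
          gcongr
          exact card_perfectMatchings_le w Y hY
  · rw [ind_false hz, zero_mul]
    refine avg_le_of_le fun T => ?_
    rw [ind_false fun h => hz (zero_of_zero_ext h.2.1)]

/-- The number of sets of size `m` between `Y` and `A`. -/
theorem sum_ind_superset_le {K : Type*} [DecidableEq K] (A Y : Finset K) (m : ℕ) :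
    ∑ Z ∈ A.powersetCard m, ind (Y ⊆ Z)
      ≤ (A.card : ℝ) ^ (m - Y.card) / (m - Y.card).factorial := by
  rw [sum_ind_eq_card]
  refine le_trans ?_ (Nat.choose_le_pow_div (m - Y.card) A.card)
  norm_cast
  refine le_trans ?_ (Nat.choose_le_choose _ (Finset.card_le_card (Finset.sdiff_subset (t := Y))))
  rw [← Finset.card_powersetCard]
  refine Finset.card_le_card_of_injOn (fun Z => Z \ Y) ?_ ?_
  · intro Z hZ
    simp only [Finset.coe_filter, Finset.mem_powersetCard, Set.mem_ofPred_eq] at hZ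
    rw [Finset.mem_coe, Finset.mem_powersetCard]
    exact ⟨Finset.sdiff_subset_sdiff hZ.1.1 subset_rfl, by
      rw [Finset.card_sdiff_of_subset hZ.2, hZ.1.2]⟩
  · intro Z hZ Z' hZ' h
    simp only [Finset.coe_filter, Finset.mem_powersetCard, Set.mem_ofPred_eq] at hZ hZ'
    dsimp only at h
    rw [← Finset.sdiff_union_of_subset hZ.2, h, Finset.sdiff_union_of_subset hZ'.2]

/-- A zero set that is no circuit is charged to a circuit of at most half its size inside it, whose
remaining keys are arbitrary. A position is needed for the parity of the sizes, hence `0 < m`. -/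
theorem sum_zero_le_sum_circ {K : Type*} [DecidableEq K] {m : ℕ} (hm : 0 < m)
    {y : K → Key k m} (hy : Function.Injective y) (A : Finset K) (w : ℕ) (hw : 1 ≤ w) :
    ∑ Z ∈ A.powersetCard (2 * w), ind (Zero y Z) ≤
      ∑ Z ∈ A.powersetCard (2 * w), ind (Circ y Z) +
      ∑ v ∈ Finset.Icc 2 (w / 2), (∑ Y ∈ A.powersetCard (2 * v), ind (Circ y Y)) *
        ((A.card : ℝ) ^ (2 * w - 2 * v) / (2 * w - 2 * v).factorial) := by
  have h1 : ∀ Z ∈ A.powersetCard (2 * w), ind (Zero y Z) ≤ ind (Circ y Z) +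
      ∑ v ∈ Finset.Icc 2 (w / 2), ∑ Y ∈ A.powersetCard (2 * v), ind (Circ y Y) * ind (Y ⊆ Z) := by
    intro Z hZ
    rw [Finset.mem_powersetCard] at hZ
    have h2 : Zero y Z → Circ y Z ∨ ∃ v ∈ Finset.Icc 2 (w / 2),
        ∃ Y ∈ A.powersetCard (2 * v), Circ y Y ∧ Y ⊆ Z := by
      intro hz
      by_cases hc : Circ y Z
      · exact Or.inl hc
      · have hn : Z.Nonempty := Finset.card_pos.1 (by omega)
        obtain ⟨Y, hYZ, hY, hle⟩ := exists_circ_half hn hz hc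
        obtain ⟨v, hv2, hv⟩ := exists_card_of_zero hy hm hY.1 hY.2.1
        exact Or.inr ⟨v, Finset.mem_Icc.2 ⟨hv2, by omega⟩, Y,
          Finset.mem_powersetCard.2 ⟨hYZ.trans hZ.1, hv⟩, hY, hYZ⟩
    refine (ind_mono h2).trans ((ind_or_le _ _).trans (add_le_add_right ?_ _))
    refine (ind_exists_le _ _).trans (Finset.sum_le_sum fun v _ => ?_)
    refine (ind_exists_le _ _).trans (Finset.sum_le_sum fun Y _ => ?_)
    rw [ind_and]
  refine (Finset.sum_le_sum h1).trans ?_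
  rw [Finset.sum_add_distrib]
  gcongr ?_ + ?_
  · rfl
  rw [Finset.sum_comm]
  refine Finset.sum_le_sum fun v _ => ?_
  rw [Finset.sum_comm, Finset.sum_mul]
  refine Finset.sum_le_sum fun Y hY => ?_
  rw [← Finset.mul_sum]
  refine mul_le_mul_of_nonneg_left ?_ (ind_nonneg _)
  rw [← (Finset.mem_powersetCard.1 hY).2]
  exact sum_ind_superset_le A Y (2 * w)

/-- The expected number of circuits of `2 w` keys from `A` among the keys with `i` derived
characters. -/
noncomputable def circAvg (A : Finset (Key k c)) (i w : ℕ) : ℝ :=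
  avg fun T : DerivedTables k c i =>
    ∑ Z ∈ A.powersetCard (2 * w), ind (Circ (derivedKey i T) Z)

/-- The expected number of zero sets of `2 w` keys from `A` among the keys with `i` derived
characters. -/
noncomputable def zeroAvg (A : Finset (Key k c)) (i w : ℕ) : ℝ :=
  avg fun T : DerivedTables k c i =>
    ∑ Z ∈ A.powersetCard (2 * w), ind (Zero (derivedKey i T) Z)

theorem zeroAvg_zero_le (A : Finset (Key k c)) (w : ℕ) (hw : 2 ≤ w) :
    zeroAvg A 0 w ≤ 3 ^ c * (A.card : ℝ) ^ (2 * w - 2) / (2 * w).factorial :=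
  avg_le_of_le fun _ => card_zero_powersetCard_le A w hw

theorem circAvg_succ_le (A : Finset (Key k c)) (i w : ℕ) (hw : 1 ≤ w) :
    circAvg A (i + 1) w ≤ zeroAvg A i w * (oddFact w * (1 / 2 ^ k : ℝ) ^ (w - 1)) := by
  unfold circAvg zeroAvg
  rw [avg_derivedKey_succ i (fun y => ∑ Z ∈ A.powersetCard (2 * w), ind (Circ y Z)),
    ← avg_mul_right]
  refine avg_mono fun T => ?_
  rw [avg_sum, Finset.sum_mul]
  exact Finset.sum_le_sum fun Z hZ => avg_circ_ext_le _ (Finset.mem_powersetCard.1 hZ).2 hw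

theorem zeroAvg_le (A : Finset (Key k c)) (i w : ℕ) (hi : 1 ≤ i) (hw : 1 ≤ w) :
    zeroAvg A i w ≤ circAvg A i w + ∑ v ∈ Finset.Icc 2 (w / 2), circAvg A i v *
      ((A.card : ℝ) ^ (2 * w - 2 * v) / (2 * w - 2 * v).factorial) := by
  unfold circAvg zeroAvg
  simp_rw [← avg_mul_right]
  rw [← avg_sum, ← avg_add]
  exact avg_mono fun T => sum_zero_le_sum_circ (by omega) (derivedKey_injective i T) A w hw

/-- The factor by which the weight of a circuit of `2 w` keys drops at each level, relative to
`3 / s`. -/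
noncomputable def levelFactor (s : ℝ) (w : ℕ) : ℝ := oddFact w / (3 * s ^ (w - 2))

/-- `b` dominates the relative weights of circuits up to size `2 L`, at all levels. -/
structure CircuitWeights (s : ℝ) (L : ℕ) (b : ℕ → ℝ) : Prop where
  first : ∀ w, 2 ≤ w → w ≤ L → levelFactor s w ≤ b w
  step : ∀ w, 2 ≤ w → w ≤ L → levelFactor s w *
    (b w + ∑ v ∈ Finset.Icc 2 (w / 2), ((2 * w).choose (2 * v) : ℝ) * b v) ≤ b w

theorem levelFactor_nonneg {s : ℝ} (hs : 0 ≤ s) (w : ℕ) : 0 ≤ levelFactor s w := by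
  unfold levelFactor; positivity

theorem oddFact_mul_eq {s : ℝ} (hs : 0 < s) {w : ℕ} (hw : 2 ≤ w) :
    oddFact w * (1 / s) ^ (w - 1) = levelFactor s w * (3 / s) := by
  obtain ⟨u, rfl⟩ := Nat.exists_eq_add_of_le hw
  unfold levelFactor
  rw [show 2 + u - 1 = u + 1 by omega, show 2 + u - 2 = u by omega, one_div, inv_pow, pow_succ]
  field_simp

/-- Induction on the level: circuits with one more character come from zero sets, and zero sets from
circuits of the same or at most half the size. All sizes share the factor 3/s per level; `b` records
the rest, with `CircuitWeights.first` for the first character and `CircuitWeights.step` for all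
later ones. -/
theorem circAvg_le (A : Finset (Key k c)) {L : ℕ} {b : ℕ → ℝ}
    (hb : CircuitWeights (2 ^ k) L b) (i w : ℕ) (hw : 2 ≤ w) (hwL : w ≤ L) :
    circAvg A (i + 1) w ≤ b w * (3 ^ c * (3 / 2 ^ k) ^ (i + 1)) *
      ((A.card : ℝ) ^ (2 * w - 2) / (2 * w).factorial) := by
  have hs : (0 : ℝ) < 2 ^ k := by positivity
  have hg := levelFactor_nonneg hs.le w
  induction i generalizing w with
  | zero =>
    refine (circAvg_succ_le A 0 w (by omega)).trans ?_
    rw [oddFact_mul_eq hs hw]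
    calc _ ≤ (3 ^ c * (A.card : ℝ) ^ (2 * w - 2) / (2 * w).factorial) *
          (levelFactor (2 ^ k) w * (3 / 2 ^ k)) := by
          gcongr
          exact zeroAvg_zero_le A w hw
      _ ≤ (3 ^ c * (A.card : ℝ) ^ (2 * w - 2) / (2 * w).factorial) * (b w * (3 / 2 ^ k)) := by
          gcongr
          exact hb.first w hw hwL
      _ = _ := by ring
  | succ i ih =>
    refine (circAvg_succ_le A (i + 1) w (by omega)).trans ?_
    rw [oddFact_mul_eq hs hw]
    set P : ℝ := 3 ^ c * (3 / 2 ^ k) ^ (i + 1) with hP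
    have hP0 : 0 ≤ P := by positivity
    have hz : zeroAvg A (i + 1) w ≤ (b w + ∑ v ∈ Finset.Icc 2 (w / 2),
        ((2 * w).choose (2 * v) : ℝ) * b v) * (P *
        ((A.card : ℝ) ^ (2 * w - 2) / (2 * w).factorial)) := by
      refine (zeroAvg_le A (i + 1) w (by omega) (by omega)).trans ?_
      rw [add_mul, Finset.sum_mul]
      refine add_le_add ((ih w hw hwL hg).trans (le_of_eq (by ring)))
        (Finset.sum_le_sum fun v hv => ?_)
      rw [Finset.mem_Icc] at hv
      have hvw : 2 * v ≤ 2 * w := by omega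
      calc _ ≤ (b v * P * ((A.card : ℝ) ^ (2 * v - 2) / (2 * v).factorial)) *
            ((A.card : ℝ) ^ (2 * w - 2 * v) / (2 * w - 2 * v).factorial) := by
            gcongr
            exact ih v hv.1 (by omega) (levelFactor_nonneg hs.le v)
        _ = _ := by
            -- The binomial coefficient is what remains of the factorials after normalisation by
            -- (2w)!.
            rw [Nat.cast_choose ℝ hvw,
              show 2 * w - 2 = (2 * v - 2) + (2 * w - 2 * v) by omega, pow_add]
            have h1 : ((2 * w).factorial : ℝ) ≠ 0 := by positivity
            have h2 : ((2 * v).factorial : ℝ) ≠ 0 := by positivity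
            have h3 : ((2 * w - 2 * v).factorial : ℝ) ≠ 0 := by positivity
            field_simp
    calc _ ≤ _ := mul_le_mul_of_nonneg_right hz (by positivity)
      _ = (levelFactor (2 ^ k) w * (b w + ∑ v ∈ Finset.Icc 2 (w / 2),
          ((2 * w).choose (2 * v) : ℝ) * b v)) * (P * (3 / 2 ^ k) *
          ((A.card : ℝ) ^ (2 * w - 2) / (2 * w).factorial)) := by ring
      _ ≤ b w * (P * (3 / 2 ^ k) *
          ((A.card : ℝ) ^ (2 * w - 2) / (2 * w).factorial)) :=
          mul_le_mul_of_nonneg_right (hb.step w hw hwL) (by positivity)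
      _ = _ := by rw [hP]; ring

theorem factorial_two_mul (w : ℕ) : (2 * w).factorial = oddFact w * (2 ^ w * w.factorial) := by
  induction w with
  | zero => rfl
  | succ w ih =>
    rw [show 2 * (w + 1) = 2 * w + 1 + 1 by ring, Nat.factorial_succ, Nat.factorial_succ, ih,
      oddFact_succ, Nat.factorial_succ]
    ring

theorem oddFact_pos (w : ℕ) : 0 < oddFact w :=
  Finset.prod_pos fun _ _ => Nat.succ_pos _

theorem oddFact_div_factorial (w : ℕ) :
    (oddFact w : ℝ) / (2 * w).factorial = 1 / (2 ^ w * w.factorial) := by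
  have := oddFact_pos w
  rw [factorial_two_mul]
  push_cast
  field_simp

/-! ### Dependencies among the edges of a perfect matching -/

/-- The expected number of pairs of a set of `2 t` keys from `A` and a perfect matching of it with
a dependency among its edges. -/
noncomputable def depAvg (A : Finset (Key k c)) (i t : ℕ) : ℝ :=
  avg fun T : DerivedTables k c i => ∑ V ∈ A.powersetCard (2 * t),
    ∑ E ∈ perfectMatchings t V, ind (∃ S ⊆ E, S.Nonempty ∧ Zero (derivedKey i T) (supp S))

theorem sum_matchings_superset_le {K : Type*} [DecidableEq K] (A Z : Finset K) (t w : ℕ)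
    (hZ : Z.card = 2 * w) :
    ∑ V ∈ A.powersetCard (2 * t), ∑ E ∈ perfectMatchings t V,
        ind (Z ⊆ V ∧ ∃ S ⊆ E, supp S = Z)
      ≤ oddFact w * oddFact (t - w) *
        ((A.card : ℝ) ^ (2 * t - 2 * w) / (2 * t - 2 * w).factorial) := by
  have h := sum_ind_superset_le A Z (2 * t)
  rw [hZ] at h
  refine le_trans ?_ (mul_le_mul_of_nonneg_left h (by positivity))
  rw [Finset.mul_sum]
  refine Finset.sum_le_sum fun V hV => ?_
  simp_rw [ind_and, ← Finset.mul_sum]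
  rw [mul_comm]
  by_cases hZV : Z ⊆ V
  · refine mul_le_mul_of_nonneg_right ?_ (ind_nonneg _)
    rw [sum_ind_eq_card]
    exact_mod_cast card_perfectMatchings_filter_le t w V Z
      (Finset.mem_powersetCard.1 hV).2 hZ hZV
  · rw [ind_false hZV, mul_zero, mul_zero]

/-- For the circuits of at most half size inside a dependency: these need not be unions of edges, so
all matchings have to be counted. -/
theorem sum_matchings_superset_le' {K : Type*} [DecidableEq K] (A Z : Finset K) (t w : ℕ)
    (hZ : Z.card = 2 * w) :
    ∑ V ∈ A.powersetCard (2 * t), ∑ _E ∈ perfectMatchings t V, ind (Z ⊆ V)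
      ≤ oddFact t * ((A.card : ℝ) ^ (2 * t - 2 * w) / (2 * t - 2 * w).factorial) := by
  have h := sum_ind_superset_le A Z (2 * t)
  rw [hZ] at h
  refine le_trans ?_ (mul_le_mul_of_nonneg_left h (by positivity))
  rw [Finset.mul_sum]
  refine Finset.sum_le_sum fun V hV => ?_
  rw [Finset.sum_const, nsmul_eq_mul]
  refine mul_le_mul_of_nonneg_right ?_ (ind_nonneg _)
  exact_mod_cast card_perfectMatchings_le t V (Finset.mem_powersetCard.1 hV).2

theorem exists_circ_of_dep {K : Type*} [DecidableEq K] {m : ℕ} {y : K → Key k m}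
    (hy : Function.Injective y) {t : ℕ} {V : Finset K} (hV : V.card = 2 * t)
    {E : Finset (K × K)} (hE : E ∈ perfectMatchings t V)
    (h : ∃ S ⊆ E, S.Nonempty ∧ Zero y (supp S)) :
    ∃ w, 2 ≤ w ∧ w ≤ t ∧ ∃ Z ⊆ V, Z.card = 2 * w ∧ Zero y Z ∧ (∃ S ⊆ E, supp S = Z) := by
  obtain ⟨S, hS, hSn, hz⟩ := h
  obtain ⟨hM, hs⟩ := perfectMatchings_spec t V hV hE
  have hc := (hM.mono hS).card_supp
  have h2 := card_ne_two_of_zero hy hz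
  have h3 := hSn.card_pos
  have hsub : supp S ⊆ V := hs ▸ supp_mono hS
  have := Finset.card_le_card hsub
  exact ⟨S.card, by omega, by omega, supp S, hsub, hc, hz, S, hS, rfl⟩

/-- For keys without derived characters, where zero sets of every size are bounded directly and a
reduction to circuits is not needed. -/
theorem sum_dep_le_zero {K : Type*} [DecidableEq K] {m : ℕ} {y : K → Key k m}
    (hy : Function.Injective y) (A : Finset K) (t : ℕ) :
    ∑ V ∈ A.powersetCard (2 * t), ∑ E ∈ perfectMatchings t V,
        ind (∃ S ⊆ E, S.Nonempty ∧ Zero y (supp S)) ≤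
      ∑ w ∈ Finset.Icc 2 t, (∑ Z ∈ A.powersetCard (2 * w), ind (Zero y Z)) *
        (oddFact w * oddFact (t - w) *
          ((A.card : ℝ) ^ (2 * t - 2 * w) / (2 * t - 2 * w).factorial)) := by
  have h1 : ∀ V ∈ A.powersetCard (2 * t), ∀ E ∈ perfectMatchings t V,
      ind (∃ S ⊆ E, S.Nonempty ∧ Zero y (supp S)) ≤
      ∑ w ∈ Finset.Icc 2 t, ∑ Z ∈ A.powersetCard (2 * w),
        ind (Zero y Z) * ind (Z ⊆ V ∧ ∃ S ⊆ E, supp S = Z) := by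
    intro V hV E hE
    rw [Finset.mem_powersetCard] at hV
    have h2 : (∃ S ⊆ E, S.Nonempty ∧ Zero y (supp S)) → ∃ w ∈ Finset.Icc 2 t,
        ∃ Z ∈ A.powersetCard (2 * w), Zero y Z ∧ (Z ⊆ V ∧ ∃ S ⊆ E, supp S = Z) := by
      intro h
      obtain ⟨w, hw2, hwt, Z, hZV, hZc, hZ, hSZ⟩ := exists_circ_of_dep hy hV.2 hE h
      exact ⟨w, Finset.mem_Icc.2 ⟨hw2, hwt⟩, Z,
        Finset.mem_powersetCard.2 ⟨hZV.trans hV.1, hZc⟩, hZ, hZV, hSZ⟩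
    refine (ind_mono h2).trans ?_
    refine (ind_exists_le _ _).trans (Finset.sum_le_sum fun v _ => ?_)
    refine (ind_exists_le _ _).trans (Finset.sum_le_sum fun Y _ => ?_)
    rw [ind_and]
  refine (Finset.sum_le_sum fun V hV => Finset.sum_le_sum fun E hE => h1 V hV E hE).trans ?_
  simp_rw [Finset.sum_comm (s := perfectMatchings _ _)]
  rw [Finset.sum_comm]
  refine Finset.sum_le_sum fun w _ => ?_
  rw [Finset.sum_comm, Finset.sum_mul]
  refine Finset.sum_le_sum fun Z hZ => ?_
  simp_rw [← Finset.mul_sum]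
  exact mul_le_mul_of_nonneg_left
    (sum_matchings_superset_le A Z t w (Finset.mem_powersetCard.1 hZ).2) (ind_nonneg _)

/-- A dependent set of edges spans a zero set. Either this is a circuit that is a union of edges, or
it contains a circuit of at most half its size. -/
theorem sum_dep_le_circ {K : Type*} [DecidableEq K] {m : ℕ} (hm : 0 < m) {y : K → Key k m}
    (hy : Function.Injective y) (A : Finset K) (t : ℕ) :
    ∑ V ∈ A.powersetCard (2 * t), ∑ E ∈ perfectMatchings t V,
        ind (∃ S ⊆ E, S.Nonempty ∧ Zero y (supp S)) ≤
      ∑ w ∈ Finset.Icc 2 t, (∑ Z ∈ A.powersetCard (2 * w), ind (Circ y Z)) *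
        (oddFact w * oddFact (t - w) *
          ((A.card : ℝ) ^ (2 * t - 2 * w) / (2 * t - 2 * w).factorial)) +
      ∑ v ∈ Finset.Icc 2 (t / 2), (∑ Z ∈ A.powersetCard (2 * v), ind (Circ y Z)) *
        (oddFact t * ((A.card : ℝ) ^ (2 * t - 2 * v) / (2 * t - 2 * v).factorial)) := by
  have h1 : ∀ V ∈ A.powersetCard (2 * t), ∀ E ∈ perfectMatchings t V,
      ind (∃ S ⊆ E, S.Nonempty ∧ Zero y (supp S)) ≤
      ∑ w ∈ Finset.Icc 2 t, ∑ Z ∈ A.powersetCard (2 * w),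
        ind (Circ y Z) * ind (Z ⊆ V ∧ ∃ S ⊆ E, supp S = Z) +
      ∑ v ∈ Finset.Icc 2 (t / 2), ∑ Z ∈ A.powersetCard (2 * v),
        ind (Circ y Z) * ind (Z ⊆ V) := by
    intro V hV E hE
    rw [Finset.mem_powersetCard] at hV
    have h2 : (∃ S ⊆ E, S.Nonempty ∧ Zero y (supp S)) → (∃ w ∈ Finset.Icc 2 t,
        ∃ Z ∈ A.powersetCard (2 * w), Circ y Z ∧ (Z ⊆ V ∧ ∃ S ⊆ E, supp S = Z)) ∨
        ∃ v ∈ Finset.Icc 2 (t / 2), ∃ Z ∈ A.powersetCard (2 * v), Circ y Z ∧ Z ⊆ V := by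
      intro h
      obtain ⟨w, hw2, hwt, Z, hZV, hZc, hZ, hSZ⟩ := exists_circ_of_dep hy hV.2 hE h
      by_cases hc : Circ y Z
      · exact Or.inl ⟨w, Finset.mem_Icc.2 ⟨hw2, hwt⟩, Z,
          Finset.mem_powersetCard.2 ⟨hZV.trans hV.1, hZc⟩, hc, hZV, hSZ⟩
      · obtain ⟨Y, hYZ, hY, hle⟩ := exists_circ_half (Finset.card_pos.1 (by omega)) hZ hc
        obtain ⟨v, hv2, hv⟩ := exists_card_of_zero hy hm hY.1 hY.2.1
        exact Or.inr ⟨v, Finset.mem_Icc.2 ⟨hv2, by omega⟩, Y,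
          Finset.mem_powersetCard.2 ⟨hYZ.trans (hZV.trans hV.1), hv⟩, hY, hYZ.trans hZV⟩
    refine (ind_mono h2).trans ((ind_or_le _ _).trans (add_le_add ?_ ?_))
    all_goals
      refine (ind_exists_le _ _).trans (Finset.sum_le_sum fun v _ => ?_)
      refine (ind_exists_le _ _).trans (Finset.sum_le_sum fun Y _ => ?_)
      rw [ind_and]
  refine (Finset.sum_le_sum fun V hV => Finset.sum_le_sum fun E hE => h1 V hV E hE).trans ?_
  simp_rw [Finset.sum_add_distrib, Finset.sum_comm (s := perfectMatchings _ _)]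
  refine add_le_add ?_ ?_
  · rw [Finset.sum_comm]
    refine Finset.sum_le_sum fun w _ => ?_
    rw [Finset.sum_comm, Finset.sum_mul]
    refine Finset.sum_le_sum fun Z hZ => ?_
    simp_rw [← Finset.mul_sum]
    exact mul_le_mul_of_nonneg_left
      (sum_matchings_superset_le A Z t w (Finset.mem_powersetCard.1 hZ).2) (ind_nonneg _)
  · rw [Finset.sum_comm]
    refine Finset.sum_le_sum fun w _ => ?_
    rw [Finset.sum_comm, Finset.sum_mul]
    refine Finset.sum_le_sum fun Z hZ => ?_
    simp_rw [← Finset.mul_sum]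
    exact mul_le_mul_of_nonneg_left
      (sum_matchings_superset_le' A Z t w (Finset.mem_powersetCard.1 hZ).2) (ind_nonneg _)

/-- The relative weight of the obstructions with `2 t` keys. -/
noncomputable def depWeight (b : ℕ → ℝ) (t : ℕ) : ℝ :=
  ∑ w ∈ Finset.Icc 2 t, (t.choose w : ℝ) * max 1 (b w) +
    ∑ v ∈ Finset.Icc 2 (t / 2), ((2 * t).choose (2 * v) : ℝ) * b v

/-- After division by the factorials, the choices of a circuit with a matching that respects it
combine to C(t, w), those with an arbitrary matching to C(2t, 2v), each over 2^t t!. The maximum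
with 1 in `depWeight` covers level 0, where zero sets have relative weight 1. -/
theorem depAvg_le (A : Finset (Key k c)) {L : ℕ} {b : ℕ → ℝ}
    (hb : CircuitWeights (2 ^ k) L b) (i t : ℕ) (htL : t ≤ L) :
    depAvg A i t ≤ 3 ^ c * (3 / 2 ^ k) ^ i * (A.card : ℝ) ^ (2 * t - 2) *
      (depWeight b t / (2 ^ t * t.factorial)) := by
  have hs : (0 : ℝ) < 2 ^ k := by positivity
  have hb0 : ∀ w, 2 ≤ w → w ≤ L → 0 ≤ b w := fun w h1 h2 =>
    (levelFactor_nonneg hs.le w).trans (hb.first w h1 h2)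
  set P : ℝ := 3 ^ c * (3 / 2 ^ k) ^ i with hP
  have hP0 : 0 ≤ P := by positivity
  have e1 : ∀ w, 2 ≤ w → w ≤ t → ∀ x : ℝ,
      (x * P * ((A.card : ℝ) ^ (2 * w - 2) / (2 * w).factorial)) *
        (oddFact w * oddFact (t - w) *
          ((A.card : ℝ) ^ (2 * t - 2 * w) / (2 * t - 2 * w).factorial)) =
      P * (A.card : ℝ) ^ (2 * t - 2) * ((t.choose w : ℝ) * x / (2 ^ t * t.factorial)) := by
    intro w hw hwt x
    have h1 := oddFact_div_factorial w
    have h2 := oddFact_div_factorial (t - w)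
    rw [show 2 * (t - w) = 2 * t - 2 * w by omega] at h2
    calc _ = P * ((A.card : ℝ) ^ (2 * w - 2) * (A.card : ℝ) ^ (2 * t - 2 * w)) * x *
          (oddFact w / (2 * w).factorial) * (oddFact (t - w) / (2 * t - 2 * w).factorial) := by
          ring
      _ = _ := by
          rw [h1, h2, ← pow_add, show 2 * w - 2 + (2 * t - 2 * w) = 2 * t - 2 by omega,
            Nat.cast_choose ℝ hwt]
          have h3 : (2 : ℝ) ^ t = 2 ^ w * 2 ^ (t - w) := by
            rw [← pow_add]; congr 1; omega
          rw [h3]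
          have h4 : (t.factorial : ℝ) ≠ 0 := by positivity
          field_simp
  have e2 : ∀ v, 2 ≤ v → v ≤ t → ∀ x : ℝ,
      (x * P * ((A.card : ℝ) ^ (2 * v - 2) / (2 * v).factorial)) *
        (oddFact t * ((A.card : ℝ) ^ (2 * t - 2 * v) / (2 * t - 2 * v).factorial)) =
      P * (A.card : ℝ) ^ (2 * t - 2) *
        (((2 * t).choose (2 * v) : ℝ) * x / (2 ^ t * t.factorial)) := by
    intro v hv hvt x
    have hvt2 : 2 * v ≤ 2 * t := by omega
    have h1 := oddFact_div_factorial t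
    rw [div_eq_div_iff (by positivity) (by positivity), one_mul] at h1
    rw [Nat.cast_choose ℝ hvt2,
      show 2 * t - 2 = (2 * v - 2) + (2 * t - 2 * v) by omega, pow_add, ← h1]
    have h4 : (oddFact t : ℝ) ≠ 0 := by have := oddFact_pos t; positivity
    field_simp
  rcases Nat.eq_zero_or_pos i with rfl | hi
  · have hle : depAvg A 0 t ≤ ∑ w ∈ Finset.Icc 2 t, zeroAvg A 0 w *
        (oddFact w * oddFact (t - w) *
          ((A.card : ℝ) ^ (2 * t - 2 * w) / (2 * t - 2 * w).factorial)) := by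
      unfold depAvg zeroAvg
      simp_rw [← avg_mul_right]
      rw [← avg_sum]
      exact avg_mono fun T => sum_dep_le_zero (derivedKey_injective 0 T) A t
    refine hle.trans ?_
    unfold depWeight
    rw [add_div, mul_add, Finset.sum_div, Finset.mul_sum]
    refine le_add_of_le_of_nonneg (Finset.sum_le_sum fun w hw => ?_) ?_
    · rw [Finset.mem_Icc] at hw
      rw [← e1 w hw.1 hw.2]
      gcongr
      refine (zeroAvg_zero_le A w hw.1).trans ?_
      rw [mul_div_assoc, hP, pow_zero, mul_one]
      gcongr
      exact le_mul_of_one_le_left (by positivity) (le_max_left _ _)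
    · refine mul_nonneg (by positivity) (div_nonneg (Finset.sum_nonneg fun v hv => ?_)
        (by positivity))
      rw [Finset.mem_Icc] at hv
      exact mul_nonneg (by positivity) (hb0 v hv.1 (by omega))
  · have hle : depAvg A i t ≤ ∑ w ∈ Finset.Icc 2 t, circAvg A i w *
        (oddFact w * oddFact (t - w) *
          ((A.card : ℝ) ^ (2 * t - 2 * w) / (2 * t - 2 * w).factorial)) +
        ∑ v ∈ Finset.Icc 2 (t / 2), circAvg A i v *
        (oddFact t * ((A.card : ℝ) ^ (2 * t - 2 * v) / (2 * t - 2 * v).factorial)) := by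
      unfold depAvg circAvg
      simp_rw [← avg_mul_right]
      rw [← avg_sum, ← avg_sum, ← avg_add]
      exact avg_mono fun T => sum_dep_le_circ (by omega) (derivedKey_injective i T) A t
    refine hle.trans ?_
    obtain ⟨j, rfl⟩ : ∃ j, i = j + 1 := ⟨i - 1, by omega⟩
    unfold depWeight
    rw [add_div, mul_add, Finset.sum_div, Finset.mul_sum, Finset.sum_div, Finset.mul_sum]
    refine add_le_add (Finset.sum_le_sum fun w hw => ?_) (Finset.sum_le_sum fun v hv => ?_)
    · rw [Finset.mem_Icc] at hw
      rw [← e1 w hw.1 hw.2]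
      gcongr
      refine (circAvg_le A hb j w hw.1 (by omega)).trans ?_
      gcongr
      exact le_max_right _ _
    · rw [Finset.mem_Icc] at hv
      rw [← e2 v hv.1 (by omega)]
      gcongr
      exact circAvg_le A hb j v hv.1 (by omega)

end levels

/-! ### Obstructions -/

section exploration

variable {K : Type*} [DecidableEq K]

/-- `V ⊆ Z` is closed under `σ`, and closed under `τ` up to two of its points. -/
def Explored (Z : Finset K) (σ τ : K → K) (V : Finset K) : Prop :=
  V ⊆ Z ∧ (∀ x ∈ V, σ x ∈ V) ∧ ∃ P ⊆ V, P.card = 2 ∧ ∀ x ∈ V \ P, τ x ∈ V \ P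

/-- `f` is a fixed-point-free involution of `Z`. -/
def IsInvolutionOn (f : K → K) (Z : Finset K) : Prop :=
  ∀ x ∈ Z, f x ∈ Z ∧ f (f x) = x ∧ f x ≠ x

/-- An explored set consists of complete alternating cycles and one alternating path with end points
`P`. Either the path is extended across a τ-edge at its end `a`, or it has closed up and a new path
is begun. -/
theorem Explored.exists_superset {Z : Finset K} {σ τ : K → K} (hσ : IsInvolutionOn σ Z)
    (hτ : IsInvolutionOn τ Z) {V : Finset K} (hV : Explored Z σ τ V) (hne : V ≠ Z) :
    ∃ u ∈ Z, u ∉ V ∧ σ u ∉ V ∧ Explored Z σ τ (V ∪ {u, σ u}) := by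
  obtain ⟨hVZ, hVσ, P, hPV, hP2, hPτ⟩ := hV
  obtain ⟨a, b, hab, rfl⟩ := Finset.card_eq_two.1 hP2
  have haV : a ∈ V := hPV (by simp)
  have hbV : b ∈ V := hPV (by simp)
  have hσV : ∀ u ∈ Z, u ∉ V → σ u ∉ V := fun u hu huV h => huV (by
    rw [← (hσ u hu).2.1]; exact hVσ _ h)
  have hsub : ∀ u ∈ Z, V ∪ {u, σ u} ⊆ Z := fun u hu => by
    refine Finset.union_subset hVZ fun z hz => ?_
    rcases Finset.mem_insert.1 hz with rfl | hz
    · exact hu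
    · rw [Finset.mem_singleton.1 hz]; exact (hσ u hu).1
  have hcl : ∀ u ∈ Z, ∀ x ∈ V ∪ {u, σ u}, σ x ∈ V ∪ {u, σ u} := fun u hu x hx => by
    simp only [Finset.mem_union, Finset.mem_insert, Finset.mem_singleton] at hx ⊢
    rcases hx with hx | rfl | rfl
    · exact Or.inl (hVσ x hx)
    · exact Or.inr (Or.inr rfl)
    · exact Or.inr (Or.inl (hσ u hu).2.1)
  by_cases hτa : τ a ∈ V
  -- Here `τ a` can only be the other end `b`, so all of `V` is closed under `τ` and any unexplored
  -- pair starts a new path.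
  · have hτV : ∀ x ∈ V, τ x ∈ V := by
      have hnP : ∀ z, z ∈ ({a, b} : Finset K) → τ z ∈ V → τ z ∈ ({a, b} : Finset K) := by
        intro z hz h
        by_contra hn
        have := hPτ (τ z) (Finset.mem_sdiff.2 ⟨h, hn⟩)
        rw [(hτ z (hVZ (hPV hz))).2.1] at this
        exact (Finset.mem_sdiff.1 this).2 hz
      have hb : τ a = b := by
        have := hnP a (by simp) hτa
        simp only [Finset.mem_insert, Finset.mem_singleton] at this
        exact this.resolve_left (hτ a (hVZ haV)).2.2
      intro x hx
      by_cases hxP : x ∈ ({a, b} : Finset K)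
      · simp only [Finset.mem_insert, Finset.mem_singleton] at hxP
        rcases hxP with rfl | rfl
        · exact hτa
        · rw [← hb, (hτ a (hVZ haV)).2.1]; exact haV
      · exact (Finset.mem_sdiff.1 (hPτ x (Finset.mem_sdiff.2 ⟨hx, hxP⟩))).1
    obtain ⟨u, huZ, huV⟩ := Finset.exists_of_ssubset (Finset.ssubset_iff_subset_ne.2 ⟨hVZ, hne⟩)
    refine ⟨u, huZ, huV, hσV u huZ huV, hsub u huZ, hcl u huZ, {u, σ u},
      Finset.subset_union_right, Finset.card_pair (hσ u huZ).2.2.symm, ?_⟩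
    have hdis : Disjoint V {u, σ u} := by
      simp [huV, hσV u huZ huV]
    rw [Finset.union_sdiff_cancel_right hdis]
    exact hτV
  -- The new path runs on through `τ a` to `σ (τ a)`, which replaces `a` as an end point.
  · have huZ := (hτ a (hVZ haV)).1
    have hσu := hσV (τ a) huZ hτa
    have hbσ : b ≠ σ (τ a) := fun h => hσu (h ▸ hbV)
    refine ⟨τ a, huZ, hτa, hσu, hsub _ huZ, hcl _ huZ, {b, σ (τ a)}, ?_,
      Finset.card_pair hbσ, ?_⟩
    · intro z hz
      simp only [Finset.mem_insert, Finset.mem_singleton] at hz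
      rcases hz with rfl | rfl
      · exact Finset.mem_union_left _ hbV
      · simp
    · intro x hx
      simp only [Finset.mem_sdiff, Finset.mem_union, Finset.mem_insert, Finset.mem_singleton,
        not_or] at hx hPτ ⊢
      obtain ⟨hx1, hx2, hx3⟩ := hx
      have ha1 : τ a ≠ b := fun h => hτa (h ▸ hbV)
      have ha2 : τ a ≠ σ (τ a) := (hσ _ huZ).2.2.symm
      rcases hx1 with hx1 | hx1 | hx1
      · by_cases hxa : x = a
        · subst hxa
          exact ⟨Or.inr (Or.inl rfl), ha1, ha2⟩
        · obtain ⟨g1, g2, g3⟩ := hPτ x ⟨hx1, hxa, hx2⟩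
          exact ⟨Or.inl g1, g3, fun h => hσu (h ▸ g1)⟩
      · subst hx1
        rw [(hτ a (hVZ haV)).2.1]
        exact ⟨Or.inl haV, hab, fun h => hσu (h ▸ haV)⟩
      · exact absurd hx1 hx3

/-- The exploration stops at the first set without the property `Q`, where removing the pair added
last restores `Q`. As `Z` itself lacks `Q`, the whole of `Z` is never reached with `Q` intact. -/
theorem exists_explored {Z : Finset K} (hZ : Z.Nonempty) {σ τ : K → K}
    (hσ : IsInvolutionOn σ Z) (hτ : IsInvolutionOn τ Z) (Q : Finset K → Prop) (hQZ : ¬ Q Z)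
    (hQ : ∀ x ∈ Z, Q {x, σ x}) (L : ℕ) (hL : 1 ≤ L) :
    (∃ V, Explored Z σ τ V ∧ Q V ∧ V.card = 2 * L) ∨
      ∃ V t, 2 ≤ t ∧ t ≤ L ∧ Explored Z σ τ V ∧ V.card = 2 * t ∧ ¬ Q V ∧
        ∃ u ∈ V, Q (V \ {u, σ u}) := by
  induction L, hL using Nat.le_induction with
  | base =>
    obtain ⟨x, hx⟩ := hZ
    have hne := (hσ x hx).2.2
    refine Or.inl ⟨{x, σ x}, ⟨?_, ?_, {x, σ x}, subset_rfl, ?_, ?_⟩, hQ x hx, ?_⟩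
    · intro z hz
      rcases Finset.mem_insert.1 hz with rfl | hz
      · exact hx
      · rw [Finset.mem_singleton.1 hz]; exact (hσ x hx).1
    · intro z hz
      simp only [Finset.mem_insert, Finset.mem_singleton] at hz ⊢
      rcases hz with rfl | rfl
      · exact Or.inr rfl
      · exact Or.inl (hσ x hx).2.1
    · exact Finset.card_pair hne.symm
    · simp
    · exact Finset.card_pair hne.symm
  | succ L hL ih =>
    rcases ih with ⟨V, hV, hQV, hc⟩ | ⟨V, t, h2, htL, h⟩
    · have hne : V ≠ Z := fun h => hQZ (h ▸ hQV)
      obtain ⟨u, huZ, huV, hσu, hV'⟩ := hV.exists_superset hσ hτ hne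
      have hdis : Disjoint V {u, σ u} := by simp [huV, hσu]
      have hc' : (V ∪ {u, σ u}).card = 2 * (L + 1) := by
        rw [Finset.card_union_of_disjoint hdis, hc, Finset.card_pair (hσ u huZ).2.2.symm]
        ring
      by_cases hQ' : Q (V ∪ {u, σ u})
      · exact Or.inl ⟨_, hV', hQ', hc'⟩
      · refine Or.inr ⟨_, L + 1, by omega, le_rfl, hV', hc', hQ', u, by simp, ?_⟩
        rw [Finset.union_sdiff_cancel_right hdis]
        exact hQV
    · exact Or.inr ⟨V, t, h2, by omega, h⟩

theorem exists_edge_of_mem_supp {E : Finset (K × K)} {f : K → K} (hE : ∀ e ∈ E, f e.1 = e.2)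
    {V : Finset K} (hf : IsInvolutionOn f V) (hs : supp E = V) {u : K} (hu : u ∈ V) :
    ∃ e ∈ E, ({e.1, e.2} : Finset K) = {u, f u} := by
  rw [← hs] at hu
  obtain ⟨e, he, rfl | rfl⟩ := mem_supp.1 hu
  · exact ⟨e, he, by rw [hE e he]⟩
  · have h1 : e.1 ∈ V := hs ▸ mem_supp.2 ⟨e, he, Or.inl rfl⟩
    refine ⟨e, he, ?_⟩
    rw [← hE e he, (hf e.1 h1).2.1, Finset.pair_comm]

variable {k m : ℕ}

/-- No nonempty subset of `V` that is closed under `σ` is a zero set. -/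
def ClosedIndep (y : K → Key k m) (σ : K → K) (V : Finset K) : Prop :=
  ∀ S ⊆ V, S.Nonempty → (∀ x ∈ S, σ x ∈ S) → ¬ Zero y S

theorem closed_supp {E S : Finset (K × K)} {f : K → K} (hE : ∀ e ∈ E, f e.1 = e.2)
    {V : Finset K} (hf : IsInvolutionOn f V) (hs : supp E = V) (hS : S ⊆ E) :
    ∀ x ∈ supp S, f x ∈ supp S := by
  intro x hx
  obtain ⟨e, he, rfl | rfl⟩ := mem_supp.1 hx
  · rw [hE e (hS he)]; exact mem_supp.2 ⟨e, he, Or.inr rfl⟩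
  · have h1 : e.1 ∈ V := hs ▸ mem_supp.2 ⟨e, hS he, Or.inl rfl⟩
    rw [← hE e (hS he), (hf e.1 h1).2.1]
    exact mem_supp.2 ⟨e, he, Or.inl rfl⟩

theorem indepEdges_of_closedIndep {y : K → Key k m} {E E₀ : Finset (K × K)} {f : K → K}
    (hE : ∀ e ∈ E, f e.1 = e.2) (hM : IsMatching E) {V V₀ : Finset K}
    (hf : IsInvolutionOn f V) (hs : supp E = V) (h₀ : E₀ ⊆ E) (hV₀ : supp E₀ ⊆ V₀)
    (h : ClosedIndep y f V₀) : IndepEdges y E₀ := by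
  intro S hS hSn h0
  rw [← (hM.mono (hS.trans h₀)).sum_supp (fun x => keyVec (y x))] at h0
  exact h (supp S) ((supp_mono hS).trans hV₀) (supp_nonempty hSn)
    (closed_supp hE hf hs (hS.trans h₀)) h0

/-- A subset of `V` closed under the involution is the union of the edges that it contains. -/
theorem exists_dep_of_not_closedIndep {y : K → Key k m} {E : Finset (K × K)} {f : K → K}
    (hE : ∀ e ∈ E, f e.1 = e.2) {V : Finset K} (hf : IsInvolutionOn f V) (hs : supp E = V)
    (h : ¬ ClosedIndep y f V) : ∃ S ⊆ E, S.Nonempty ∧ Zero y (supp S) := by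
  simp only [ClosedIndep, not_forall, not_not] at h
  obtain ⟨Z, hZV, hZn, hcl, hz⟩ := h
  have hsupp : supp (E.filter fun e => e.1 ∈ Z) = Z := by
    ext x
    simp only [mem_supp, Finset.mem_filter]
    constructor
    · rintro ⟨e, ⟨he, h1⟩, rfl | rfl⟩
      · exact h1
      · rw [← hE e he]; exact hcl _ h1
    · intro hx
      have hxV := hZV hx
      rw [← hs] at hxV
      obtain ⟨e, he, h1⟩ := mem_supp.1 hxV
      refine ⟨e, ⟨he, ?_⟩, h1⟩
      rcases h1 with rfl | rfl
      · exact hx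
      · have h2 : e.1 ∈ V := hs ▸ mem_supp.2 ⟨e, he, Or.inl rfl⟩
        rw [← (hf e.1 h2).2.1, hE e he]
        exact hcl _ hx
  refine ⟨_, Finset.filter_subset _ _, ?_, hsupp.symm ▸ hz⟩
  rw [Finset.nonempty_iff_ne_empty]
  intro he
  rw [he] at hsupp
  rw [← hsupp] at hZn
  simp [supp] at hZn

/-- The edges of the two top levels of an obstruction. -/
def TopMatched (y : K → Key k m) (T₁ : Tables k k m) (T₂ : Tables k k (m + 1))
    (G : Finset (K × K) → Prop) (E E' : Finset (K × K)) : Prop :=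
  (G E ∧ Matched T₁ y E) ∧ (IndepEdges (ext T₁ y) E' ∧ Matched T₂ (ext T₁ y) E')

/-- The edges are independent except for a single dependency. -/
def NearlyIndep (y : K → Key k m) (E : Finset (K × K)) : Prop :=
  (∃ e ∈ E, IndepEdges y (E.erase e)) ∧ ∃ S ⊆ E, S.Nonempty ∧ Zero y (supp S)

/-- The exploration is applied with `Q` the independence of the σ-edges for the keys `y`. Recording
only the explored part of `Z` makes the union bound affordable: its t σ-edges and t-1 τ-edges almost
pay for the choice of 2t keys. -/
theorem exists_obstruction {y : K → Key k m} (hy : Function.Injective y) {T₁ : Tables k k m}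
    {T₂ : Tables k k (m + 1)} {Z A : Finset K} (hZA : Z ⊆ A)
    (hZ : Circ (ext T₂ (ext T₁ y)) Z) (L : ℕ) (hL : 1 ≤ L) :
    (∃ V ∈ A.powersetCard (2 * L), ∃ P ∈ V.powersetCard 2, ∃ E ∈ perfectMatchings L V,
      ∃ E' ∈ perfectMatchings (L - 1) (V \ P), TopMatched y T₁ T₂ (IndepEdges y) E E' ∧
        V ⊆ Z ∧ IndepKeys (ext T₂ (ext T₁ y)) V) ∨
    ∃ t ∈ Finset.Icc 2 L, ∃ V ∈ A.powersetCard (2 * t), ∃ P ∈ V.powersetCard 2,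
      ∃ E ∈ perfectMatchings t V, ∃ E' ∈ perfectMatchings (t - 1) (V \ P),
        TopMatched y T₁ T₂ (NearlyIndep y) E E' ∧
        V ⊆ Z ∧ ∀ x ∈ V, IndepKeys (ext T₂ (ext T₁ y)) (V.erase x) := by
  have hz1 : Zero (ext T₁ y) Z := zero_of_zero_ext hZ.2.1
  have hz0 : Zero y Z := zero_of_zero_ext hz1
  obtain ⟨σ, hσ'⟩ := exists_involution_of_even Z (fun x => simpleTab T₁ (y x))
    (even_of_zero_ext hz1)
  obtain ⟨τ, hτ'⟩ := exists_involution_of_even Z (fun x => simpleTab T₂ (ext T₁ y x))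
    (even_of_zero_ext hZ.2.1)
  have hσ : IsInvolutionOn σ Z := fun x hx => ⟨(hσ' x hx).1, (hσ' x hx).2.1, (hσ' x hx).2.2.1⟩
  have hτ : IsInvolutionOn τ Z := fun x hx => ⟨(hτ' x hx).1, (hτ' x hx).2.1, (hτ' x hx).2.2.1⟩
  have hprop : ∀ V, V ⊂ Z → IndepKeys (ext T₂ (ext T₁ y)) V := fun V hV S hS hSn =>
    hZ.2.2 S (hS.trans_ssubset hV) hSn
  have hQZ : ¬ ClosedIndep y σ Z := fun h =>
    h Z subset_rfl hZ.1 (fun x hx => (hσ x hx).1) hz0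
  -- A single σ-edge is independent, because two distinct keys never form a zero set.
  have hQ : ∀ x ∈ Z, ClosedIndep y σ {x, σ x} := by
    intro x hx S hS hSn hcl hS0
    have h2 := card_ne_two_of_zero hy hS0
    obtain ⟨z, hz⟩ := hSn
    have hzZ : z ∈ Z := by
      have := hS hz
      simp only [Finset.mem_insert, Finset.mem_singleton] at this
      rcases this with rfl | rfl
      · exact hx
      · exact (hσ x hx).1
    have hle := Finset.card_le_card hS
    rw [Finset.card_pair (hσ x hx).2.2.symm] at hle
    have : 1 < S.card := Finset.one_lt_card.2 ⟨z, hz, σ z, hcl z hz, (hσ z hzZ).2.2.symm⟩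
    omega
  have main : ∀ V t, 1 ≤ t → V.card = 2 * t → Explored Z σ τ V →
      IsInvolutionOn σ V ∧ ∃ P ∈ V.powersetCard 2, ∃ E ∈ perfectMatchings t V,
        ∃ E' ∈ perfectMatchings (t - 1) (V \ P), (∀ e ∈ E, σ e.1 = e.2) ∧ Matched T₁ y E ∧
          IndepEdges (ext T₁ y) E' ∧ Matched T₂ (ext T₁ y) E' := by
    rintro V t ht hVc ⟨hVZ, hVσ, P, hPV, hP2, hPτ⟩
    have hσV : IsInvolutionOn σ V := fun x hx => ⟨hVσ x hx, (hσ x (hVZ hx)).2⟩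
    have hVP : V \ P ⊆ Z := Finset.sdiff_subset.trans hVZ
    have hτV : IsInvolutionOn τ (V \ P) := fun x hx => ⟨hPτ x hx, (hτ x (hVP hx)).2⟩
    have hc : (V \ P).card = 2 * (t - 1) := by
      rw [Finset.card_sdiff_of_subset hPV, hVc, hP2]; omega
    obtain ⟨E, hE, hEσ⟩ := exists_perfectMatching_of_involution t V hVc σ hσV
    obtain ⟨E', hE', hEτ⟩ := exists_perfectMatching_of_involution (t - 1) (V \ P) hc τ hτV
    obtain ⟨hM', hs'⟩ := perfectMatchings_spec _ _ hc hE'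
    obtain ⟨hM, hs⟩ := perfectMatchings_spec _ _ hVc hE
    have hm' : Matched T₂ (ext T₁ y) E' := fun e he => by
      rw [← hEτ e he]
      exact ((hτ' e.1 (hVP (hs' ▸ mem_supp.2 ⟨e, he, Or.inl rfl⟩))).2.2.2).symm
    refine ⟨hσV, P, Finset.mem_powersetCard.2 ⟨hPV, hP2⟩, E, hE, E', hE', hEσ,
      fun e he => ?_, fun S hS hSn h0 => ?_, hm'⟩
    · rw [← hEσ e he]
      exact ((hσ' e.1 (hVZ (hs ▸ mem_supp.2 ⟨e, he, Or.inl rfl⟩))).2.2.2).symm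
    -- A dependency of τ-edges would be a zero set of fully derived keys that misses the nonempty
    -- set `P`, against the minimality of `Z`.
    · have h1 := sum_edges_ext (T := T₂) (fun e he => hm' e (hS he)) h0
      rw [← (hM'.mono hS).sum_supp (fun x => keyVec (ext T₂ (ext T₁ y) x))] at h1
      have hss : supp S ⊆ V \ P := hs' ▸ supp_mono hS
      refine hZ.2.2 (supp S) (Finset.ssubset_iff_subset_ne.2 ⟨hss.trans hVP, fun heq => ?_⟩)
        (supp_nonempty hSn) h1
      obtain ⟨a, ha⟩ := Finset.card_pos.1 (show 0 < P.card by omega)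
      have haS : a ∈ supp S := heq ▸ hVZ (hPV ha)
      exact (Finset.mem_sdiff.1 (hss haS)).2 ha
  rcases exists_explored hZ.1 hσ hτ (ClosedIndep y σ) hQZ hQ L hL with
    ⟨V, hV, hQV, hVc⟩ | ⟨V, t, ht2, htL, hV, hVc, hnQ, u, hu, hQu⟩
  · obtain ⟨hσV, P, hP, E, hE, E', hE', hEσ, hm, hi', hm'⟩ := main V L hL hVc hV
    obtain ⟨hM, hs⟩ := perfectMatchings_spec _ _ hVc hE
    -- Since `Q` holds for `V` but not for `Z`, the set is proper and all of its 2L keys are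
    -- independent at the top.
    have hVZ : V ⊂ Z := Finset.ssubset_iff_subset_ne.2 ⟨hV.1, fun h => hQZ (h ▸ hQV)⟩
    exact Or.inl ⟨V, Finset.mem_powersetCard.2 ⟨hV.1.trans hZA, hVc⟩, P, hP, E, hE, E', hE',
      ⟨⟨indepEdges_of_closedIndep hEσ hM hσV hs subset_rfl hs.subset hQV, hm⟩, hi', hm'⟩,
      hV.1, hprop V hVZ⟩
  · obtain ⟨hσV, P, hP, E, hE, E', hE', hEσ, hm, hi', hm'⟩ := main V t (by omega) hVc hV
    obtain ⟨hM, hs⟩ := perfectMatchings_spec _ _ hVc hE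
    obtain ⟨e, he, heu⟩ := exists_edge_of_mem_supp hEσ hσV hs hu
    have hsub : supp (E.erase e) ⊆ V \ {u, σ u} := by
      intro x hx
      obtain ⟨e', he', hxe⟩ := mem_supp.1 hx
      have hdis := hM.2 e he e' (Finset.mem_of_mem_erase he') (Finset.ne_of_mem_erase he').symm
      refine Finset.mem_sdiff.2 ⟨hs ▸ supp_mono (Finset.erase_subset _ _) hx, fun hxu => ?_⟩
      rw [← heu] at hxu
      exact Finset.disjoint_left.1 hdis hxu (by simpa using hxe)
    -- Here `V` may be all of `Z`, so independence at the top holds only after removal of a key;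
    -- this costs one factor p.
    exact Or.inr ⟨t, Finset.mem_Icc.2 ⟨ht2, htL⟩, V,
      Finset.mem_powersetCard.2 ⟨hV.1.trans hZA, hVc⟩, P, hP, E, hE, E', hE',
      ⟨⟨⟨⟨e, he, indepEdges_of_closedIndep hEσ hM hσV hs (Finset.erase_subset _ _) hsub hQu⟩,
        exists_dep_of_not_closedIndep hEσ hσV hs hnQ⟩, hm⟩, hi', hm'⟩, hV.1,
      fun x hx => hprop _ ((Finset.erase_ssubset hx).trans_subset hV.1)⟩

end exploration

/-! ### The union bound over obstructions -/

section union

variable {k r c : ℕ}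

theorem selProb_nonneg (f : Key k c → BitString r → Bool) (x : Key k c) : 0 ≤ selProb f x := by
  unfold selProb uniformProb; positivity

theorem selected_subset_of_selProb_eq_zero (f : Key k c → BitString r → Bool)
    (A : Finset (Key k c)) (hA : ∀ x ∉ A, selProb f x = 0) (h : Key k c → BitString r) :
    selected f h ⊆ A := by
  intro x hx
  by_contra hxA
  have h0 := hA x hxA
  rw [selProb, uniformProb_eq_avg, avg, div_eq_zero_iff] at h0
  rcases h0 with h0 | h0
  · rw [Finset.sum_eq_zero_iff_of_nonneg fun _ _ => ind_nonneg _] at h0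
    have := h0 (h x) (Finset.mem_univ _)
    rw [ind_true (show f x (h x) = true from hx)] at this
    exact one_ne_zero this
  · simp at h0

theorem exists_circ_of_not_linIndep {m : ℕ} {y : Key k c → Key k m} (hy : Function.Injective y)
    {X : Set (Key k c)} (h : ¬ LinIndep (y '' X)) : ∃ Z : Finset (Key k c), ↑Z ⊆ X ∧ Circ y Z := by
  classical
  simp only [LinIndep, not_forall, not_exists, Nat.not_odd_iff_even] at h
  obtain ⟨W, hWn, hWX, hW⟩ := h
  obtain ⟨Z, hZX, rfl⟩ := Finset.subset_set_image_iff.1 hWX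
  have hz : Zero y Z := by
    rw [zero_iff]
    intro j a
    have := hW j a
    rw [Finset.filter_image, Finset.card_image_of_injective _ hy] at this
    exact this
  obtain ⟨Y, hYZ, hY⟩ := exists_circ_subset Z (Finset.image_nonempty.1 hWn) hz
  exact ⟨Y, (Finset.coe_subset.2 hYZ).trans hZX, hY⟩

theorem avg_selected_const_le {m : ℕ} (f : Key k c → BitString r → Bool) (y : Key k c → Key k m)
    {A V : Finset (Key k c)} {p : ℝ} (hp : ∀ x ∈ A, selProb f x = p) (hV : V ⊆ A) :
    avg (fun T : Tables k r m =>
        ind (IndepKeys y V ∧ ∀ x ∈ V, f x (simpleTab T (y x)) = true)) ≤ p ^ V.card :=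
  (avg_selected_le f y V).trans
    (le_of_eq (Finset.prod_eq_pow_card fun x hx => hp x (hV hx)))

/-- The sum over all ways to choose the edges of the two top levels on sets of `2 t` keys. -/
noncomputable def topSum (A : Finset (Key k c)) (t : ℕ)
    (F : Finset (Key k c × Key k c) → Finset (Key k c × Key k c) → ℝ) : ℝ :=
  ∑ V ∈ A.powersetCard (2 * t), ∑ P ∈ V.powersetCard 2, ∑ E ∈ perfectMatchings t V,
    ∑ E' ∈ perfectMatchings (t - 1) (V \ P), F E E'

theorem topSum_mono {A : Finset (Key k c)} {t : ℕ}
    {F G : Finset (Key k c × Key k c) → Finset (Key k c × Key k c) → ℝ}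
    (h : ∀ V ∈ A.powersetCard (2 * t), ∀ P ∈ V.powersetCard 2, ∀ E ∈ perfectMatchings t V,
      ∀ E' ∈ perfectMatchings (t - 1) (V \ P), F E E' ≤ G E E') :
    topSum A t F ≤ topSum A t G :=
  Finset.sum_le_sum fun V hV => Finset.sum_le_sum fun P hP => Finset.sum_le_sum fun E hE =>
    Finset.sum_le_sum fun E' hE' => h V hV P hP E hE E' hE'

theorem avg_topSum {Ω : Type*} [Fintype Ω] (A : Finset (Key k c)) (t : ℕ)
    (F : Ω → Finset (Key k c × Key k c) → Finset (Key k c × Key k c) → ℝ) :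
    avg (fun ω => topSum A t (F ω)) = topSum A t fun E E' => avg fun ω => F ω E E' := by
  unfold topSum
  simp_rw [avg_sum]

theorem card_sdiff_of_mem_powersetCard {K : Type*} [DecidableEq K] {V P : Finset K} {t : ℕ}
    (hV : V.card = 2 * t) (hP : P ∈ V.powersetCard 2) : (V \ P).card = 2 * (t - 1) := by
  rw [Finset.mem_powersetCard] at hP
  rw [Finset.card_sdiff_of_subset hP.1, hV, hP.2]; omega

theorem topSum_le (A : Finset (Key k c)) (t : ℕ)
    (F : Finset (Key k c × Key k c) → ℝ) (hF : ∀ E, 0 ≤ F E) :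
    topSum A t (fun E _ => F E) ≤ ((2 * t).choose 2 * oddFact (t - 1)) *
      ∑ V ∈ A.powersetCard (2 * t), ∑ E ∈ perfectMatchings t V, F E := by
  unfold topSum
  rw [Finset.mul_sum]
  refine Finset.sum_le_sum fun V hV => ?_
  have hVc := (Finset.mem_powersetCard.1 hV).2
  calc _ ≤ ∑ P ∈ V.powersetCard 2, oddFact (t - 1) * ∑ E ∈ perfectMatchings t V, F E := by
        refine Finset.sum_le_sum fun P hP => ?_
        rw [Finset.mul_sum]
        refine Finset.sum_le_sum fun E _ => ?_
        rw [Finset.sum_const, nsmul_eq_mul]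
        refine mul_le_mul_of_nonneg_right ?_ (hF E)
        exact_mod_cast card_perfectMatchings_le _ _ (card_sdiff_of_mem_powersetCard hVc hP)
    _ = _ := by
        rw [Finset.sum_const, Finset.card_powersetCard, hVc, nsmul_eq_mul, mul_assoc]

theorem card_of_mem_perfectMatchings {K : Type*} [DecidableEq K] {V : Finset K} {t : ℕ}
    (hV : V.card = 2 * t) {E : Finset (K × K)} (hE : E ∈ perfectMatchings t V) : E.card = t := by
  obtain ⟨hM, hs⟩ := perfectMatchings_spec t V hV hE
  have := hM.card_supp
  rw [hs] at this
  omega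

/-- The independence of `E'` depends on the first tables, so the second tables are averaged first,
with the first ones fixed. -/
theorem avg_topMatched_le {m : ℕ} (y : Key k c → Key k m)
    (G : Finset (Key k c × Key k c) → Prop) (E E' : Finset (Key k c × Key k c)) :
    avg (fun T₁ : Tables k k m => avg fun T₂ : Tables k k (m + 1) =>
      ind (TopMatched y T₁ T₂ G E E')) ≤
      avg (fun T₁ : Tables k k m => ind (G E ∧ Matched T₁ y E)) * (1 / 2 ^ k) ^ E'.card := by
  rw [← avg_mul_right]
  refine avg_mono fun T₁ => ?_
  simp_rw [TopMatched, ind_and (G E ∧ _), avg_mul_left]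
  exact mul_le_mul_of_nonneg_left (avg_matched_le _ _) (ind_nonneg _)

/-- All edges but one are independent and give the power of 1/s; the remaining indicator keeps the
dependency for `depAvg`. -/
theorem avg_nearlyIndep_le {K : Type*} [DecidableEq K] {m t : ℕ} (y : K → Key k m)
    {E : Finset (K × K)} (hE : E.card = t) :
    avg (fun T : Tables k k m => ind (NearlyIndep y E ∧ Matched T y E)) ≤
      ind (∃ S ⊆ E, S.Nonempty ∧ Zero y (supp S)) * (1 / 2 ^ k) ^ (t - 1) := by
  by_cases h : NearlyIndep y E
  · obtain ⟨⟨e, he, hi⟩, hS⟩ := h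
    rw [ind_true hS, one_mul, ← hE, ← Finset.card_erase_of_mem he]
    refine (avg_mono fun T => ind_mono fun h => ?_).trans (avg_matched_le y (E.erase e))
    exact ⟨hi, fun e' he' => h.2 e' (Finset.mem_of_mem_erase he')⟩
  · refine avg_le_of_le fun T => ?_
    rw [ind_false fun h' => h h'.1]
    exact mul_nonneg (ind_nonneg _) (by positivity)

/-- With the tables of the derived characters fixed, only the final hash function is random. It
decides the selection, so an obstruction has probability p^(2L) or, with one key removed, at most
p^(2t-1). -/
theorem avg_fail_le {m : ℕ} {y : Key k c → Key k m} (hy : Function.Injective y)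
    (T₁ : Tables k k m) (T₂ : Tables k k (m + 1)) (f : Key k c → BitString r → Bool)
    {A : Finset (Key k c)} {p : ℝ} (hp : ∀ x ∈ A, selProb f x = p)
    (hp' : ∀ x ∉ A, selProb f x = 0) (L : ℕ) (hL : 1 ≤ L) :
    avg (fun That : Tables k r (m + 1 + 1) => ind (¬ LinIndep (ext T₂ (ext T₁ y) ''
        selected f (fun x => simpleTab That (ext T₂ (ext T₁ y) x))))) ≤
      topSum A L (fun E E' => ind (TopMatched y T₁ T₂ (IndepEdges y) E E')) * p ^ (2 * L) +
      ∑ t ∈ Finset.Icc 2 L,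
        topSum A t (fun E E' => ind (TopMatched y T₁ T₂ (NearlyIndep y) E E')) *
          p ^ (2 * t - 1) := by
  set z := ext T₂ (ext T₁ y) with hz
  have hzi : Function.Injective z := ext_injective _ (ext_injective _ hy)
  let R : Finset (Key k c) → Tables k r (m + 1 + 1) → Prop := fun V That =>
    IndepKeys z V ∧ ∀ x ∈ V, f x (simpleTab That (z x)) = true
  have h1 : ∀ That : Tables k r (m + 1 + 1),
      ind (¬ LinIndep (z '' selected f (fun x => simpleTab That (z x)))) ≤
      (∑ V ∈ A.powersetCard (2 * L), ∑ P ∈ V.powersetCard 2, ∑ E ∈ perfectMatchings L V,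
        ∑ E' ∈ perfectMatchings (L - 1) (V \ P),
          ind (TopMatched y T₁ T₂ (IndepEdges y) E E') * ind (R V That)) +
      ∑ t ∈ Finset.Icc 2 L, ∑ V ∈ A.powersetCard (2 * t), ∑ P ∈ V.powersetCard 2,
        ∑ E ∈ perfectMatchings t V, ∑ E' ∈ perfectMatchings (t - 1) (V \ P),
          ind (TopMatched y T₁ T₂ (NearlyIndep y) E E') *
            ind (∀ x ∈ V, R (V.erase x) That) := by
    intro That
    set X := selected f (fun x => simpleTab That (z x)) with hX
    have hsel : ∀ V Z : Finset (Key k c), ↑Z ⊆ X → V ⊆ Z →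
        ∀ x ∈ V, f x (simpleTab That (z x)) = true := fun V Z hZ hV x hx => hZ (hV hx)
    have h2 : ¬ LinIndep (z '' X) →
      (∃ V ∈ A.powersetCard (2 * L), ∃ P ∈ V.powersetCard 2, ∃ E ∈ perfectMatchings L V,
        ∃ E' ∈ perfectMatchings (L - 1) (V \ P),
          TopMatched y T₁ T₂ (IndepEdges y) E E' ∧ R V That) ∨
      ∃ t ∈ Finset.Icc 2 L, ∃ V ∈ A.powersetCard (2 * t), ∃ P ∈ V.powersetCard 2,
        ∃ E ∈ perfectMatchings t V, ∃ E' ∈ perfectMatchings (t - 1) (V \ P),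
          TopMatched y T₁ T₂ (NearlyIndep y) E E' ∧ ∀ x ∈ V, R (V.erase x) That := by
      intro hfail
      obtain ⟨Z, hZX, hZ⟩ := exists_circ_of_not_linIndep hzi hfail
      have hZA : Z ⊆ A := by
        rw [← Finset.coe_subset]
        exact hZX.trans (selected_subset_of_selProb_eq_zero f A hp' _)
      rcases exists_obstruction hy hZA hZ L hL with
        ⟨V, hV, P, hP, E, hE, E', hE', hT, hVZ, hi⟩ |
        ⟨t, ht, V, hV, P, hP, E, hE, E', hE', hT, hVZ, hi⟩
      · exact Or.inl ⟨V, hV, P, hP, E, hE, E', hE', hT, hi, hsel V Z hZX hVZ⟩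
      · exact Or.inr ⟨t, ht, V, hV, P, hP, E, hE, E', hE', hT, fun x hx => ⟨hi x hx,
          hsel _ Z hZX ((Finset.erase_subset x V).trans hVZ)⟩⟩
    refine (ind_mono h2).trans ((ind_or_le _ _).trans (add_le_add ?_ ?_))
    · refine (ind_exists_le _ _).trans (Finset.sum_le_sum fun V _ => ?_)
      refine (ind_exists_le _ _).trans (Finset.sum_le_sum fun P _ => ?_)
      refine (ind_exists_le _ _).trans (Finset.sum_le_sum fun E _ => ?_)
      refine (ind_exists_le _ _).trans (Finset.sum_le_sum fun E' _ => ?_)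
      rw [ind_and]
    · refine (ind_exists_le _ _).trans (Finset.sum_le_sum fun t _ => ?_)
      refine (ind_exists_le _ _).trans (Finset.sum_le_sum fun V _ => ?_)
      refine (ind_exists_le _ _).trans (Finset.sum_le_sum fun P _ => ?_)
      refine (ind_exists_le _ _).trans (Finset.sum_le_sum fun E _ => ?_)
      refine (ind_exists_le _ _).trans (Finset.sum_le_sum fun E' _ => ?_)
      rw [ind_and]
  refine (avg_mono h1).trans ?_
  rw [avg_add]
  simp_rw [avg_sum, avg_mul_left]
  unfold topSum
  simp_rw [Finset.sum_mul]
  refine add_le_add ?_ ?_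
  · refine Finset.sum_le_sum fun V hV => Finset.sum_le_sum fun P _ =>
      Finset.sum_le_sum fun E _ => Finset.sum_le_sum fun E' _ =>
        mul_le_mul_of_nonneg_left ?_ (ind_nonneg _)
    rw [Finset.mem_powersetCard] at hV
    exact (avg_selected_const_le f z hp hV.1).trans_eq (by rw [hV.2])
  · refine Finset.sum_le_sum fun t ht => Finset.sum_le_sum fun V hV =>
      Finset.sum_le_sum fun P _ => Finset.sum_le_sum fun E _ => Finset.sum_le_sum fun E' _ =>
        mul_le_mul_of_nonneg_left ?_ (ind_nonneg _)
    rw [Finset.mem_powersetCard] at hV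
    rw [Finset.mem_Icc] at ht
    obtain ⟨x, hx⟩ := Finset.card_pos.1 (show 0 < V.card by omega)
    refine (avg_mono fun That => ind_mono fun h => h x hx).trans ?_
    refine (avg_selected_const_le f z hp ((Finset.erase_subset x V).trans hV.1)).trans_eq ?_
    rw [Finset.card_erase_of_mem hx, hV.2]

/-- The weight of the choices for the two top levels. -/
noncomputable def topWeight (t : ℕ) : ℝ :=
  ((2 * t).choose 2 * oddFact (t - 1)) / (2 ^ t * t.factorial)

/-- Balance of the exponents: the truncated case has n^(2L) p^(2L) s^(-(2L-1)) = s φ^(2L), the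
dependent case n^(2t-2) p^(2t-1) s^(-(2t-2)) = p φ^(2t-2) besides the rarity of the dependency. -/
theorem simpleFailProb_le (f : Key k c → BitString r → Bool) (A : Finset (Key k c)) {p : ℝ}
    (hp0 : 0 ≤ p) (hp : ∀ x ∈ A, selProb f x = p) (hp' : ∀ x ∉ A, selProb f x = 0)
    (i L : ℕ) (hL : 1 ≤ L) {b : ℕ → ℝ} (hb : CircuitWeights (2 ^ k) L b) :
    simpleFailProb (i + 2) f ≤
      topWeight L * (2 ^ k * (A.card * p / 2 ^ k) ^ (2 * L)) +
      ∑ t ∈ Finset.Icc 2 L, topWeight t * (p * (A.card * p / 2 ^ k) ^ (2 * t - 2) *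
        (3 ^ c * (3 / 2 ^ k) ^ i) * depWeight b t) := by
  have hs : (0 : ℝ) < 2 ^ k := by positivity
  set n : ℝ := ((A.card : ℕ) : ℝ) with hn
  let F : {m : ℕ} → (Key k c → Key k m) → ℝ := fun {m} y => avg fun That : Tables k r m =>
    ind (¬ LinIndep (y '' selected f (fun x => simpleTab That (y x))))
  have h0 : simpleFailProb (i + 2) f = avg fun T : DerivedTables k c i =>
      avg fun T₁ : Tables k k (c + i) => avg fun T₂ : Tables k k (c + i + 1) =>
        F (ext T₂ (ext T₁ (derivedKey i T))) := by
    unfold simpleFailProb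
    rw [uniformProb_eq_avg, avg_prod]
    refine (avg_derivedKey_succ (i + 1) (fun y => F y)).trans ?_
    exact avg_derivedKey_succ i (fun y => avg fun T₂ : Tables k k (c + (i + 1)) => F (ext T₂ y))
  have h1 : ∀ T : DerivedTables k c i, (avg fun T₁ : Tables k k (c + i) =>
      avg fun T₂ : Tables k k (c + i + 1) => F (ext T₂ (ext T₁ (derivedKey i T)))) ≤
      topSum A L (fun _ _ => (1 / 2 ^ k) ^ (L + (L - 1))) * p ^ (2 * L) +
      ∑ t ∈ Finset.Icc 2 L, topSum A t (fun E _ =>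
        ind (∃ S ⊆ E, S.Nonempty ∧ Zero (derivedKey i T) (supp S)) *
          (1 / 2 ^ k) ^ (2 * t - 2)) * p ^ (2 * t - 1) := by
    intro T
    refine (avg_mono fun T₁ => avg_mono fun T₂ =>
      avg_fail_le (derivedKey_injective i T) T₁ T₂ f hp hp' L hL).trans ?_
    simp_rw [avg_add, avg_sum, avg_mul_right, avg_topSum]
    refine add_le_add ?_ (Finset.sum_le_sum fun t ht => ?_)
    · refine mul_le_mul_of_nonneg_right (topSum_mono fun V hV P hP E hE E' hE' => ?_)
        (by positivity)
      have hVc := (Finset.mem_powersetCard.1 hV).2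
      refine (avg_topMatched_le _ _ _ _).trans ?_
      rw [pow_add, card_of_mem_perfectMatchings (card_sdiff_of_mem_powersetCard hVc hP) hE']
      refine mul_le_mul_of_nonneg_right ?_ (by positivity)
      have := avg_matched_le (l := k) (derivedKey i T) E
      rwa [card_of_mem_perfectMatchings hVc hE] at this
    · refine mul_le_mul_of_nonneg_right (topSum_mono fun V hV P hP E hE E' hE' => ?_)
        (by positivity)
      have hVc := (Finset.mem_powersetCard.1 hV).2
      rw [Finset.mem_Icc] at ht
      refine (avg_topMatched_le _ _ _ _).trans ?_
      rw [show 2 * t - 2 = (t - 1) + (t - 1) by omega, pow_add, ← mul_assoc,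
        card_of_mem_perfectMatchings (card_sdiff_of_mem_powersetCard hVc hP) hE']
      exact mul_le_mul_of_nonneg_right
        (avg_nearlyIndep_le _ (card_of_mem_perfectMatchings hVc hE)) (by positivity)
  rw [h0]
  refine (avg_mono h1).trans ?_
  rw [avg_add, avg_const, avg_sum]
  refine add_le_add ?_ (Finset.sum_le_sum fun t ht => ?_)
  · have hsum : ∑ V ∈ A.powersetCard (2 * L), ∑ _E ∈ perfectMatchings L V,
        (1 / 2 ^ k : ℝ) ^ (L + (L - 1)) ≤ n ^ (2 * L) / (2 ^ L * L.factorial) *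
          (1 / 2 ^ k) ^ (L + (L - 1)) := by
      calc _ ≤ ∑ V ∈ A.powersetCard (2 * L), oddFact L * (1 / 2 ^ k : ℝ) ^ (L + (L - 1)) := by
            refine Finset.sum_le_sum fun V hV => ?_
            rw [Finset.sum_const, nsmul_eq_mul]
            gcongr
            exact card_perfectMatchings_le _ _ (Finset.mem_powersetCard.1 hV).2
        _ ≤ n ^ (2 * L) / (2 * L).factorial * (oddFact L * (1 / 2 ^ k : ℝ) ^ (L + (L - 1))) := by
            rw [Finset.sum_const, Finset.card_powersetCard, nsmul_eq_mul]
            gcongr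
            exact Nat.choose_le_pow_div _ _
        _ = n ^ (2 * L) * (oddFact L / (2 * L).factorial) * (1 / 2 ^ k : ℝ) ^ (L + (L - 1)) := by
            ring
        _ = _ := by rw [oddFact_div_factorial]; ring
    calc _ ≤ ((2 * L).choose 2 * oddFact (L - 1)) * (n ^ (2 * L) / (2 ^ L * L.factorial) *
          (1 / 2 ^ k) ^ (L + (L - 1))) * p ^ (2 * L) := by
          gcongr
          refine (topSum_le A L (fun _ => (1 / 2 ^ k : ℝ) ^ (L + (L - 1)))
            fun _ => by positivity).trans ?_
          gcongr
      _ = _ := by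
          obtain ⟨l, rfl⟩ : ∃ l, L = l + 1 := ⟨L - 1, by omega⟩
          unfold topWeight
          rw [show l + 1 + (l + 1 - 1) = 2 * l + 1 by omega,
            show 2 * (l + 1) = 2 * l + 1 + 1 by ring, div_pow (n * p), mul_pow,
            div_pow (1 : ℝ), one_pow, pow_succ ((2 : ℝ) ^ k) (2 * l + 1)]
          field_simp
  · rw [Finset.mem_Icc] at ht
    calc _ ≤ avg (fun T : DerivedTables k c i => ((2 * t).choose 2 * oddFact (t - 1)) *
          (1 / 2 ^ k) ^ (2 * t - 2) * p ^ (2 * t - 1) *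
          ∑ V ∈ A.powersetCard (2 * t), ∑ E ∈ perfectMatchings t V,
            ind (∃ S ⊆ E, S.Nonempty ∧ Zero (derivedKey i T) (supp S))) := by
          refine avg_mono fun T => ?_
          refine (mul_le_mul_of_nonneg_right (topSum_le A t _
            fun E => mul_nonneg (ind_nonneg _) (by positivity)) (by positivity)).trans_eq ?_
          simp_rw [← Finset.sum_mul]
          ring
      _ = ((2 * t).choose 2 * oddFact (t - 1)) *
          (1 / 2 ^ k) ^ (2 * t - 2) * p ^ (2 * t - 1) * depAvg A i t := by
          rw [avg_mul_left]; rfl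
      _ ≤ ((2 * t).choose 2 * oddFact (t - 1)) *
          (1 / 2 ^ k) ^ (2 * t - 2) * p ^ (2 * t - 1) *
          (3 ^ c * (3 / 2 ^ k) ^ i * n ^ (2 * t - 2) *
            (depWeight b t / (2 ^ t * t.factorial))) := by
          gcongr
          exact depAvg_le A hb i t ht.2
      _ = _ := by
          unfold topWeight
          rw [show 2 * t - 1 = (2 * t - 2) + 1 by omega, pow_succ, div_pow (n * p),
            mul_pow, div_pow (1 : ℝ), one_pow]
          field_simp

end union

/-! ### Weights for the circuits and numerical estimates -/

section numerics

theorem topWeight_eq {t : ℕ} (ht : 1 ≤ t) :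
    topWeight t = t * ((2 * t).choose t : ℝ) / 4 ^ t := by
  obtain ⟨u, rfl⟩ : ∃ u, t = u + 1 := ⟨t - 1, by omega⟩
  have h1 : (((2 * (u + 1)).choose 2 : ℕ) : ℝ) = (u + 1) * (2 * u + 1) := by
    rw [Nat.cast_choose_two]; push_cast; ring
  have h2 := factorial_two_mul (u + 1)
  have h3 : (((2 * (u + 1)).choose (u + 1) : ℕ) : ℝ)
      = oddFact (u + 1) * 2 ^ (u + 1) / (u + 1).factorial := by
    rw [Nat.cast_choose ℝ (by omega), show 2 * (u + 1) - (u + 1) = u + 1 by omega, h2]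
    push_cast
    have : ((u + 1).factorial : ℝ) ≠ 0 := by positivity
    field_simp
  rw [h3, topWeight, h1, Nat.add_sub_cancel, oddFact_succ,
    show (4 : ℝ) ^ (u + 1) = 2 ^ (u + 1) * 2 ^ (u + 1) by rw [← mul_pow]; norm_num]
  push_cast
  have : ((u + 1).factorial : ℝ) ≠ 0 := by positivity
  field_simp

theorem topWeight_nonneg (t : ℕ) : 0 ≤ topWeight t := by
  unfold topWeight; positivity

/-- Numbers that make the union bound over obstructions with at most `2 L` keys small enough. -/
structure GoodWeights (k L : ℕ) (b : ℕ → ℝ) : Prop where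
  one_le : 1 ≤ L
  circuit : CircuitWeights (2 ^ k) L b
  trunc : ∀ f : ℝ, 0 ≤ f → f ≤ 1 / 2 →
    topWeight L * (2 ^ k * f ^ (2 * L)) ≤ f ^ ((2 ^ k : ℝ) / 2)
  sum_le : ∑ t ∈ Finset.Icc 2 L, topWeight t * (1 / 4) ^ (t - 2) * depWeight b t ≤ 81

/-- The exponent 2L exceeds s/2 by 2L - s/2, and as f ≤ 1/2 this surplus is worth a factor 2^(-(2L -
s/2)). -/
theorem trunc_of_le {k L : ℕ} (hk : 1 ≤ k) (hL : 2 ^ (k - 1) ≤ 2 * L)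
    (h : topWeight L * 2 ^ k ≤ 2 ^ (2 * L - 2 ^ (k - 1))) (f : ℝ) (hf0 : 0 ≤ f)
    (hf : f ≤ 1 / 2) : topWeight L * (2 ^ k * f ^ (2 * L)) ≤ f ^ ((2 ^ k : ℝ) / 2) := by
  have hexp : (2 ^ k : ℝ) / 2 = ((2 ^ (k - 1) : ℕ) : ℝ) := by
    obtain ⟨j, rfl⟩ : ∃ j, k = j + 1 := ⟨k - 1, by omega⟩
    push_cast
    rw [pow_succ]
    ring
  rw [hexp, Real.rpow_natCast]
  set M := 2 ^ (k - 1) with hM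
  have h1 : f ^ (2 * L) = f ^ M * f ^ (2 * L - M) := by rw [← pow_add]; congr 1; omega
  have h2 : f ^ (2 * L - M) ≤ (1 / 2) ^ (2 * L - M) := pow_le_pow_left₀ hf0 hf _
  calc _ = f ^ M * (topWeight L * 2 ^ k * f ^ (2 * L - M)) := by rw [h1]; ring
    _ ≤ f ^ M * 1 := by
        refine mul_le_mul_of_nonneg_left ?_ (by positivity)
        calc _ ≤ 2 ^ (2 * L - M) * (1 / 2 : ℝ) ^ (2 * L - M) := by
              gcongr
          _ = 1 := by rw [← mul_pow]; norm_num
    _ = _ := mul_one _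

/-- With weights in thousandths and all denominators cleared, the conditions become finitely many
inequalities between natural numbers. The factor 16^(L-t) · 16 comes from 4^(-t) in `topWeight_eq`
and from (1/4)^(t-2). -/
theorem goodWeights_of_nat {k L : ℕ} (hk : 1 ≤ k) (hL1 : 1 ≤ L) (B : ℕ → ℕ)
    (h1 : ∀ w < L + 1, 2 ≤ w → oddFact w * 1000 ≤ B w * (3 * (2 ^ k) ^ (w - 2)))
    (h2 : ∀ w < L + 1, 2 ≤ w → oddFact w * (B w +
      ∑ v ∈ Finset.Icc 2 (w / 2), (2 * w).choose (2 * v) * B v) ≤ B w * (3 * (2 ^ k) ^ (w - 2)))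
    (h3 : 2 ^ (k - 1) ≤ 2 * L)
    (h4 : L * (2 * L).choose L * 2 ^ k ≤ 2 ^ (2 * L - 2 ^ (k - 1)) * 4 ^ L)
    (h5 : ∑ t ∈ Finset.Icc 2 L, t * (2 * t).choose t * 16 ^ (L - t) * 16 *
      (∑ w ∈ Finset.Icc 2 t, t.choose w * max 1000 (B w) +
        ∑ v ∈ Finset.Icc 2 (t / 2), (2 * t).choose (2 * v) * B v) ≤ 81 * 1000 * 16 ^ L) :
    GoodWeights k L fun w => (B w : ℝ) / 1000 := by
  have hden : ∀ w, (0 : ℝ) < 3 * (2 ^ k) ^ (w - 2) := fun w => by positivity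
  refine ⟨hL1, ⟨fun w hw hwL => ?_, fun w hw hwL => ?_⟩, ?_, ?_⟩
  · rw [levelFactor, div_le_div_iff₀ (hden w) (by norm_num)]
    exact_mod_cast h1 w (by omega) hw
  · have h : (oddFact w : ℝ) * (B w + ∑ v ∈ Finset.Icc 2 (w / 2),
        ((2 * w).choose (2 * v) : ℝ) * B v) ≤ B w * (3 * (2 ^ k) ^ (w - 2)) := by
      exact_mod_cast h2 w (by omega) hw
    have e : (B w : ℝ) / 1000 + ∑ v ∈ Finset.Icc 2 (w / 2),
        ((2 * w).choose (2 * v) : ℝ) * ((B v : ℝ) / 1000) =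
        (B w + ∑ v ∈ Finset.Icc 2 (w / 2), ((2 * w).choose (2 * v) : ℝ) * B v) / 1000 := by
      rw [add_div, Finset.sum_div]
      simp_rw [mul_div_assoc]
    rw [e, levelFactor, div_mul_div_comm, div_le_div_iff₀ (mul_pos (hden w) (by norm_num))
      (by norm_num)]
    nlinarith [h]
  · refine trunc_of_le hk h3 ?_
    rw [topWeight_eq hL1, div_mul_eq_mul_div, div_le_iff₀ (by positivity)]
    exact_mod_cast h4
  · have h : (∑ t ∈ Finset.Icc 2 L, (t : ℝ) * (2 * t).choose t * 16 ^ (L - t) * 16 *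
        (∑ w ∈ Finset.Icc 2 t, (t.choose w : ℝ) * max 1000 (B w) +
        ∑ v ∈ Finset.Icc 2 (t / 2), ((2 * t).choose (2 * v) : ℝ) * B v)) ≤
        81 * 1000 * 16 ^ L := by exact_mod_cast h5
    rw [← div_le_iff₀ (by positivity), ← div_le_iff₀ (by norm_num), div_div,
      Finset.sum_div] at h
    refine le_trans (le_of_eq (Finset.sum_congr rfl fun t ht => ?_)) h
    rw [Finset.mem_Icc] at ht
    have e : depWeight (fun w => (B w : ℝ) / 1000) t =
        (∑ w ∈ Finset.Icc 2 t, (t.choose w : ℝ) * max 1000 (B w) +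
        ∑ v ∈ Finset.Icc 2 (t / 2), ((2 * t).choose (2 * v) : ℝ) * B v) / 1000 := by
      rw [depWeight, add_div, Finset.sum_div, Finset.sum_div]
      congr 1
      · refine Finset.sum_congr rfl fun w _ => ?_
        rw [mul_div_assoc, Nat.cast_max, ← max_div_div_right (by norm_num : (0 : ℝ) ≤ 1000),
          Nat.cast_ofNat, div_self (by norm_num)]
      · exact Finset.sum_congr rfl fun w _ => by rw [mul_div_assoc]
    rw [e, topWeight_eq (by omega)]
    obtain ⟨u, rfl⟩ : ∃ u, t = u + 2 := ⟨t - 2, by omega⟩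
    have hp : (16 : ℝ) ^ L = 16 ^ (L - (u + 2)) * (4 ^ (u + 2) * (4 ^ u * 16)) := by
      rw [show (4 : ℝ) ^ (u + 2) * (4 ^ u * 16) = 16 ^ (u + 2) by
        rw [show (16 : ℝ) = 4 * 4 by norm_num, mul_pow]; ring, ← pow_add]
      congr 1; omega
    rw [Nat.add_sub_cancel, hp, one_div, inv_pow]
    field_simp

/-! ### Small alphabets -/

theorem goodWeights_small {k : ℕ} (hk : k ≤ 1) : GoodWeights k 1 fun _ => 1 := by
  have hW : topWeight 1 = 1 / 2 := by rw [topWeight_eq le_rfl]; norm_num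
  -- For L = 1 no size lies between 2 and L, and only the truncation condition is not void.
  refine ⟨le_rfl, ⟨fun w h1 h2 => by omega, fun w h1 h2 => by omega⟩, fun f hf0 hf => ?_,
    by simp⟩
  rw [hW]
  interval_cases k
  · have h1 : f ^ 2 ≤ f ^ ((2 ^ 0 : ℝ) / 2) := by
      rw [← Real.rpow_natCast]
      rcases hf0.eq_or_lt with rfl | hpos
      · rw [Real.zero_rpow (by norm_num), Real.zero_rpow (by norm_num)]
      · exact Real.rpow_le_rpow_of_exponent_ge hpos (by linarith) (by norm_num)
    nlinarith [sq_nonneg f]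
  · rw [show ((2 : ℝ) ^ 1 / 2) = 1 by norm_num, Real.rpow_one]
    nlinarith

/-- Once the smaller weights are known, the step condition is linear in `b w`; entries of this and
the following tables can be found by solving it and rounding up to thousandths. -/
theorem goodWeights_two : GoodWeights 2 2 fun w => (([0, 0, 1000].getD w 0 : ℕ) : ℝ) / 1000 := by
  refine goodWeights_of_nat (by norm_num) (by norm_num) _ ?_ ?_ ?_ ?_ ?_ <;>
    (try simp only [Nat.choose_eq_descFactorial_div_factorial]) <;> decide +kernel

theorem goodWeights_three :
    GoodWeights 3 4 fun w => (([0, 0, 1000, 625, 84483].getD w 0 : ℕ) : ℝ) / 1000 := by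
  refine goodWeights_of_nat (by norm_num) (by norm_num) _ ?_ ?_ ?_ ?_ ?_ <;>
    (try simp only [Nat.choose_eq_descFactorial_div_factorial]) <;> decide +kernel

theorem goodWeights_four : GoodWeights 4 7 fun w =>
    (([0, 0, 1000, 313, 11086, 17496, 43778, 87122].getD w 0 : ℕ) : ℝ) / 1000 := by
  refine goodWeights_of_nat (by norm_num) (by norm_num) _ ?_ ?_ ?_ ?_ ?_ <;>
    (try simp only [Nat.choose_eq_descFactorial_div_factorial]) <;> decide +kernel

theorem goodWeights_five : GoodWeights 5 11 fun w =>
    (([0, 0, 1000, 157, 2478, 2039, 2123, 1980, 22019, 38260, 138932, 277481].getD w 0 : ℕ) : ℝ)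
      / 1000 := by
  refine goodWeights_of_nat (by norm_num) (by norm_num) _ ?_ ?_ ?_ ?_ ?_ <;>
    (try simp only [Nat.choose_eq_descFactorial_div_factorial]) <;> decide +kernel

theorem goodWeights_six : GoodWeights 6 21 fun w =>
    (([0, 0, 1000, 79, 604, 253, 118, 52, 101, 81, 102, 95, 118, 124, 165, 198, 446, 689, 1773,
      3202, 10421, 21545].getD w 0 : ℕ) : ℝ) / 1000 := by
  refine goodWeights_of_nat (by norm_num) (by norm_num) _ ?_ ?_ ?_ ?_ ?_ <;>
    (try simp only [Nat.choose_eq_descFactorial_div_factorial]) <;> decide +kernel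

/-- One thousandth serves for 8 ≤ w ≤ 35; the default value 14 of the list is the weight for w = 36,
37, 38. -/
theorem goodWeights_seven : GoodWeights 7 38 fun w =>
    ((([0, 0, 1000, 40, 150, 32, 7, 2] ++ List.replicate 28 1).getD w 14 : ℕ) : ℝ) / 1000 := by
  refine goodWeights_of_nat (by norm_num) (by norm_num) _ ?_ ?_ ?_ ?_ ?_ <;>
    (try simp only [Nat.choose_eq_descFactorial_div_factorial]) <;> decide +kernel

/-! ### Large alphabets -/

theorem oddFact_five_add_le (u : ℕ) : (oddFact (5 + u) : ℝ) ≤ 945 * (10 + u) ^ u := by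
  induction u with
  | zero => norm_num [oddFact, Finset.prod_range_succ]
  | succ u ih =>
    have ha : (0 : ℝ) < 10 + u := by positivity
    -- The factors 11, 13, …, 2u + 9 beyond 9!! = 945 have mean 10 + u, which explains the bound;
    -- its induction step is Bernoulli's inequality.
    have hB := one_add_mul_le_pow (a := 1 / (10 + (u : ℝ)))
      (le_trans (by norm_num) (show (0 : ℝ) ≤ 1 / (10 + (u : ℝ)) by positivity)) u
    have hkey : (2 * (5 + u) + 1 : ℝ) * (10 + u) ^ u ≤ (10 + (u + 1)) ^ (u + 1) := by
      have e : (10 + (u + 1) : ℝ) = (10 + u) * (1 + 1 / (10 + u)) := by field_simp; ring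
      rw [pow_succ]
      calc (2 * (5 + u) + 1 : ℝ) * (10 + u) ^ u
          ≤ ((1 + u * (1 / (10 + u))) * (10 + (u + 1))) * (10 + u) ^ u := by
            refine mul_le_mul_of_nonneg_right ?_ (by positivity)
            have h1 : (1 + u * (1 / (10 + u)) : ℝ) * (10 + (u + 1))
                = 2 * (5 + u) + 1 + u * (1 / (10 + u)) := by field_simp; ring
            rw [h1]
            have : (0 : ℝ) ≤ u * (1 / (10 + u)) := by positivity
            linarith
        _ ≤ ((1 + 1 / (10 + u)) ^ u * (10 + (u + 1))) * (10 + u) ^ u := by gcongr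
        _ = (10 + (u + 1)) ^ u * (10 + (u + 1)) := by
            rw [show (10 + (u + 1) : ℝ) ^ u = (10 + u) ^ u * (1 + 1 / (10 + u)) ^ u by
              rw [← mul_pow, ← e]]
            ring
    rw [← add_assoc, oddFact_succ]
    push_cast
    calc (2 * (5 + u) + 1 : ℝ) * oddFact (5 + u)
        ≤ (2 * (5 + u) + 1) * (945 * (10 + u) ^ u) := by gcongr
      _ = 945 * ((2 * (5 + u) + 1) * (10 + u) ^ u) := by ring
      _ ≤ _ := by gcongr

/-- Explicit weights for circuits over a large alphabet. -/
noncomputable def circuitWeight (s : ℝ) (w : ℕ) : ℝ :=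
  if w = 2 then 1 else if w = 3 then 5 / s else if w = 4 then 2520 / s ^ 2
    else levelFactor s w * 4 ^ w

/-- For w = 5 + u the weight is at most 322560/s³ times the u-th power of 4(w+5)/s ≤ q. The lower
bounds on s and q settle the constant and the cases w = 3, 4. -/
theorem circuitWeight_le {s q : ℝ} (hs : 256 ≤ s) (hq : 16 / 25 ≤ q) {w : ℕ} (hw : 3 ≤ w)
    (h : 4 * ((w : ℝ) + 5) ≤ q * s) : circuitWeight s w ≤ 1 / 4 * q ^ w := by
  have hs0 : 0 < s := by linarith
  unfold circuitWeight
  rw [if_neg (by omega)]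
  split_ifs with h3 h4
  · subst h3
    have : (16 / 25 : ℝ) ^ 3 ≤ q ^ 3 := by gcongr
    have h5 : 5 / s ≤ 5 / 256 := by gcongr
    norm_num at this
    linarith
  · subst h4
    have : (16 / 25 : ℝ) ^ 4 ≤ q ^ 4 := by gcongr
    have h5 : 2520 / s ^ 2 ≤ 2520 / 256 ^ 2 := by gcongr
    norm_num at this h5
    linarith
  · obtain ⟨u, rfl⟩ : ∃ u, w = 5 + u := ⟨w - 5, by omega⟩
    push_cast at h
    have hr : 4 * (10 + (u : ℝ)) / s ≤ q := by
      rw [div_le_iff₀ hs0]; linarith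
    have hq5 : (16 / 25 : ℝ) ^ 5 ≤ q ^ 5 := by gcongr
    calc levelFactor s (5 + u) * 4 ^ (5 + u)
        ≤ 945 * (10 + u) ^ u / (3 * s ^ (5 + u - 2)) * 4 ^ (5 + u) := by
          unfold levelFactor
          gcongr
          exact oddFact_five_add_le u
      _ = 322560 / s ^ 3 * (4 * (10 + u) / s) ^ u := by
          rw [show 5 + u - 2 = 3 + u by omega, pow_add, pow_add, div_pow, mul_pow]
          field_simp
          norm_num
      _ ≤ 322560 / 256 ^ 3 * q ^ u := by gcongr
      _ ≤ 1 / 4 * q ^ 5 * q ^ u := by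
          gcongr
          norm_num at hq5 ⊢
          linarith
      _ = _ := by rw [pow_add, mul_assoc]

theorem circuitWeight_two (s : ℝ) : circuitWeight s 2 = 1 := by
  simp [circuitWeight]

theorem sum_pairs_le (g : ℕ → ℕ) (M : ℕ) :
    ∑ v ∈ Finset.Icc 2 M, (g (2 * v - 1) + g (2 * v)) ≤ ∑ j ∈ Finset.range (2 * M + 1), g j := by
  induction M with
  | zero => simp
  | succ M ih =>
    rcases Nat.lt_or_ge M 1 with hM | hM
    · simp [show M = 0 by omega]
    · rw [Finset.sum_Icc_succ_top (by omega), show 2 * (M + 1) + 1 = 2 * M + 1 + 1 + 1 by ring,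
        Finset.sum_range_succ, Finset.sum_range_succ, show 2 * (M + 1) - 1 = 2 * M + 1 by omega,
        show 2 * (M + 1) = 2 * M + 2 by ring]
      omega

/-- By Pascal's rule the even entries of row 2w are sums of disjoint pairs of entries of row 2w - 1,
whose total is 4^w / 2. -/
theorem two_mul_sum_choose_even_le {w : ℕ} (hw : 1 ≤ w) :
    2 * ∑ v ∈ Finset.Icc 2 (w / 2), (2 * w).choose (2 * v) ≤ 4 ^ w := by
  obtain ⟨u, rfl⟩ : ∃ u, w = u + 1 := ⟨w - 1, by omega⟩
  have h1 : ∑ v ∈ Finset.Icc 2 ((u + 1) / 2), (2 * (u + 1)).choose (2 * v)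
      ≤ 2 ^ (2 * u + 1) := by
    calc _ = ∑ v ∈ Finset.Icc 2 ((u + 1) / 2),
          ((2 * u + 1).choose (2 * v - 1) + (2 * u + 1).choose (2 * v)) := by
          refine Finset.sum_congr rfl fun v hv => ?_
          rw [Finset.mem_Icc] at hv
          obtain ⟨x, rfl⟩ : ∃ x, v = x + 1 := ⟨v - 1, by omega⟩
          rw [show 2 * (u + 1) = 2 * u + 1 + 1 by ring, show 2 * (x + 1) = 2 * x + 1 + 1 by ring,
            Nat.choose_succ_succ, Nat.add_sub_cancel]
      _ ≤ ∑ j ∈ Finset.range (2 * ((u + 1) / 2) + 1), (2 * u + 1).choose j :=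
          sum_pairs_le _ _
      _ ≤ ∑ j ∈ Finset.range (2 * u + 1 + 1), (2 * u + 1).choose j :=
          Finset.sum_le_sum_of_subset (Finset.range_mono (by omega))
      _ = _ := Nat.sum_range_choose _
  calc _ ≤ 2 * 2 ^ (2 * u + 1) := by gcongr
    _ = 4 ^ (u + 1) := by
      rw [← pow_succ', show 2 * u + 1 + 1 = 2 * (u + 1) by ring, pow_mul]; norm_num

/-- For w ≥ 5 the factor 4^w in `circuitWeight` is split in half: one half bounds `b w` itself, the
other the sum over smaller circuits, which all have weight at most 1. -/
theorem circuitWeights_large {s : ℝ} (hs : 256 ≤ s) {L : ℕ}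
    (hL : 2 * (L : ℝ) + 20 ≤ 16 / 25 * s) : CircuitWeights s L (circuitWeight s) := by
  have hs0 : 0 < s := by linarith
  have hl2 : levelFactor s 2 = 1 := by norm_num [levelFactor, oddFact, Finset.prod_range_succ]
  have hl3 : levelFactor s 3 = 5 / s := by
    norm_num [levelFactor, oddFact, Finset.prod_range_succ]; field_simp; norm_num
  have hl4 : levelFactor s 4 = 35 / s ^ 2 := by
    norm_num [levelFactor, oddFact, Finset.prod_range_succ]; field_simp; norm_num
  have hb2 := circuitWeight_two s
  have hb3 : circuitWeight s 3 = 5 / s := by simp [circuitWeight]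
  have hb4 : circuitWeight s 4 = 2520 / s ^ 2 := by simp [circuitWeight]
  have hb : ∀ w, 5 ≤ w → circuitWeight s w = levelFactor s w * 4 ^ w := fun w hw => by
    rw [circuitWeight, if_neg (by omega), if_neg (by omega), if_neg (by omega)]
  refine ⟨fun w hw _ => ?_, fun w hw hwL => ?_⟩
  · rcases Nat.lt_or_ge w 5 with h | h
    · interval_cases w
      · rw [hl2, hb2]
      · rw [hl3, hb3]
      · rw [hl4, hb4]; gcongr; norm_num
    · rw [hb w h]
      exact le_mul_of_one_le_right (levelFactor_nonneg hs0.le w) (one_le_pow₀ (by norm_num))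
  · rcases Nat.lt_or_ge w 5 with h | h
    · interval_cases w
      · simp [hl2, hb2]
      · simp only [Nat.reduceDiv, Finset.Icc_eq_empty_of_lt (show 1 < 2 by norm_num),
          Finset.sum_empty, add_zero, hl3, hb3]
        have : 5 / s ≤ 1 := by rw [div_le_one hs0]; linarith
        exact mul_le_of_le_one_left (by positivity) this
      · simp only [Nat.reduceDiv, Finset.Icc_self, Finset.sum_singleton, hl4, hb2, hb4]
        -- Here 2520 = 35 · 72, and 72 exceeds C(8, 4) = 70 by enough to cover the weight of w = 4
        -- itself.
        have h1 : 2520 / s ^ 2 ≤ 2520 / 256 ^ 2 := by gcongr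
        rw [show (2520 : ℝ) / s ^ 2 = 35 / s ^ 2 * 72 by ring] at h1 ⊢
        refine mul_le_mul_of_nonneg_left ?_ (by positivity)
        norm_num [Nat.choose_eq_descFactorial_div_factorial, Nat.descFactorial,
          Nat.factorial] at h1 ⊢
        linarith
    · have hwL' : (w : ℝ) ≤ L := by exact_mod_cast hwL
      -- For w ≤ L the hypothesis gives 4(w+5) ≤ (32/25) s, so q = 3/2 is admissible; circuits of at
      -- most half size even allow q = 16/25.
      have h1 : circuitWeight s w ≤ 1 / 4 * (3 / 2) ^ w :=
        circuitWeight_le hs (by norm_num) (by omega) (by linarith)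
      have h2 : circuitWeight s w ≤ 4 ^ w / 2 := by
        have : (3 / 2 : ℝ) ^ w ≤ 4 ^ w := by gcongr; norm_num
        have : (0 : ℝ) < 4 ^ w := by positivity
        linarith
      have h3 : ∑ v ∈ Finset.Icc 2 (w / 2), ((2 * w).choose (2 * v) : ℝ) * circuitWeight s v
          ≤ 4 ^ w / 2 := by
        have h4 : ((2 * ∑ v ∈ Finset.Icc 2 (w / 2), (2 * w).choose (2 * v) : ℕ) : ℝ) ≤ 4 ^ w := by
          exact_mod_cast two_mul_sum_choose_even_le (w := w) (by omega)
        push_cast at h4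
        refine le_trans (Finset.sum_le_sum fun v hv => ?_)
          (by linarith : ∑ v ∈ Finset.Icc 2 (w / 2), ((2 * w).choose (2 * v) : ℝ) ≤ 4 ^ w / 2)
        rw [Finset.mem_Icc] at hv
        refine mul_le_of_le_one_right (by positivity) ?_
        rcases hv.1.eq_or_lt with rfl | hv3
        · exact hb2.le
        · have h5 : 2 * (v : ℝ) ≤ L := by
            have : 2 * v ≤ L := by omega
            exact_mod_cast this
          refine (circuitWeight_le hs le_rfl hv3 (by linarith)).trans ?_
          have : (16 / 25 : ℝ) ^ v ≤ 1 := pow_le_one₀ (by norm_num) (by norm_num)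
          linarith
      rw [hb w h]
      rw [hb w h] at h2
      exact mul_le_mul_of_nonneg_left (by linarith) (levelFactor_nonneg hs0.le w)

theorem topWeight_le {t : ℕ} (ht : 2 ≤ t) : topWeight t ≤ (10 + 3 * t) / 20 := by
  rcases Nat.lt_or_ge t 4 with h | h
  · rw [topWeight_eq (by omega)]
    interval_cases t <;>
      norm_num [Nat.choose_eq_descFactorial_div_factorial, Nat.descFactorial, Nat.factorial]
  -- The ratio of consecutive values is (2t+1)/(2t), and the linear bound keeps up with it exactly
  -- when t ≥ 10/3.
  · induction t, h using Nat.le_induction with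
    | base =>
      rw [topWeight_eq (by omega)]
      norm_num [Nat.choose_eq_descFactorial_div_factorial, Nat.descFactorial, Nat.factorial]
    | succ t h ih =>
      have ih := ih (by omega)
      have ht4 : (4 : ℝ) ≤ t := by exact_mod_cast h
      have hrec : topWeight (t + 1) = topWeight t * ((2 * t + 1) / (2 * t)) := by
        rw [topWeight_eq (by omega), topWeight_eq (by omega)]
        have := Nat.succ_mul_centralBinom_succ t
        rw [Nat.centralBinom, Nat.centralBinom] at this
        have h2 : ((t : ℝ) + 1) * ((2 * (t + 1)).choose (t + 1) : ℝ)
            = 2 * (2 * t + 1) * ((2 * t).choose t : ℝ) := by exact_mod_cast this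
        push_cast
        rw [h2, pow_succ]
        field_simp
        ring
      rw [hrec]
      calc topWeight t * ((2 * t + 1) / (2 * t))
          ≤ (10 + 3 * t) / 20 * ((2 * t + 1) / (2 * t)) := by gcongr
        _ ≤ _ := by
          push_cast
          rw [div_mul_div_comm, div_le_div_iff₀ (by positivity) (by positivity)]
          nlinarith

theorem sum_choose_mul_pow_le {x : ℝ} (hx : 0 ≤ x) (n : ℕ) (S : Finset ℕ)
    (hS : ∀ w ∈ S, w ≤ n) : ∑ w ∈ S, (n.choose w : ℝ) * x ^ w ≤ (1 + x) ^ n := by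
  rw [add_comm, add_pow]
  simp only [one_pow, mul_one]
  calc ∑ w ∈ S, (n.choose w : ℝ) * x ^ w = ∑ w ∈ S, x ^ w * (n.choose w : ℝ) :=
        Finset.sum_congr rfl fun _ _ => mul_comm _ _
    _ ≤ _ := Finset.sum_le_sum_of_subset_of_nonneg
        (fun w hw => Finset.mem_range.2 (Nat.lt_succ_of_le (hS w hw)))
        fun _ _ _ => by positivity

/-- Both sums are compared with binomial expansions: (1 + 3/2)^t for the circuits made of edges, and
(1 + 4/5)^(2t), as 16/25 = (4/5)², for the small ones. The circuits of four keys have weight 1 and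
are kept apart as C(2t, 4). -/
theorem depWeight_le {s : ℝ} (hs : 256 ≤ s) {L : ℕ} (hL : 2 * (L : ℝ) + 20 ≤ 16 / 25 * s)
    {t : ℕ} (htL : t ≤ L) : depWeight (circuitWeight s) t ≤ (5 / 2) ^ t +
      if 4 ≤ t then ((2 * t).choose 4 : ℝ) + 1 / 4 * (81 / 25) ^ t else 0 := by
  have htL' : (t : ℝ) ≤ L := by exact_mod_cast htL
  unfold depWeight
  refine add_le_add ?_ ?_
  · calc _ ≤ ∑ w ∈ Finset.Icc 2 t, (t.choose w : ℝ) * (3 / 2) ^ w := by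
          refine Finset.sum_le_sum fun w hw => mul_le_mul_of_nonneg_left (max_le ?_ ?_)
            (by positivity)
          · exact one_le_pow₀ (by norm_num)
          · rw [Finset.mem_Icc] at hw
            rcases hw.1.eq_or_lt with rfl | h3
            · rw [circuitWeight_two]; norm_num
            · have : (w : ℝ) ≤ t := by exact_mod_cast hw.2
              refine (circuitWeight_le (q := 3 / 2) hs (by norm_num) h3 (by linarith)).trans ?_
              have : (0 : ℝ) < (3 / 2) ^ w := by positivity
              linarith
      _ ≤ (1 + 3 / 2) ^ t := sum_choose_mul_pow_le (by norm_num) _ _ fun w hw =>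
          (Finset.mem_Icc.1 hw).2
      _ = _ := by norm_num
  · split_ifs with h4
    · rw [← Finset.add_sum_Ioc_eq_sum_Icc (by omega), circuitWeight_two, mul_one]
      refine add_le_add le_rfl ?_
      calc _ ≤ ∑ v ∈ Finset.Ioc 2 (t / 2), 1 / 4 * (((2 * t).choose (2 * v) : ℝ)
            * (4 / 5) ^ (2 * v)) := by
            refine Finset.sum_le_sum fun v hv => ?_
            rw [Finset.mem_Ioc] at hv
            have h5 : 2 * (v : ℝ) ≤ t := by
              have : 2 * v ≤ t := by omega
              exact_mod_cast this
            have := circuitWeight_le hs le_rfl (w := v) (by omega) (by linarith)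
            rw [pow_mul, show ((4 / 5 : ℝ) ^ 2) = 16 / 25 by norm_num]
            calc _ ≤ ((2 * t).choose (2 * v) : ℝ) * (1 / 4 * (16 / 25) ^ v) := by gcongr
              _ = _ := by ring
        _ = 1 / 4 * ∑ w ∈ (Finset.Ioc 2 (t / 2)).image (2 * ·),
            ((2 * t).choose w : ℝ) * (4 / 5) ^ w := by
            rw [Finset.sum_image (fun a _ b _ h => by simpa using h), Finset.mul_sum]
        _ ≤ 1 / 4 * (1 + 4 / 5) ^ (2 * t) := by
            refine mul_le_mul_of_nonneg_left (sum_choose_mul_pow_le (by norm_num) _ _ ?_)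
              (by norm_num)
            intro w hw
            obtain ⟨v, hv, rfl⟩ := Finset.mem_image.1 hw
            rw [Finset.mem_Ioc] at hv
            omega
        _ = _ := by rw [pow_mul]; norm_num
    · rw [Finset.Icc_eq_empty (by omega), Finset.sum_empty]

/-- From t = 7 on, the left side at most doubles at each step; the earlier values are computed. -/
theorem mul_choose_four_le {t : ℕ} (ht : 4 ≤ t) :
    (10 + 3 * t) * (2 * t).choose 4 ≤ 375 * 2 ^ t := by
  rcases Nat.lt_or_ge t 7 with h | h
  · interval_cases t <;>
      simp [Nat.choose_eq_descFactorial_div_factorial, Nat.descFactorial, Nat.factorial]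
  · induction t, h using Nat.le_induction with
    | base => simp [Nat.choose_eq_descFactorial_div_factorial, Nat.descFactorial, Nat.factorial]
    | succ t h ih =>
      have ih := ih (by omega)
      obtain ⟨u, rfl⟩ : ∃ u, t = u + 7 := ⟨t - 7, by omega⟩
      have e1 := Nat.descFactorial_eq_factorial_mul_choose (2 * (u + 7)) 4
      have e2 := Nat.descFactorial_eq_factorial_mul_choose (2 * (u + 7 + 1)) 4
      rw [show 2 * (u + 7) = 2 * u + 14 by ring] at e1 ih
      rw [show 2 * (u + 7 + 1) = 2 * u + 16 by ring] at e2 ⊢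
      simp only [Nat.descFactorial_succ, Nat.descFactorial_zero, Nat.reduceSubDiff, mul_one,
        Nat.sub_zero, show Nat.factorial 4 = 24 from rfl] at e1 e2
      have h24 : 24 * ((10 + 3 * (u + 7 + 1)) * (2 * u + 16).choose 4)
          ≤ 24 * (2 * ((10 + 3 * (u + 7)) * (2 * u + 14).choose 4)) := by
        calc _ = (10 + 3 * (u + 7 + 1)) * (24 * (2 * u + 16).choose 4) := by ring
          _ ≤ 2 * (10 + 3 * (u + 7)) * (24 * (2 * u + 14).choose 4) := by
            rw [← e1, ← e2]
            ring_nf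
            nlinarith [sq_nonneg u]
          _ = _ := by ring
      rw [pow_succ]
      omega

/-- A potential whose decrements dominate the terms of the union bound. -/
noncomputable def potential (t : ℕ) : ℝ :=
  16 * ((2 + 2 / 5 * t) * (5 / 8) ^ t) + (600 * (1 / 2) ^ (max t 4) +
    4 * ((6 + 15 / 19 * (max t 4 : ℕ)) * (81 / 100) ^ (max t 4)))

theorem potential_nonneg (t : ℕ) : 0 ≤ potential t := by
  unfold potential; positivity

/-- The three parts of the potential telescope against the three parts of `depWeight_le`, with decay
rates 5/8, 1/2 and 81/100. The last two parts of the weight vanish below t = 4, so there the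
potential is frozen by `max t 4`. -/
theorem term_le_potential {s : ℝ} (hs : 256 ≤ s) {L : ℕ} (hL : 2 * (L : ℝ) + 20 ≤ 16 / 25 * s)
    {t : ℕ} (ht : 2 ≤ t) (htL : t ≤ L) :
    topWeight t * (1 / 4) ^ (t - 2) * depWeight (circuitWeight s) t ≤
      potential t - potential (t + 1) := by
  have hA : ((1 / 4 : ℝ) ^ (t - 2)) = 16 * (1 / 4) ^ t := by
    obtain ⟨u, rfl⟩ : ∃ u, t = u + 2 := ⟨t - 2, by omega⟩
    rw [Nat.add_sub_cancel, pow_add]; ring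
  have hd := depWeight_le hs hL htL
  set D : ℝ := if 4 ≤ t then ((2 * t).choose 4 : ℝ) + 1 / 4 * (81 / 25) ^ t else 0 with hD
  have hD0 : 0 ≤ D := by rw [hD]; split_ifs <;> positivity
  have h1 : (1 / 4 : ℝ) ^ t * (5 / 2) ^ t = (5 / 8) ^ t := by rw [← mul_pow]; norm_num
  have h2 : (1 / 4 : ℝ) ^ t * (81 / 25) ^ t = (81 / 100) ^ t := by rw [← mul_pow]; norm_num
  calc _ ≤ topWeight t * (16 * (1 / 4) ^ t) * ((5 / 2) ^ t + D) := by
        rw [hA]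
        exact mul_le_mul_of_nonneg_left hd (mul_nonneg (topWeight_nonneg t) (by positivity))
    _ ≤ (10 + 3 * t) / 20 * (16 * (1 / 4) ^ t) * ((5 / 2) ^ t + D) := by
        have := topWeight_le ht
        gcongr
    _ = 16 * ((10 + 3 * t) / 20 * (5 / 8) ^ t) +
        16 * ((10 + 3 * t) / 20 * ((1 / 4) ^ t * D)) := by rw [← h1]; ring
    _ ≤ 16 * ((2 + 2 / 5 * t) * (5 / 8) ^ t - (2 + 2 / 5 * (t + 1 : ℕ)) * (5 / 8) ^ (t + 1)) +
        (600 * (1 / 2) ^ (max t 4) +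
          4 * ((6 + 15 / 19 * (max t 4 : ℕ)) * (81 / 100) ^ (max t 4)) -
        (600 * (1 / 2) ^ (max (t + 1) 4) +
          4 * ((6 + 15 / 19 * (max (t + 1) 4 : ℕ)) * (81 / 100) ^ (max (t + 1) 4)))) := by
        refine add_le_add (le_of_eq ?_) ?_
        · rw [pow_succ]; push_cast; ring
        · rcases Nat.lt_or_ge t 4 with h4 | h4
          · rw [hD, if_neg (by omega), max_eq_right (by omega), max_eq_right (by omega)]
            simp
          · rw [max_eq_left h4, max_eq_left (by omega), hD, if_pos h4, mul_add,
              mul_left_comm _ (1 / 4 : ℝ), h2]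
            have h5 : ((10 + 3 * t) * (2 * t).choose 4 : ℝ) ≤ 375 * 2 ^ t := by
              exact_mod_cast mul_choose_four_le h4
            have h6 : (1 / 2 : ℝ) ^ t = 2 ^ t * (1 / 4) ^ t := by
              rw [← mul_pow]; norm_num
            have h7 := mul_le_mul_of_nonneg_right h5 (by positivity : (0 : ℝ) ≤ (1 / 4) ^ t)
            have h8 : (0 : ℝ) < (81 / 100) ^ t := by positivity
            rw [pow_succ, pow_succ]
            push_cast
            nlinarith [h7, h6, h8]
    _ = _ := by unfold potential; ring

theorem sum_terms_le {s : ℝ} (hs : 256 ≤ s) {L : ℕ} (hL : 2 * (L : ℝ) + 20 ≤ 16 / 25 * s) :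
    ∑ t ∈ Finset.Icc 2 L, topWeight t * (1 / 4) ^ (t - 2) * depWeight (circuitWeight s) t
      ≤ 81 := by
  have htel : ∀ n, ∑ t ∈ Finset.Icc 2 n, (potential t - potential (t + 1)) ≤ potential 2 := by
    intro n
    rcases Nat.lt_or_ge n 2 with h | h
    · rw [Finset.Icc_eq_empty (by omega), Finset.sum_empty]; exact potential_nonneg 2
    · have : ∑ t ∈ Finset.Icc 2 n, (potential t - potential (t + 1))
          = potential 2 - potential (n + 1) := by
        induction n, h using Nat.le_induction with
        | base => simp
        | succ n h ih => rw [Finset.sum_Icc_succ_top (by omega), ih]; ring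
      linarith [potential_nonneg (n + 1)]
  refine (Finset.sum_le_sum fun t ht => ?_).trans ((htel L).trans ?_)
  · rw [Finset.mem_Icc] at ht
    exact term_le_potential hs hL ht.1 ht.2
  -- The value is about 70.8.
  · norm_num [potential]

/-- With L = s/4 + k - 1 the surplus 2L - s/2 is 2k - 2; the factor 2^(2k-2) pays for s and for the
top weight, which is at most 2^(k-2). -/
theorem goodWeights_large {k : ℕ} (hk : 8 ≤ k) :
    GoodWeights k (2 ^ (k - 2) + k - 1) (circuitWeight (2 ^ k)) := by
  -- This is 2L + 20 ≤ (16/25) s for the chosen L, and it first holds in this range at k = 8.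
  have hN : 50 * (2 * k + 18) ≤ 7 * 2 ^ k := by
    induction k, hk using Nat.le_induction with
    | base => norm_num
    | succ k hk ih => rw [pow_succ]; omega
  obtain ⟨j, rfl⟩ : ∃ j, k = j + 2 := ⟨k - 2, by omega⟩
  simp only [Nat.add_sub_cancel]
  set L := 2 ^ j + (j + 2) - 1 with hLdef
  have hj : 1 ≤ 2 ^ j := Nat.one_le_two_pow
  have hLn : L = 2 ^ j + j + 1 := by omega
  have hLr : (L : ℝ) = 2 ^ j + j + 1 := by rw [hLn]; push_cast; ring
  have hNr : 50 * (2 * ((j : ℝ) + 2) + 18) ≤ 7 * 2 ^ (j + 2) := by exact_mod_cast hN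
  have hs4 : (2 : ℝ) ^ (j + 2) = 4 * 2 ^ j := by rw [pow_add]; ring
  have hs : (256 : ℝ) ≤ 2 ^ (j + 2) := by
    calc (256 : ℝ) = 2 ^ 8 := by norm_num
      _ ≤ _ := pow_le_pow_right₀ (by norm_num) hk
  have hL : 2 * (L : ℝ) + 20 ≤ 16 / 25 * 2 ^ (j + 2) := by rw [hLr]; linarith
  have hexp : 2 ^ (j + 2 - 1) = 2 * 2 ^ j := by
    rw [show j + 2 - 1 = j + 1 by omega, pow_succ']
  refine ⟨by omega, circuitWeights_large hs hL, trunc_of_le (by omega) (by omega) ?_,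
    sum_terms_le hs hL⟩
  rw [hexp, show 2 * L - 2 * 2 ^ j = j + (j + 2) by omega, pow_add (2 : ℝ) j (j + 2)]
  refine mul_le_mul_of_nonneg_right ((topWeight_le (t := L) (by omega)).trans ?_)
    (by positivity : (0 : ℝ) ≤ 2 ^ (j + 2))
  rw [hLr]
  linarith

theorem exists_goodWeights (k : ℕ) : ∃ L b, GoodWeights k L b := by
  rcases Nat.lt_or_ge k 8 with h | h
  · rcases Nat.lt_or_ge k 2 with h2 | h2
    · exact ⟨_, _, goodWeights_small (by omega)⟩
    · interval_cases k
      exacts [⟨_, _, goodWeights_two⟩, ⟨_, _, goodWeights_three⟩, ⟨_, _, goodWeights_four⟩,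
        ⟨_, _, goodWeights_five⟩, ⟨_, _, goodWeights_six⟩, ⟨_, _, goodWeights_seven⟩]
  · exact ⟨_, _, goodWeights_large h⟩

end numerics

/-! ### The final bound and the twist -/

section main

variable {k r c : ℕ}

theorem expectedSize_eq (f : Key k c → BitString r → Bool) (A : Finset (Key k c)) {p : ℝ}
    (hp : ∀ x ∈ A, selProb f x = p) (hp' : ∀ x ∉ A, selProb f x = 0) :
    expectedSize f = A.card * p := by
  unfold expectedSize
  rw [← Finset.sum_subset (Finset.subset_univ A) fun x _ hx => hp' x hx, Finset.sum_congr rfl hp,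
    Finset.sum_const, nsmul_eq_mul]

theorem simpleFailProb_le_failBound (i : ℕ) (f : Key k c → BitString r → Bool)
    (A : Finset (Key k c)) (hA : A.Nonempty) {p : ℝ} (hp : ∀ x ∈ A, selProb f x = p)
    (hp' : ∀ x ∉ A, selProb f x = 0) (hμ : expectedSize f ≤ (2 ^ k : ℝ) / 2) :
    simpleFailProb (i + 2) f ≤ failBound (2 ^ k) A.card (expectedSize f) c (i + 2) := by
  obtain ⟨L, b, hb⟩ := exists_goodWeights k
  have hp0 : 0 ≤ p := by
    obtain ⟨x, hx⟩ := hA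
    rw [← hp x hx]
    exact selProb_nonneg f x
  have hs : (0 : ℝ) < 2 ^ k := by positivity
  have hn : (0 : ℝ) < A.card := by exact_mod_cast hA.card_pos
  rw [expectedSize_eq f A hp hp'] at hμ ⊢
  set s : ℝ := 2 ^ k with hs_def
  set φ : ℝ := A.card * p / s with hφ
  have hφ0 : 0 ≤ φ := by positivity
  have hφ1 : φ ≤ 1 / 2 := by rw [hφ, div_le_iff₀ hs]; linarith
  refine (simpleFailProb_le f A hp0 hp hp' i L hb.one_le hb.circuit).trans ?_
  rw [failBound, add_comm]
  refine add_le_add ?_ (hb.trunc φ hφ0 hφ1)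
  set P : ℝ := 3 ^ c * (3 / s) ^ i with hP
  have hd : ∀ t ≤ L, 0 ≤ depWeight b t := fun t ht => by
    unfold depWeight
    refine add_nonneg (Finset.sum_nonneg fun w _ => by positivity)
      (Finset.sum_nonneg fun v hv => mul_nonneg (by positivity) ?_)
    rw [Finset.mem_Icc] at hv
    exact (levelFactor_nonneg hs.le v).trans (hb.circuit.first v hv.1 (by omega))
  calc _ ≤ ∑ t ∈ Finset.Icc 2 L, p * φ ^ 2 * P *
        (topWeight t * (1 / 4) ^ (t - 2) * depWeight b t) := by
        refine Finset.sum_le_sum fun t ht => ?_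
        rw [Finset.mem_Icc] at ht
        have h1 : φ ^ (2 * t - 2) ≤ φ ^ 2 * (1 / 4) ^ (t - 2) := by
          rw [show 2 * t - 2 = 2 + 2 * (t - 2) by omega, pow_add, pow_mul φ 2 (t - 2)]
          have : φ ^ 2 ≤ 1 / 4 := by nlinarith
          gcongr
        calc _ ≤ topWeight t * (p * (φ ^ 2 * (1 / 4) ^ (t - 2)) * P * depWeight b t) := by
              have := topWeight_nonneg t
              have := hd t ht.2
              gcongr
          _ = _ := by ring
    _ ≤ p * φ ^ 2 * P * 81 := by
        rw [← Finset.mul_sum]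
        exact mul_le_mul_of_nonneg_left hb.sum_le (by positivity)
    _ = _ := by
        -- The constant 81 is 3 · 3³: the factor 3 of the bound and the three surplus factors 3/s in
        -- (3/s)^(d+1) for d = i + 2.
        rw [hP, hφ, pow_add (3 / s) (i + 2) 1, pow_add]
        field_simp
        norm_num

theorem twist_val_last {c : ℕ} (T₀ : Tables k k (c - 1)) (x : Key k c) (i : Fin c)
    (hi : (i : ℕ) + 1 = c) : twist T₀ x i =
      x i + simpleTab T₀ (fun j => x ⟨(j : ℕ), lt_of_lt_of_le j.isLt (Nat.sub_le c 1)⟩) := by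
  rw [twist, if_pos hi]

theorem twist_val_of_ne {c : ℕ} (T₀ : Tables k k (c - 1)) (x : Key k c) (i : Fin c)
    (hi : (i : ℕ) + 1 ≠ c) : twist T₀ x i = x i := by
  rw [twist, if_neg hi]

theorem twist_twist (T₀ : Tables k k (c - 1)) (x : Key k c) : twist T₀ (twist T₀ x) = x := by
  funext i
  by_cases hi : (i : ℕ) + 1 = c
  · have h : (fun j : Fin (c - 1) =>
        twist T₀ x ⟨(j : ℕ), lt_of_lt_of_le j.isLt (Nat.sub_le c 1)⟩)
        = fun j : Fin (c - 1) => x ⟨(j : ℕ), lt_of_lt_of_le j.isLt (Nat.sub_le c 1)⟩ := by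
      funext j
      have hj := j.isLt
      exact twist_val_of_ne T₀ x ⟨(j : ℕ), by omega⟩ (by dsimp only; omega)
    rw [twist_val_last T₀ _ i hi, h, twist_val_last T₀ x i hi, add_assoc,
      add_self_bits, add_zero]
  · rw [twist_val_of_ne T₀ _ i hi, twist_val_of_ne T₀ x i hi]

/-- For fixed tables the twist is a permutation of the keys. -/
def twistEquiv (T₀ : Tables k k (c - 1)) : Key k c ≃ Key k c where
  toFun := twist T₀
  invFun := twist T₀
  left_inv := twist_twist T₀
  right_inv := twist_twist T₀

/-- The twist is an involution for fixed tables, so substituting `twist T₀ x` for `x` moves it from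
the hash function into the selector. -/
theorem twistedFailProb_eq (d : ℕ) (f : Key k c → BitString r → Bool) :
    twistedFailProb d f = avg fun T₀ : Tables k k (c - 1) =>
      simpleFailProb d fun x v => f (twist T₀ x) v := by
  rw [twistedFailProb, uniformProb_eq_avg, avg_prod]
  refine congrArg avg (funext fun T₀ => ?_)
  rw [simpleFailProb, uniformProb_eq_avg]
  refine congrArg avg (funext fun ω => ?_)
  have h : (fun x => derivedKey d ω.1 (twist T₀ x)) ''
      selected f (fun x => simpleTab ω.2 (derivedKey d ω.1 (twist T₀ x))) =
      derivedKey d ω.1 '' selected (fun x v => f (twist T₀ x) v)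
        (fun x => simpleTab ω.2 (derivedKey d ω.1 x)) := by
    ext y
    constructor
    · rintro ⟨x, hx, rfl⟩
      refine ⟨twist T₀ x, ?_, rfl⟩
      simpa only [selected, Set.mem_ofPred_eq, twist_twist] using hx
    · rintro ⟨x, hx, rfl⟩
      refine ⟨twist T₀ x, ?_, by simp only [twist_twist]⟩
      simpa only [selected, Set.mem_ofPred_eq, twist_twist] using hx
  simp only [h]

/-- For each fixed twist the new selector has the same expected size, and its keys of probability p
form a permuted copy of `A`; the simple case applies and is averaged. -/
theorem twistedFailProb_le_failBound (i : ℕ) (f : Key k c → BitString r → Bool)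
    (A : Finset (Key k c)) (hA : A.Nonempty) {p : ℝ} (hp : ∀ x ∈ A, selProb f x = p)
    (hp' : ∀ x ∉ A, selProb f x = 0) (hμ : expectedSize f ≤ (2 ^ k : ℝ) / 2) :
    twistedFailProb (i + 2) f ≤ failBound (2 ^ k) A.card (expectedSize f) c (i + 2) := by
  rw [twistedFailProb_eq]
  refine avg_le_of_le fun T₀ => ?_
  have hsize : expectedSize (fun x v => f (twist T₀ x) v) = expectedSize f :=
    Equiv.sum_comp (twistEquiv T₀) (selProb f)
  have hmem : ∀ x, x ∈ A.map (twistEquiv T₀).toEmbedding ↔ twist T₀ x ∈ A := fun x => by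
    rw [Finset.mem_map_equiv]; rfl
  have h := simpleFailProb_le_failBound i (fun x v => f (twist T₀ x) v)
    (A.map (twistEquiv T₀).toEmbedding) (hA.map) (p := p)
    (fun x hx => hp _ ((hmem x).1 hx)) (fun x hx => hp' _ fun h => hx ((hmem x).2 h))
    (hsize ▸ hμ)
  rwa [Finset.card_map, hsize] at h

end main

end Tornado

open Tornado in
theorem mainTheorem3 (k r c d : ℕ) (hd : 2 ≤ d)
    (A : Finset (Key k c)) (hA : A.Nonempty)
    (f : Key k c → BitString r → Bool) (p : ℝ)
    (hp : ∀ x ∈ A, selProb f x = p) (hp' : ∀ x ∉ A, selProb f x = 0)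
    (hμ : expectedSize f ≤ (Fintype.card (BitString k) : ℝ) / 2) :
    simpleFailProb d f
        ≤ failBound (Fintype.card (BitString k)) A.card (expectedSize f) c d ∧
      twistedFailProb d f
        ≤ failBound (Fintype.card (BitString k)) A.card (expectedSize f) c d := by
  obtain ⟨i, rfl⟩ : ∃ i, d = i + 2 := ⟨d - 2, by omega⟩
  have hs : ((Fintype.card (BitString k) : ℕ) : ℝ) = 2 ^ k := by
    rw [card_bitString]; push_cast; rfl
  rw [hs] at hμ ⊢
  exact ⟨simpleFailProb_le_failBound i f A hA hp hp' hμ,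
    twistedFailProb_le_failBound i f A hA hp hp' hμ⟩
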